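/- Let $n\ge 2$, let $\Omega\subset\mathbb R^n$ be a bounded domain (open, connected) with Lipschitz boundary, and let $1<p<\infty$. For $i=1,2$ let $A_i$ be an open set, possibly empty, with Lipschitz boundary and finitely many connected components, such that $\overline{A_i}\subset\Omega$ and $B_i:=\Omega\setminus\overline{A_i}$ is connected. Let $\sigma_i(x,E)\in[0,+\infty]$ ($x\in\Omega$, $E>0$) satisfy (P1) on each of $A_i$, $B_i$, $\sigma_i$ is measurable in $x$ for every $E>0$ and continuous in $E>0$ for a.e. $x$; (P2) there are constants $0<\underline\sigma\le\overline\sigma$ and $E_0>0$ such that for a.e. $x\in B_i$ and all $E>0$ one has $\underline\sigma(E/E_0)^{p-2}\le\sigma_i(x,E)$, and $\sigma_i(x,E)\le\overline\sigma[1+(E/E_0)^{p-2}]$ if $p\ge2$, $\sigma_i(x,E)\le\overline\sigma(E/E_0)^{p-2}$ if $p<2$; (P3) there is $\kappa>0$ such that for a.e. $x\in B_i$ and all $\xi_1,\xi_2\in\mathbb R^n$ the quantity $(\sigma_i(x,|\xi_2|)\xi_2-\sigma_i(x,|\xi_1|)\xi_1)\cdot(\xi_2-\xi_1)$ is at least $\kappa|\xi_2-\xi_1|^p$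 if $p\ge2$, and at least $\kappa(1+|\xi_2|^2+|\xi_1|^2)^{\frac{p-2}2}|\xi_2-\xi_1|^2$ if $p<2$ (with $\sigma_i(x,|\xi|)\xi:=0$ for $\xi=0$). Assume that one of the following holds: (i) $A_1=A_2=\emptyset$; (ii) for $i=1,2$ there is $1<q_i<\infty$ such that the conditions in (P2), (P3) hold on $A_i$ with $q_i$ in place of $p$ (and possibly other constants); (iii) (PEI) $\sigma_i=0$ a.e. on $A_i$ for all $E>0$, $i=1,2$; (iv) (PEC) $\sigma_i=+\infty$ a.e. on $A_i$ for all $E>0$, $i=1,2$. Let $X^p(\partial\Omega)=W^{1,p}(\Omega)/W^{1,p}_0(\Omega)$ be the trace space and $X^p_\diamond(\partial\Omega)$ the set of its elements whose trace has mean zero on $\partial\Omega$ with respect to the $(n-1)$-dimensional Hausdorff measure. Write $(\sigma,A,B,q)$ for $(\sigma_i,A_i,B_i,q_i)$ and put $Q_\sigma(x,E)=\int_0^E\sigma(x,\xi)\,\xi\,d\xi$. For a boundary datum $g\in X^p(\partial\Omega)$ let $u^g$ be the minimizer of the Dirichlet energy $\int_D Q_\sigma(x,|\nabla u|)\,dx$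 among all $u$ with $u=g$ on $\partial\Omega$ such that: $D=\Omega$ and $u\in W^{1,p}(\Omega)$ in case (i); $D=\Omega$ and $u\in W^{1,\min\{p,q\}}(\Omega)$ in case (ii); $D=B$ and $u\in W^{1,p}(B)$ in case (iii); $D=B$, $u\in W^{1,p}(\Omega)$ and $\nabla u=0$ a.e. in $A$ in case (iv). Here $u=g$ on $\partial\Omega$ means that $u-g$ is a limit, in the norm of the Sobolev space in question, of $C^1$ functions with compact support in $\Omega$. The Dirichlet-to-Neumann operator is given in weak form by $$\langle\Lambda_\sigma(g),\varphi\rangle=\int_D\sigma(x,|\nabla u^g|)\,\nabla u^g\cdot\nabla w\,dx,$$ where $w$ is any function in the same class with $w=\varphi$ on $\partial\Omega$ (in case (ii) with, in addition, $w\in W^{1,p}(B)$ and $w\in W^{1,q}(A)$), and the average DtN operator by $\langle\overline\Lambda_\sigma(g),\varphi\rangle=\int_0^1\langle\Lambda_\sigma(\alpha g),\varphi\rangle\,d\alpha$. If $\sigma_1(x,E)\le\sigma_2(x,E)$ for a.e. $x\in\Omega$ and all $E>0$, then for every $f\in X^p_\diamond(\partial\Omega)$ the quantities $\langle\overline\Lambda_{\sigma_i}(f),f\rangle$,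 $i=1,2$, are well defined (the values $\langle\Lambda_{\sigma_i}(\alpha f),f\rangle$, $0\le\alpha\le1$, exist, are uniquely determined, and are integrable in $\alpha$), and $$\langle\overline\Lambda_{\sigma_1}(f),f\rangle\le\langle\overline\Lambda_{\sigma_2}(f),f\rangle .$$ -/

import Mathlib

open MeasureTheory Set
open scoped ENNReal NNReal ContDiff

noncomputable section

/-- `ℝⁿ` with the Euclidean norm. -/
abbrev Rn (n : ℕ) : Type := EuclideanSpace ℝ (Fin n)

/-! ### Geometry -/

/-- `U` has Lipschitz boundary: near each boundary point, in suitable orthogonal coordinates with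
last axis `e`, the set `U` is the strict epigraph of a Lipschitz function of the coordinates
orthogonal to `e`. -/
def HasLipschitzBoundary {n : ℕ} (U : Set (Rn n)) : Prop :=
  ∀ x ∈ frontier U, ∃ e : Rn n, ‖e‖ = 1 ∧ ∃ r : ℝ, 0 < r ∧
    ∃ (K : ℝ≥0) (γ : Rn n → ℝ), LipschitzWith K γ ∧
      ∀ y ∈ Metric.ball x r, (y ∈ U ↔ γ (y - inner ℝ y e • e) < inner ℝ y e)

/-- Bounded domain with Lipschitz boundary. -/
structure IsLipschitzDomain {n : ℕ} (Ω : Set (Rn n)) : Prop where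
  isOpen : IsOpen Ω
  isBounded : Bornology.IsBounded Ω
  isConnected : IsConnected Ω
  lipschitz : HasLipschitzBoundary Ω

/-- The region `B = Ω \ closure A` outside the inclusion. -/
def outer {n : ℕ} (Ω A : Set (Rn n)) : Set (Rn n) := Ω \ closure A

/-- `A` is an open set with Lipschitz boundary, compactly contained in `Ω`, with finitely many
connected components, whose complement in `Ω` is still a domain. `A = ∅` is allowed. -/
structure IsInclusion {n : ℕ} (Ω A : Set (Rn n)) : Prop where
  isOpen : IsOpen A
  closure_subset : closure A ⊆ Ω
  lipschitz : HasLipschitzBoundary A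
  finite_components : Finite (ConnectedComponents A)
  outer_connected : IsConnected (outer Ω A)

/-! ### Sobolev spaces -/

/-- `g` is the weak gradient of `u` on the open set `U`. -/
def HasWeakGrad {n : ℕ} (U : Set (Rn n)) (u : Rn n → ℝ) (g : Rn n → Rn n) : Prop :=
  LocallyIntegrableOn u U ∧ LocallyIntegrableOn g U ∧
    ∀ φ : Rn n → ℝ, ContDiff ℝ ∞ φ → HasCompactSupport φ → tsupport φ ⊆ U →
      ∀ v : Rn n, ∫ x in U, u x * fderiv ℝ φ x v = -∫ x in U, φ x * inner ℝ (g x) v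

open Classical in
/-- The weak gradient of `u` on `U` (determined up to null sets; `0` if there is none). -/
def weakGrad {n : ℕ} (U : Set (Rn n)) (u : Rn n → ℝ) : Rn n → Rn n :=
  if h : ∃ g, HasWeakGrad U u g then h.choose else 0

/-- `u ∈ W^{1,p}(U)`. -/
def MemW {n : ℕ} (U : Set (Rn n)) (p : ℝ) (u : Rn n → ℝ) : Prop :=
  (∃ g, HasWeakGrad U u g) ∧
    MemLp u (ENNReal.ofReal p) (volume.restrict U) ∧
    MemLp (weakGrad U u) (ENNReal.ofReal p) (volume.restrict U)

/-- `v ∈ W^{1,p}(U)` vanishes on `∂Ω`, where `U ⊆ Ω`: it is a limit, in the norm of `W^{1,p}(U)`,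
of `C¹` functions with compact support in `Ω`. For `U = Ω` this is `v ∈ W₀^{1,p}(Ω)`; for
`U = Ω \ closure A` nothing is imposed on `∂A`. -/
def VanishesOnBoundary {n : ℕ} (Ω U : Set (Rn n)) (p : ℝ) (v : Rn n → ℝ) : Prop :=
  MemW U p v ∧ ∀ ε : ℝ≥0∞, 0 < ε → ∃ φ : Rn n → ℝ,
    ContDiff ℝ 1 φ ∧ HasCompactSupport φ ∧ tsupport φ ⊆ Ω ∧
    eLpNorm (fun x => v x - φ x) (ENNReal.ofReal p) (volume.restrict U) < ε ∧
    eLpNorm (fun x => weakGrad U v x - gradient φ x) (ENNReal.ofReal p) (volume.restrict U) < ε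

/-- The surface measure on `∂Ω`: the `(n-1)`-dimensional Hausdorff measure. -/
def surfaceMeasure {n : ℕ} (Ω : Set (Rn n)) : Measure (Rn n) :=
  (Measure.hausdorffMeasure ((n : ℝ) - 1)).restrict (frontier Ω)

/-- `g ∈ L^p(∂Ω)` is the trace of `f ∈ W^{1,p}(Ω)`: both are limits, in the respective norms, of the
same `C¹` functions on `ℝⁿ`. -/
def HasTrace {n : ℕ} (Ω : Set (Rn n)) (p : ℝ) (f g : Rn n → ℝ) : Prop :=
  MemLp g (ENNReal.ofReal p) (surfaceMeasure Ω) ∧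
    ∀ ε : ℝ≥0∞, 0 < ε → ∃ φ : Rn n → ℝ, ContDiff ℝ 1 φ ∧
      eLpNorm (fun x => f x - φ x) (ENNReal.ofReal p) (volume.restrict Ω) < ε ∧
      eLpNorm (fun x => weakGrad Ω f x - gradient φ x) (ENNReal.ofReal p)
        (volume.restrict Ω) < ε ∧
      eLpNorm (fun x => g x - φ x) (ENNReal.ofReal p) (surfaceMeasure Ω) < ε

/-- `f` represents an element of `X^p_⋄(∂Ω)`. Elements of the trace space `X^p(∂Ω)` are functions in
`W^{1,p}(Ω)` modulo `W₀^{1,p}(Ω)`; the subscript requires mean zero on `∂Ω`. -/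
def MemXDiamond {n : ℕ} (Ω : Set (Rn n)) (p : ℝ) (f : Rn n → ℝ) : Prop :=
  MemW Ω p f ∧ ∃ g, HasTrace Ω p f g ∧ ∫ x, g x ∂(surfaceMeasure Ω) = 0

/-! ### Conductivities

A conductivity is a function `σ : ℝⁿ → ℝ → [0,∞]` of position and field strength; only its values
at `x ∈ Ω`, `E > 0` matter, and the value `∞` occurs there only in perfect conductors. -/

/-- Carathéodory condition on `S`. -/
def IsCaratheodoryOn {n : ℕ} (S : Set (Rn n)) (σ : Rn n → ℝ → ℝ≥0∞) : Prop :=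
  (∀ E : ℝ, 0 < E → AEMeasurable (fun x => σ x E) (volume.restrict S)) ∧
    ∀ᵐ x ∂(volume.restrict S), ContinuousOn (σ x) (Ioi 0)

/-- `σ` has `r`-growth on `S`. -/
def HasGrowthOn {n : ℕ} (r : ℝ) (S : Set (Rn n)) (σ : Rn n → ℝ → ℝ≥0∞) : Prop :=
  ∃ a b E₀ : ℝ, 0 < a ∧ a ≤ b ∧ 0 < E₀ ∧ ∀ᵐ x ∂(volume.restrict S), ∀ E : ℝ, 0 < E →
    ENNReal.ofReal (a * (E / E₀) ^ (r - 2)) ≤ σ x E ∧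
    σ x E ≤ if 2 ≤ r then ENNReal.ofReal (b * (1 + (E / E₀) ^ (r - 2)))
      else ENNReal.ofReal (b * (E / E₀) ^ (r - 2))

/-- The vector field `ξ ↦ σ(x,|ξ|) ξ`. -/
def flux {n : ℕ} (σ : Rn n → ℝ → ℝ≥0∞) (x ξ : Rn n) : Rn n := (σ x ‖ξ‖).toReal • ξ

/-- `ξ ↦ σ(x,|ξ|) ξ` is strongly monotone of exponent `r` for a.e. `x ∈ S`. -/
def IsStronglyMonotoneOn {n : ℕ} (r : ℝ) (S : Set (Rn n)) (σ : Rn n → ℝ → ℝ≥0∞) : Prop :=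
  ∃ κ : ℝ, 0 < κ ∧ ∀ᵐ x ∂(volume.restrict S), ∀ ξ₁ ξ₂ : Rn n,
    (if 2 ≤ r then κ * ‖ξ₂ - ξ₁‖ ^ r
      else κ * (1 + ‖ξ₂‖ ^ 2 + ‖ξ₁‖ ^ 2) ^ ((r - 2) / 2) * ‖ξ₂ - ξ₁‖ ^ 2)
      ≤ inner ℝ (flux σ x ξ₂ - flux σ x ξ₁) (ξ₂ - ξ₁)

/-- The kind of material in the inclusion: no inclusion, a material with `q`-growth, a perfect
insulator (PEI), or a perfect conductor (PEC). -/
inductive Phase where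
  | empty : Phase
  | growth (q : ℝ) : Phase
  | insulator : Phase
  | conductor : Phase

/-- The material in `A` is of the kind `k`. -/
def IsPhase {n : ℕ} (k : Phase) (A : Set (Rn n)) (σ : Rn n → ℝ → ℝ≥0∞) : Prop :=
  match k with
  | .empty => A = ∅
  | .growth q => 1 < q ∧ HasGrowthOn q A σ ∧ IsStronglyMonotoneOn q A σ
  | .insulator => ∀ᵐ x ∂(volume.restrict A), ∀ E : ℝ, 0 < E → σ x E = 0
  | .conductor => ∀ᵐ x ∂(volume.restrict A), ∀ E : ℝ, 0 < E → σ x E = ⊤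

/-- `σ` satisfies (P1), (P2), (P3) outside `A`, and the material in `A` is of the kind `k`. -/
structure IsConductivity {n : ℕ} (p : ℝ) (k : Phase) (Ω A : Set (Rn n))
    (σ : Rn n → ℝ → ℝ≥0∞) : Prop where
  caratheodory_outer : IsCaratheodoryOn (outer Ω A) σ
  caratheodory_inner : IsCaratheodoryOn A σ
  growth : HasGrowthOn p (outer Ω A) σ
  monotone : IsStronglyMonotoneOn p (outer Ω A) σ
  phase : IsPhase k A σ

/-! ### The variational problem -/

/-- The set on which the potential is defined: `Ω`, or `Ω \ closure A` for an insulator. -/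
def potentialDomain {n : ℕ} (k : Phase) (Ω A : Set (Rn n)) : Set (Rn n) :=
  match k with
  | .insulator => outer Ω A
  | _ => Ω

/-- The set over which the energy is integrated: `Ω`, or `Ω \ closure A` for an insulator or a
perfect conductor. -/
def energyDomain {n : ℕ} (k : Phase) (Ω A : Set (Rn n)) : Set (Rn n) :=
  match k with
  | .insulator => outer Ω A
  | .conductor => outer Ω A
  | _ => Ω

/-- The gradient of a potential. -/
def potentialGrad {n : ℕ} (k : Phase) (Ω A : Set (Rn n)) (u : Rn n → ℝ) : Rn n → Rn n :=
  weakGrad (potentialDomain k Ω A) u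

/-- The competitors `u` with `u = f` on `∂Ω`. For a `q`-growth inclusion,
`W^{1,p}(Ω) ∪ W^{1,q}(Ω) = W^{1, min p q}(Ω)`, and likewise for `W₀`, since `Ω` is bounded. -/
def IsAdmissible {n : ℕ} (p : ℝ) (k : Phase) (Ω A : Set (Rn n)) (f u : Rn n → ℝ) : Prop :=
  match k with
  | .empty => MemW Ω p u ∧ VanishesOnBoundary Ω Ω p (u - f)
  | .growth q => MemW Ω (min p q) u ∧ VanishesOnBoundary Ω Ω (min p q) (u - f)
  | .insulator => MemW (outer Ω A) p u ∧ VanishesOnBoundary Ω (outer Ω A) p (u - f)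
  | .conductor => MemW Ω p u ∧ VanishesOnBoundary Ω Ω p (u - f) ∧
      ∀ᵐ x ∂(volume.restrict A), weakGrad Ω u x = 0

/-- `Q_σ(x,E) = ∫₀^E σ(x,ξ) ξ dξ`. -/
def energyDensity {n : ℕ} (σ : Rn n → ℝ → ℝ≥0∞) (x : Rn n) (E : ℝ) : ℝ≥0∞ :=
  ∫⁻ ξ in Ioc 0 E, σ x ξ * ENNReal.ofReal ξ

/-- The Dirichlet energy of `u`. -/
def dirichletEnergy {n : ℕ} (k : Phase) (Ω A : Set (Rn n)) (σ : Rn n → ℝ → ℝ≥0∞)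
    (u : Rn n → ℝ) : ℝ≥0∞ :=
  ∫⁻ x in energyDomain k Ω A, energyDensity σ x ‖potentialGrad k Ω A u x‖

/-- `u` is the potential `u^f`: it minimizes the Dirichlet energy among the competitors. -/
def IsPotential {n : ℕ} (p : ℝ) (k : Phase) (Ω A : Set (Rn n)) (σ : Rn n → ℝ → ℝ≥0∞)
    (f u : Rn n → ℝ) : Prop :=
  IsAdmissible p k Ω A f u ∧
    ∀ v, IsAdmissible p k Ω A f v → dirichletEnergy k Ω A σ u ≤ dirichletEnergy k Ω A σ v

/-! ### The Dirichlet-to-Neumann operator -/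

/-- `w` is an extension of the boundary datum `φ` usable as a test function. -/
def IsTestExtension {n : ℕ} (p : ℝ) (k : Phase) (Ω A : Set (Rn n)) (φ w : Rn n → ℝ) : Prop :=
  IsAdmissible p k Ω A φ w ∧
    match k with
    | .growth q => MemW (outer Ω A) p w ∧ MemW A q w
    | _ => True

/-- `ℓ = ⟨Λ_σ(f), φ⟩`: the boundary integral `∫_{∂Ω} φ σ(x,|∇u^f|) ∂ₙu^f dS` in its weak sense
`∫ σ(x,|∇u^f|) ∇u^f · ∇w dx`, the same for every extension `w` of `φ`. -/
def IsDtNValue {n : ℕ} (p : ℝ) (k : Phase) (Ω A : Set (Rn n)) (σ : Rn n → ℝ → ℝ≥0∞)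
    (f φ : Rn n → ℝ) (ℓ : ℝ) : Prop :=
  ∃ u, IsPotential p k Ω A σ f u ∧ ∀ w, IsTestExtension p k Ω A φ w →
    IntegrableOn (fun x => inner ℝ (flux σ x (potentialGrad k Ω A u x)) (potentialGrad k Ω A w x))
      (energyDomain k Ω A) ∧
    ∫ x in energyDomain k Ω A,
      inner ℝ (flux σ x (potentialGrad k Ω A u x)) (potentialGrad k Ω A w x) = ℓ

/-- `⟨Λ_σ(f), φ⟩`. -/
def dtn {n : ℕ} (p : ℝ) (k : Phase) (Ω A : Set (Rn n)) (σ : Rn n → ℝ → ℝ≥0∞)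
    (f φ : Rn n → ℝ) : ℝ :=
  Classical.epsilon (IsDtNValue p k Ω A σ f φ)

/-- The average DtN operator: `⟨Λ̄_σ(f), φ⟩ = ∫₀¹ ⟨Λ_σ(α f), φ⟩ dα`. -/
def avgDtN {n : ℕ} (p : ℝ) (k : Phase) (Ω A : Set (Rn n)) (σ : Rn n → ℝ → ℝ≥0∞)
    (f φ : Rn n → ℝ) : ℝ :=
  ∫ α in (0 : ℝ)..1, dtn p k Ω A σ (α • f) φ

/-- `⟨Λ̄_σ(f), φ⟩` is meaningful: each `⟨Λ_σ(α f), φ⟩` exists and is uniquely determined, and it is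
integrable in `α`. -/
def AvgDtNWellDefined {n : ℕ} (p : ℝ) (k : Phase) (Ω A : Set (Rn n)) (σ : Rn n → ℝ → ℝ≥0∞)
    (f φ : Rn n → ℝ) : Prop :=
  (∀ α ∈ Icc (0 : ℝ) 1, ∃! ℓ, IsDtNValue p k Ω A σ (α • f) φ ℓ) ∧
    IntervalIntegrable (fun α : ℝ => dtn p k Ω A σ (α • f) φ) volume 0 1

end

/-! ### Subgradients of functions of one real variable -/

/-! Let `E a` be the minimal Dirichlet energy for the datum `a • f`. The flux `ξ ↦ σ(x,|ξ|) ξ` is a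
gradient of the convex density `Q_σ(x,|ξ|)`, and the Euler–Lagrange equation makes `⟨Λ_σ(a f), f⟩` a
subgradient of `E` at `a`. A subgradient is monotone, hence integrable, and integrates to the
increment of `E`. Since `E 0 = 0`, the average form `⟨Λ̄_σ(f), f⟩` equals `E 1`, the minimal energy
for `f` (`IsMaterial.integral_ray`, `avgDtN_eq_energy`). It remains to compare minimal energies: the
potential of `σ₂` is turned into a competitor for `σ₁` with no larger energy.

Without inclusions the potential itself serves. For insulators `σ₁ ≤ σ₂` forces `A₂ ⊆ closure A₁`,
and the potential is restricted to the smaller exterior region. For conductors it forces `A₁ ⊆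
closure A₂`, so a gradient that vanishes on `A₂` vanishes a.e. on `A₁`. For growth inclusions the
two Sobolev exponents may differ: finite energy improves the integrability of the gradient, and
`IsGradLimit.of_memLp` improves the sense in which the boundary values are attained
(`exists_isAdmissible_growth`).

Existence and uniqueness of potentials are proved once for all cases, for vector fields with a
pointwise exponent `r x`. Strong monotonicity yields a uniform convexity estimate,
`IsMaterial.integral_rpow_sub_le`: almost minimizers are close in the modular `∫ |G| ^ r`. So
minimizing sequences converge strongly and no weak compactness is needed. Fields are converted back
into functions by Poincaré's inequality on `Ω \ closure A` for functions vanishing near `∂Ω` only,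
which is obtained by translating balls through the connected exterior. The four kinds of inclusion
are instances of one structure, `IsFrame`. -/

theorem monotone_of_subgradient {E l : ℝ → ℝ} (h : ∀ a b, E a + (b - a) * l a ≤ E b) :
    Monotone l := by
  intro a b hab
  rcases hab.eq_or_lt with rfl | hlt
  · rfl
  · have h1 := h a b
    have h2 := h b a
    have h3 : 0 ≤ (b - a) * (l b - l a) := by linarith
    have := nonneg_of_mul_nonneg_right h3 (sub_pos.2 hlt)
    linarith

/-- The inequalities from `a` to `b` and from `b` to `a` place `E b - E a - (b - a) * l a` between
`0` and `(b - a) * (l b - l a)`, which is `o(b - a)` where `l` is continuous. -/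
theorem hasDerivAt_of_subgradient {E l : ℝ → ℝ} (h : ∀ a b, E a + (b - a) * l a ≤ E b) {a : ℝ}
    (hl : ContinuousAt l a) : HasDerivAt E (l a) a := by
  rw [hasDerivAt_iff_isLittleO, Asymptotics.isLittleO_iff]
  intro c hc
  have := Metric.continuousAt_iff.1 hl c hc
  obtain ⟨δ, hδ, hd⟩ := this
  filter_upwards [Metric.ball_mem_nhds a hδ] with b hb
  have h1 := h a b
  have h2 := h b a
  have h3 : |l b - l a| ≤ c := (hd hb).le
  have h4 : (b - a) * (l b - l a) ≤ |b - a| * c :=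
    (le_abs_self _).trans (by rw [abs_mul]; gcongr)
  simp only [Real.norm_eq_abs, smul_eq_mul]
  rw [abs_of_nonneg (by linarith)]
  linarith

/-- By monotonicity `l` is bounded on `[a - 1, a + 1]` by its values at the endpoints, and a bounded
subgradient gives a Lipschitz estimate. -/
theorem continuous_of_subgradient {E l : ℝ → ℝ} (h : ∀ a b, E a + (b - a) * l a ≤ E b) :
    Continuous E := by
  have hm := monotone_of_subgradient h
  rw [continuous_iff_continuousAt]
  intro a
  rw [Metric.continuousAt_iff]
  intro ε hε
  set M := |l (a - 1)| + |l (a + 1)| + 1 with hM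
  have hMpos : 0 < M := by positivity
  refine ⟨min 1 (ε / M), by positivity, fun {b} hb => ?_⟩
  have hb1 : |b - a| < 1 := lt_of_lt_of_le hb (min_le_left _ _)
  have hb2 : |b - a| < ε / M := lt_of_lt_of_le hb (min_le_right _ _)
  have bd : ∀ x, |x - a| ≤ 1 → |l x| ≤ M := by
    intro x hx
    have hx' := abs_le.1 hx
    have h1 := hm (show a - 1 ≤ x by linarith)
    have h2 := hm (show x ≤ a + 1 by linarith)
    rw [abs_le]
    constructor
    · have := neg_abs_le (l (a - 1)); have := abs_nonneg (l (a + 1)); linarith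
    · have := le_abs_self (l (a + 1)); have := abs_nonneg (l (a - 1)); linarith
  have h1 := h a b
  have h2 := h b a
  have ha := bd a (by simp)
  have hb' := bd b hb1.le
  have e1 : |(b - a) * l a| ≤ |b - a| * M := by rw [abs_mul]; gcongr
  have e2 : |(b - a) * l b| ≤ |b - a| * M := by rw [abs_mul]; gcongr
  have h5 : |b - a| * M < ε := (lt_div_iff₀ hMpos).1 hb2
  rw [Real.dist_eq, abs_lt]
  have := neg_abs_le ((b - a) * l a)
  have := le_abs_self ((b - a) * l b)
  constructor <;> linarith

/-- A monotone `l` is integrable and has countably many discontinuities; elsewhere `E` has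
derivative `l`, and `E` is continuous. The fundamental theorem of calculus tolerates a countable
exceptional set. -/
theorem integral_subgradient {E l : ℝ → ℝ} (h : ∀ a b, E a + (b - a) * l a ≤ E b) (a b : ℝ) :
    IntervalIntegrable l volume a b ∧ ∫ x in a..b, l x = E b - E a := by
  have hm := monotone_of_subgradient h
  have hi : IntervalIntegrable l volume a b := hm.intervalIntegrable
  refine ⟨hi, integral_eq_of_hasDerivAt_off_countable E l hm.countable_not_continuousAt
    (continuous_of_subgradient h).continuousOn (fun x hx => ?_) hi⟩
  exact hasDerivAt_of_subgradient h (not_not.1 hx.2)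

/-! ### Integral functionals with variable exponent -/

section Variational

set_option linter.unusedSectionVars false

variable {X H : Type*} [MeasurableSpace X] [NormedAddCommGroup H] [InnerProductSpace ℝ H]

/-- Structural assumptions on a flux `Φ` that is the gradient of a convex density `Q`, with growth
of exponent `r x` at the point `x`. -/
structure IsMaterial (μ : Measure X) (r : X → ℝ) (Φ : X → H → H) (Q : X → H → ℝ) : Prop where
  exponent_measurable : Measurable r
  exponent_bounds : ∃ b, ∀ x, 1 ≤ r x ∧ r x ≤ b
  flux_aestronglyMeasurable : ∀ G : X → H, AEStronglyMeasurable G μ →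
    AEStronglyMeasurable (fun x => Φ x (G x)) μ
  density_aemeasurable : ∀ G : X → H, AEStronglyMeasurable G μ →
    AEMeasurable (fun x => Q x (G x)) μ
  flux_zero : ∀ᵐ x ∂μ, Φ x 0 = 0
  flux_continuous : ∀ᵐ x ∂μ, Continuous (Φ x)
  density_nonneg : ∀ᵐ x ∂μ, ∀ ξ, 0 ≤ Q x ξ
  density_zero : ∀ᵐ x ∂μ, Q x 0 = 0
  convex : ∀ᵐ x ∂μ, ∀ ξ η, Q x ξ + inner ℝ (Φ x ξ) (η - ξ) ≤ Q x η
  flux_bound : ∃ C : ℝ, 0 ≤ C ∧ ∀ᵐ x ∂μ, ∀ ξ η,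
    |inner ℝ (Φ x ξ) η| ≤ C * (1 + ‖ξ‖ ^ r x + ‖η‖ ^ r x)
  -- The small error term is there for exponents below 2, where the weight in (P3) degenerates at
  -- infinity and does not bound `‖η - ξ‖ ^ r` by the pairing alone.
  strong : ∀ ε : ℝ, 0 < ε → ∃ C : ℝ, 0 ≤ C ∧ ∀ᵐ x ∂μ, ∀ ξ η,
    ‖η - ξ‖ ^ r x ≤ ε * (1 + ‖ξ‖ ^ r x + ‖η‖ ^ r x) + C * inner ℝ (Φ x η - Φ x ξ) (η - ξ)

/-- `G` is a field with finite modular `∫ |G x| ^ r x`. -/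
def MemModular (μ : Measure X) (r : X → ℝ) (G : X → H) : Prop :=
  AEStronglyMeasurable G μ ∧ Integrable (fun x => ‖G x‖ ^ r x) μ

/-- The energy of a field. -/
noncomputable def energy (μ : Measure X) (Q : X → H → ℝ) (G : X → H) : ℝ≥0∞ :=
  ∫⁻ x, ENNReal.ofReal (Q x (G x)) ∂μ

/-- `G` minimizes the energy in the class `a • w + 𝒢`. -/
def IsEnergyMin (μ : Measure X) (Q : X → H → ℝ) (𝒢 : Submodule ℝ (X → H)) (w : X → H) (a : ℝ)
    (G : X → H) : Prop :=
  G - a • w ∈ 𝒢 ∧ ∀ G', G' - a • w ∈ 𝒢 → energy μ Q G ≤ energy μ Q G'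

theorem rpow_norm_le_add_of_norm_le_max {ξ a b : H} {s : ℝ} (hs : 0 ≤ s)
    (h : ‖ξ‖ ≤ max ‖a‖ ‖b‖) : ‖ξ‖ ^ s ≤ ‖a‖ ^ s + ‖b‖ ^ s := by
  have h0 : (0 : ℝ) ≤ ‖a‖ ^ s := by positivity
  have h1 : (0 : ℝ) ≤ ‖b‖ ^ s := by positivity
  calc ‖ξ‖ ^ s ≤ (max ‖a‖ ‖b‖) ^ s := by gcongr
    _ ≤ ‖a‖ ^ s + ‖b‖ ^ s := by
      rcases max_cases ‖a‖ ‖b‖ with ⟨h, _⟩ | ⟨h, _⟩ <;> rw [h] <;> linarith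

/-- The constant depends only on an upper bound `B` of the exponent, so it serves all points of a
variable-exponent field at once. -/
theorem rpow_norm_add_le (a b : H) {s B : ℝ} (hs : 0 ≤ s) (hB : s ≤ B) :
    ‖a + b‖ ^ s ≤ 2 ^ B * (‖a‖ ^ s + ‖b‖ ^ s) := by
  have h1 : ‖(2 : ℝ)⁻¹ • (a + b)‖ ^ s ≤ ‖a‖ ^ s + ‖b‖ ^ s := by
    apply rpow_norm_le_add_of_norm_le_max hs
    rw [norm_smul]
    have := norm_add_le a b
    have := le_max_left ‖a‖ ‖b‖
    have := le_max_right ‖a‖ ‖b‖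
    rw [norm_inv, Real.norm_two]
    linarith
  have h2 : ‖a + b‖ ^ s = 2 ^ s * ‖(2 : ℝ)⁻¹ • (a + b)‖ ^ s := by
    rw [← Real.mul_rpow (by positivity) (by positivity), norm_smul, norm_inv, Real.norm_two,
      mul_inv_cancel_left₀ two_ne_zero]
  rw [h2]
  have : (2 : ℝ) ^ s ≤ 2 ^ B := Real.rpow_le_rpow_of_exponent_le (by norm_num) hB
  gcongr

namespace MemModular

variable {μ : Measure X} {r : X → ℝ} {G G' : X → H}

theorem aestronglyMeasurable_rpow (hr : Measurable r) (hG : AEStronglyMeasurable G μ) :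
    AEStronglyMeasurable (fun x => ‖G x‖ ^ r x) μ :=
  (hG.norm.aemeasurable.pow hr.aemeasurable).aestronglyMeasurable

theorem of_le (hr : Measurable r) (hG : AEStronglyMeasurable G μ) {f : X → ℝ}
    (hf : Integrable f μ) (h : ∀ᵐ x ∂μ, ‖G x‖ ^ r x ≤ f x) : MemModular μ r G := by
  refine ⟨hG, hf.mono' (aestronglyMeasurable_rpow hr hG) ?_⟩
  filter_upwards [h] with x hx
  rwa [Real.norm_of_nonneg (by positivity)]

theorem add (hr : Measurable r) {b : ℝ} (hb : ∀ x, 1 ≤ r x ∧ r x ≤ b) (h : MemModular μ r G)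
    (h' : MemModular μ r G') : MemModular μ r (G + G') :=
  of_le hr (h.1.add h'.1) ((h.2.add h'.2).const_mul (2 ^ b)) (ae_of_all _ fun x =>
    rpow_norm_add_le _ _ (by linarith [(hb x).1]) (hb x).2)

theorem const_smul (hr : Measurable r) {b : ℝ} (hb : ∀ x, 1 ≤ r x ∧ r x ≤ b) (c : ℝ)
    (h : MemModular μ r G) : MemModular μ r (c • G) := by
  refine of_le hr (h.1.const_smul c) (h.2.const_mul ((1 + |c|) ^ b)) (ae_of_all _ fun x => ?_)
  simp only [Pi.smul_apply, norm_smul, Real.norm_eq_abs]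
  rw [Real.mul_rpow (abs_nonneg _) (norm_nonneg _)]
  have h0 : (0 : ℝ) ≤ r x := by linarith [(hb x).1]
  have h1 : |c| ^ r x ≤ (1 + |c|) ^ r x := by gcongr; linarith
  have h2 : (1 + |c|) ^ r x ≤ (1 + |c|) ^ b :=
    Real.rpow_le_rpow_of_exponent_le (by linarith [abs_nonneg c]) (hb x).2
  gcongr
  exact h1.trans h2

theorem sub (hr : Measurable r) {b : ℝ} (hb : ∀ x, 1 ≤ r x ∧ r x ≤ b) (h : MemModular μ r G)
    (h' : MemModular μ r G') : MemModular μ r (G - G') := by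
  rw [sub_eq_add_neg, ← neg_one_smul ℝ G']
  exact h.add hr hb (h'.const_smul hr hb _)

end MemModular

namespace IsMaterial

variable {μ : Measure X} {r : X → ℝ} {Φ : X → H → H} {Q : X → H → ℝ}

/-- Quantitative midpoint convexity. -/
theorem midpoint (hm : IsMaterial μ r Φ Q) : ∀ᵐ x ∂μ, ∀ ξ η : H,
    2 * Q x ((2 : ℝ)⁻¹ • (ξ + η)) + 2⁻¹ *
      inner ℝ (Φ x ((4 : ℝ)⁻¹ • (ξ + (3 : ℝ) • η)) - Φ x ((4 : ℝ)⁻¹ • ((3 : ℝ) • ξ + η)))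
        ((4 : ℝ)⁻¹ • (ξ + (3 : ℝ) • η) - (4 : ℝ)⁻¹ • ((3 : ℝ) • ξ + η)) ≤ Q x ξ + Q x η := by
  filter_upwards [hm.convex] with x hx ξ η
  -- Tangent inequalities at the two quarter points, evaluated at the endpoints, and at the
  -- midpoint, evaluated at the quarter points. In the sum the two midpoint terms cancel, leaving
  -- the flux difference between the quarter points.
  have h1 := hx ((4 : ℝ)⁻¹ • ((3 : ℝ) • ξ + η)) ξ
  have h2 := hx ((2 : ℝ)⁻¹ • (ξ + η)) ((4 : ℝ)⁻¹ • ((3 : ℝ) • ξ + η))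
  have h3 := hx ((4 : ℝ)⁻¹ • (ξ + (3 : ℝ) • η)) η
  have h4 := hx ((2 : ℝ)⁻¹ • (ξ + η)) ((4 : ℝ)⁻¹ • (ξ + (3 : ℝ) • η))
  have e1 : ξ - (4 : ℝ)⁻¹ • ((3 : ℝ) • ξ + η) = -((4 : ℝ)⁻¹ • (η - ξ)) := by module
  have e2 : (4 : ℝ)⁻¹ • ((3 : ℝ) • ξ + η) - (2 : ℝ)⁻¹ • (ξ + η) = -((4 : ℝ)⁻¹ • (η - ξ)) := by
    module
  have e3 : η - (4 : ℝ)⁻¹ • (ξ + (3 : ℝ) • η) = (4 : ℝ)⁻¹ • (η - ξ) := by module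
  have e4 : (4 : ℝ)⁻¹ • (ξ + (3 : ℝ) • η) - (2 : ℝ)⁻¹ • (ξ + η) = (4 : ℝ)⁻¹ • (η - ξ) := by module
  have e5 : (4 : ℝ)⁻¹ • (ξ + (3 : ℝ) • η) - (4 : ℝ)⁻¹ • ((3 : ℝ) • ξ + η)
      = (2 : ℝ)⁻¹ • (η - ξ) := by module
  rw [e1, inner_neg_right, inner_smul_right] at h1
  rw [e2, inner_neg_right, inner_smul_right] at h2
  rw [e3, inner_smul_right] at h3
  rw [e4, inner_smul_right] at h4
  rw [e5, inner_smul_right, inner_sub_left]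
  linarith

/-- Upper bound for the density. -/
theorem density_le (hm : IsMaterial μ r Φ Q) : ∃ C : ℝ, 0 ≤ C ∧ ∀ᵐ x ∂μ, ∀ ξ,
    Q x ξ ≤ C * (1 + ‖ξ‖ ^ r x) := by
  obtain ⟨C, hC, h⟩ := hm.flux_bound
  refine ⟨2 * C, by positivity, ?_⟩
  filter_upwards [h, hm.convex, hm.density_zero] with x hx hc h0 ξ
  -- The tangent at `ξ` evaluated at `0` gives `Q x ξ ≤ ⟨Φ x ξ, ξ⟩`.
  have h1 := hc ξ 0
  rw [h0, zero_sub, inner_neg_right] at h1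
  have h2 := (le_abs_self _).trans (hx ξ ξ)
  have : 0 ≤ C * 1 := by positivity
  linarith

/-- Coercivity of the density. -/
theorem rpow_le_density (hm : IsMaterial μ r Φ Q) : ∃ C : ℝ, 0 ≤ C ∧ ∀ᵐ x ∂μ, ∀ ξ,
    ‖ξ‖ ^ r x ≤ C * (1 + Q x ξ) := by
  obtain ⟨C, hC, h⟩ := hm.strong (1 / 2) (by norm_num)
  obtain ⟨b, hb⟩ := hm.exponent_bounds
  refine ⟨2 ^ b * (1 + 2 * C), by positivity, ?_⟩
  filter_upwards [h, hm.convex, hm.flux_zero, hm.density_nonneg] with x hx hc h0 hn ξ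
  have hr0 : (0 : ℝ) < r x := by linarith [(hb x).1]
  -- The tangent at `ξ / 2` evaluated at `ξ` bounds the pairing of the flux at `ξ / 2` by `Q x ξ`;
  -- strong monotonicity between `0` and `ξ / 2` bounds the power by that pairing. With `ε = 1 / 2`
  -- the power on the right is absorbed.
  have h1 := hc ((2 : ℝ)⁻¹ • ξ) ξ
  have h2 := hx 0 ((2 : ℝ)⁻¹ • ξ)
  have e : ξ - (2 : ℝ)⁻¹ • ξ = (2 : ℝ)⁻¹ • ξ := by module
  rw [e] at h1
  simp only [sub_zero, norm_zero, Real.zero_rpow hr0.ne', h0] at h2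
  have hz : inner ℝ (Φ x ((2 : ℝ)⁻¹ • ξ)) ((2 : ℝ)⁻¹ • ξ) ≤ Q x ξ := by
    linarith [hn ((2 : ℝ)⁻¹ • ξ)]
  have h3 : ‖(2 : ℝ)⁻¹ • ξ‖ ^ r x ≤ 1 + 2 * C * Q x ξ := by
    have := mul_le_mul_of_nonneg_left hz hC
    linarith
  have h4 : ‖ξ‖ ^ r x = 2 ^ r x * ‖(2 : ℝ)⁻¹ • ξ‖ ^ r x := by
    rw [← Real.mul_rpow (by positivity) (by positivity), norm_smul, norm_inv, Real.norm_two,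
      mul_inv_cancel_left₀ two_ne_zero]
  have h5 : (2 : ℝ) ^ r x ≤ 2 ^ b := Real.rpow_le_rpow_of_exponent_le (by norm_num) (hb x).2
  have h6 : 1 + 2 * C * Q x ξ ≤ (1 + 2 * C) * (1 + Q x ξ) := by
    have := hn ξ
    linarith
  rw [h4, mul_assoc]
  gcongr
  exact h3.trans h6

/-- `Q x η` lies between the tangent at `ξ` and the expression obtained from the tangent at `η`;
both tend to `Q x ξ`. -/
theorem density_continuous (hm : IsMaterial μ r Φ Q) : ∀ᵐ x ∂μ, Continuous (Q x) := by
  filter_upwards [hm.convex, hm.flux_continuous] with x hc hf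
  rw [continuous_iff_continuousAt]
  intro ξ
  have h1 : Filter.Tendsto (fun η => Q x ξ + inner ℝ (Φ x ξ) (η - ξ)) (nhds ξ) (nhds (Q x ξ)) := by
    have : Continuous (fun η => Q x ξ + inner ℝ (Φ x ξ) (η - ξ)) := by fun_prop
    simpa using this.tendsto ξ
  have h2 : Filter.Tendsto (fun η => Q x ξ + inner ℝ (Φ x η) (η - ξ)) (nhds ξ) (nhds (Q x ξ)) := by
    have : Continuous (fun η => Q x ξ + inner ℝ (Φ x η) (η - ξ)) := by fun_prop
    simpa using this.tendsto ξ
  refine tendsto_of_tendsto_of_tendsto_of_le_of_le h1 h2 (fun η => hc ξ η) fun η => ?_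
  have := hc η ξ
  rw [← neg_sub η ξ, inner_neg_right] at this
  simp only
  linarith

variable [IsFiniteMeasure μ] {G G' φ w : X → H}

theorem integrable_density (hm : IsMaterial μ r Φ Q) (hG : MemModular μ r G) :
    Integrable (fun x => Q x (G x)) μ := by
  obtain ⟨C, hC, h⟩ := hm.density_le
  refine (((integrable_const (1 : ℝ)).add hG.2).const_mul C).mono'
    (hm.density_aemeasurable G hG.1).aestronglyMeasurable ?_
  filter_upwards [h, hm.density_nonneg] with x hx h0
  rw [Real.norm_of_nonneg (h0 _)]
  exact hx _

theorem integral_density_nonneg (hm : IsMaterial μ r Φ Q) (G : X → H) :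
    0 ≤ ∫ x, Q x (G x) ∂μ :=
  integral_nonneg_of_ae (hm.density_nonneg.mono fun _ hx => hx _)

theorem energy_eq (hm : IsMaterial μ r Φ Q) (hG : MemModular μ r G) :
    energy μ Q G = ENNReal.ofReal (∫ x, Q x (G x) ∂μ) :=
  (ofReal_integral_eq_lintegral_ofReal (hm.integrable_density hG)
    (hm.density_nonneg.mono fun _ hx => hx _)).symm

/-- Coercivity makes finite energy as strong as finite modular, so infinite-energy competitors can
be discarded and all others handled with real integrals. -/
theorem memModular_of_energy_lt_top (hm : IsMaterial μ r Φ Q) (hG : AEStronglyMeasurable G μ)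
    (h : energy μ Q G < ⊤) : MemModular μ r G := by
  obtain ⟨C, hC, hC'⟩ := hm.rpow_le_density
  have hi : Integrable (fun x => Q x (G x)) μ := by
    refine ⟨(hm.density_aemeasurable G hG).aestronglyMeasurable, ?_⟩
    rw [hasFiniteIntegral_iff_ofReal (hm.density_nonneg.mono fun _ hx => hx _)]
    exact h
  exact MemModular.of_le hm.exponent_measurable hG
    (((integrable_const (1 : ℝ)).add hi).const_mul C) (hC'.mono fun _ hx => hx _)

theorem integrable_inner (hm : IsMaterial μ r Φ Q) (hG : MemModular μ r G)
    (hφ : MemModular μ r φ) : Integrable (fun x => inner ℝ (Φ x (G x)) (φ x)) μ := by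
  obtain ⟨C, hC, h⟩ := hm.flux_bound
  refine ((((integrable_const (1 : ℝ)).add hG.2).add hφ.2).const_mul C).mono'
    ((hm.flux_aestronglyMeasurable G hG.1).inner hφ.1) ?_
  filter_upwards [h] with x hx
  exact hx _ _

/-- Two almost minimizing fields are close in modular. -/
theorem integral_rpow_sub_le (hm : IsMaterial μ r Φ Q) (K : ℝ) {ε : ℝ} (hε : 0 < ε) :
    ∃ δ : ℝ, 0 < δ ∧ ∀ (I : ℝ) (G G' : X → H), I ≤ K → MemModular μ r G → MemModular μ r G' →
      ∫ x, Q x (G x) ∂μ ≤ I + δ → ∫ x, Q x (G' x) ∂μ ≤ I + δ →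
      I ≤ ∫ x, Q x (((2 : ℝ)⁻¹ • (G + G')) x) ∂μ → ∫ x, ‖(G' - G) x‖ ^ r x ∂μ ≤ ε := by
  obtain ⟨C, hC, hlow⟩ := hm.rpow_le_density
  obtain ⟨b, hb⟩ := hm.exponent_bounds
  have hr := hm.exponent_measurable
  set m : ℝ := μ.real univ with hm0
  have hmn : 0 ≤ m := measureReal_nonneg
  -- By coercivity, `M` bounds the modular of every field of energy at most `K + 1`.
  set M : ℝ := C * (m + |K| + 1) with hM
  have hMn : 0 ≤ M := by positivity
  set B : ℝ := 2 ^ b with hB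
  have hBpos : 0 < B := by positivity
  -- This parameter makes the error term of `strong` contribute at most `ε / 2`; `δ` below makes the
  -- energy defect contribute the other half.
  obtain ⟨C', hC', hst⟩ := hm.strong (ε / (2 * B * (m + 4 * M + 1))) (by positivity)
  set e : ℝ := ε / (2 * B * (m + 4 * M + 1)) with he
  have hepos : 0 < e := by positivity
  refine ⟨min 1 (ε / (8 * B * (C' + 1))), by positivity, fun I G G' hI hG hG' h1 h2 h3 => ?_⟩
  set δ : ℝ := min 1 (ε / (8 * B * (C' + 1))) with hδ
  have hmid : MemModular μ r ((2 : ℝ)⁻¹ • (G + G')) := (hG.add hr hb hG').const_smul hr hb _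
  have bd : ∀ F : X → H, MemModular μ r F → ∫ x, Q x (F x) ∂μ ≤ I + δ →
      ∫ x, ‖F x‖ ^ r x ∂μ ≤ M := by
    intro F hF hFI
    calc ∫ x, ‖F x‖ ^ r x ∂μ ≤ ∫ x, C * (1 + Q x (F x)) ∂μ :=
          integral_mono_ae hF.2
            (((integrable_const (1 : ℝ)).add (hm.integrable_density hF)).const_mul C)
            (hlow.mono fun _ hx => hx _)
      _ = C * (m + ∫ x, Q x (F x) ∂μ) := by
          rw [integral_const_mul, integral_add (integrable_const _) (hm.integrable_density hF)]
          simp [hm0]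
      _ ≤ M := by
          rw [hM]
          have : δ ≤ 1 := min_le_left _ _
          have := le_abs_self K
          exact mul_le_mul_of_nonneg_left (by linarith) hC
  have key : ∫ x, ‖(G' - G) x‖ ^ r x ∂μ ≤ ∫ x, (B * (e * (1 + 2 * (‖G x‖ ^ r x + ‖G' x‖ ^ r x)) +
      2 * C' * (Q x (G x) + Q x (G' x) - 2 * Q x (((2 : ℝ)⁻¹ • (G + G')) x)))) ∂μ := by
    refine integral_mono_ae (hG'.sub hr hb hG).2 ?_ ?_
    · exact (((((integrable_const (1 : ℝ)).add ((hG.2.add hG'.2).const_mul 2)).const_mul e).add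
        ((((hm.integrable_density hG).add (hm.integrable_density hG')).sub
          ((hm.integrable_density hmid).const_mul 2)).const_mul (2 * C'))).const_mul B)
    · filter_upwards [hst, hm.midpoint] with x hx hmx
      have hr0 : 0 ≤ r x := by linarith [(hb x).1]
      -- Strong monotonicity is used between the quarter points: they differ by half of `G' x - G
      -- x`, their norms are at most `max ‖G x‖ ‖G' x‖`, and their flux pairing is controlled by the
      -- midpoint defect of the density.
      have h4 := hx ((4 : ℝ)⁻¹ • ((3 : ℝ) • G x + G' x)) ((4 : ℝ)⁻¹ • (G x + (3 : ℝ) • G' x))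
      have h5 := hmx (G x) (G' x)
      have nm : ∀ a b : H, ‖(4 : ℝ)⁻¹ • ((3 : ℝ) • a + b)‖ ≤ max ‖a‖ ‖b‖ := by
        intro a b
        have h1 := norm_add_le ((3 : ℝ) • a) b
        have := le_max_left ‖a‖ ‖b‖
        have := le_max_right ‖a‖ ‖b‖
        rw [norm_smul, Real.norm_of_nonneg (by norm_num : (0 : ℝ) ≤ 3)] at h1
        rw [norm_smul, Real.norm_of_nonneg (by norm_num : (0 : ℝ) ≤ 4⁻¹)]
        linarith
      have h6 := rpow_norm_le_add_of_norm_le_max hr0 (nm (G x) (G' x))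
      have h7 := rpow_norm_le_add_of_norm_le_max hr0 (nm (G' x) (G x))
      rw [add_comm ((3 : ℝ) • G' x)] at h7
      have e5 : (G' - G) x = (2 : ℝ) • ((4 : ℝ)⁻¹ • (G x + (3 : ℝ) • G' x) -
          (4 : ℝ)⁻¹ • ((3 : ℝ) • G x + G' x)) := by
        simp only [Pi.sub_apply]; module
      simp only [Pi.smul_apply, Pi.add_apply] at h5 ⊢
      set P := inner ℝ (Φ x ((4 : ℝ)⁻¹ • (G x + (3 : ℝ) • G' x)) -
        Φ x ((4 : ℝ)⁻¹ • ((3 : ℝ) • G x + G' x)))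
        ((4 : ℝ)⁻¹ • (G x + (3 : ℝ) • G' x) - (4 : ℝ)⁻¹ • ((3 : ℝ) • G x + G' x))
      rw [e5, norm_smul, Real.norm_two, Real.mul_rpow (by norm_num) (norm_nonneg _)]
      have h8 : (2 : ℝ) ^ r x ≤ B := Real.rpow_le_rpow_of_exponent_le (by norm_num) (hb x).2
      have h9 : C' * P ≤
          2 * C' * (Q x (G x) + Q x (G' x) - 2 * Q x ((2 : ℝ)⁻¹ • (G x + G' x))) := by
        have := mul_le_mul_of_nonneg_left h5 hC'
        linarith
      have h10 := mul_le_mul_of_nonneg_left (add_le_add h6 h7) hepos.le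
      refine mul_le_mul h8 ?_ (by positivity) hBpos.le
      linarith
  have eq : ∫ x, (B * (e * (1 + 2 * (‖G x‖ ^ r x + ‖G' x‖ ^ r x)) +
      2 * C' * (Q x (G x) + Q x (G' x) - 2 * Q x (((2 : ℝ)⁻¹ • (G + G')) x)))) ∂μ =
      B * (e * (m + 2 * (∫ x, ‖G x‖ ^ r x ∂μ + ∫ x, ‖G' x‖ ^ r x ∂μ)) +
        2 * C' * (∫ x, Q x (G x) ∂μ + ∫ x, Q x (G' x) ∂μ -
          2 * ∫ x, Q x (((2 : ℝ)⁻¹ • (G + G')) x) ∂μ)) := by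
    have i1 := hm.integrable_density hG
    have i2 := hm.integrable_density hG'
    have i3 := hm.integrable_density hmid
    rw [integral_const_mul, integral_add, integral_const_mul, integral_const_mul, integral_sub,
      integral_add i1 i2, integral_const_mul, integral_add, integral_const_mul,
      integral_add hG.2 hG'.2]
    · simp [hm0]
    · exact integrable_const _
    · exact (hG.2.add hG'.2).const_mul 2
    · exact i1.add i2
    · exact i3.const_mul 2
    · exact ((integrable_const (1 : ℝ)).add ((hG.2.add hG'.2).const_mul 2)).const_mul e
    · exact ((i1.add i2).sub (i3.const_mul 2)).const_mul (2 * C')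
  refine key.trans (eq.le.trans ?_)
  have b1 := bd G hG h1
  have b2 := bd G' hG' h2
  have t1 : e * (m + 2 * (∫ x, ‖G x‖ ^ r x ∂μ + ∫ x, ‖G' x‖ ^ r x ∂μ)) ≤ e * (m + 4 * M + 1) :=
    mul_le_mul_of_nonneg_left (by linarith) hepos.le
  have t2 : 2 * C' * (∫ x, Q x (G x) ∂μ + ∫ x, Q x (G' x) ∂μ -
          2 * ∫ x, Q x (((2 : ℝ)⁻¹ • (G + G')) x) ∂μ) ≤ 2 * (C' + 1) * (2 * δ) := by
    have : 0 ≤ δ := by positivity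
    have := mul_le_mul_of_nonneg_left (show ∫ x, Q x (G x) ∂μ + ∫ x, Q x (G' x) ∂μ -
          2 * ∫ x, Q x (((2 : ℝ)⁻¹ • (G + G')) x) ∂μ ≤ 2 * δ by linarith)
          (show 0 ≤ 2 * C' by positivity)
    linarith
  have t3 : δ ≤ ε / (8 * B * (C' + 1)) := min_le_right _ _
  have t4 : B * (e * (m + 4 * M + 1)) = ε / 2 := by
    rw [he]; field_simp
  have t5 : B * (2 * (C' + 1) * (2 * δ)) ≤ ε / 2 := by
    calc B * (2 * (C' + 1) * (2 * δ)) ≤ B * (2 * (C' + 1) * (2 * (ε / (8 * B * (C' + 1))))) := by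
          gcongr
      _ = ε / 2 := by field_simp; norm_num
  have := mul_le_mul_of_nonneg_left (add_le_add t1 t2) hBpos.le
  linarith

end IsMaterial

end Variational

/-! ### Existence, uniqueness, Euler–Lagrange equation, and energy along rays -/

section Variational

variable {X H : Type*} [MeasurableSpace X] [NormedAddCommGroup H] [InnerProductSpace ℝ H]

/-- A form of Fatou's lemma for real integrals. -/
theorem integral_le_of_ae_tendsto {μ : Measure X} {f : ℕ → X → ℝ} {g : X → ℝ} {c : ℝ}
    (hf : ∀ k, Integrable (f k) μ) (hf0 : ∀ k, 0 ≤ᵐ[μ] f k) (hg : AEStronglyMeasurable g μ)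
    (hlim : ∀ᵐ x ∂μ, Filter.Tendsto (fun k => f k x) Filter.atTop (nhds (g x)))
    (hc : ∀ᶠ k in Filter.atTop, ∫ x, f k x ∂μ ≤ c) : Integrable g μ ∧ ∫ x, g x ∂μ ≤ c := by
  have hg0 : 0 ≤ᵐ[μ] g := by
    filter_upwards [hlim, ae_all_iff.2 hf0] with x hx h0
    exact ge_of_tendsto' hx h0
  have hc0 : 0 ≤ c := by
    obtain ⟨k, hk⟩ := hc.exists
    exact (integral_nonneg_of_ae (hf0 k)).trans hk
  have key : ∫⁻ x, ENNReal.ofReal (g x) ∂μ ≤ ENNReal.ofReal c := by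
    calc ∫⁻ x, ENNReal.ofReal (g x) ∂μ
        = ∫⁻ x, Filter.liminf (fun k => ENNReal.ofReal (f k x)) Filter.atTop ∂μ := by
          refine lintegral_congr_ae (hlim.mono fun x hx => ?_)
          exact ((ENNReal.continuous_ofReal.tendsto _).comp hx).liminf_eq.symm
      _ ≤ Filter.liminf (fun k => ∫⁻ x, ENNReal.ofReal (f k x) ∂μ) Filter.atTop :=
          lintegral_liminf_le' fun k => (hf k).1.aemeasurable.ennreal_ofReal
      _ ≤ ENNReal.ofReal c := by
          refine Filter.liminf_le_of_frequently_le' (Filter.Eventually.frequently ?_)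
          filter_upwards [hc] with k hk
          rw [← ofReal_integral_eq_lintegral_ofReal (hf k) (hf0 k)]
          exact ENNReal.ofReal_le_ofReal hk
  have hi : Integrable g μ :=
    ⟨hg, (hasFiniteIntegral_iff_ofReal hg0).2 (key.trans_lt ENNReal.ofReal_lt_top)⟩
  refine ⟨hi, ?_⟩
  rw [← ofReal_integral_eq_lintegral_ofReal hi hg0] at key
  exact (ENNReal.ofReal_le_ofReal_iff hc0).1 key

/-- Interpolation between exponents, up to a small constant. -/
theorem rpow_le_add_rpow {t δ s s' : ℝ} (ht : 0 ≤ t) (hδ : 0 < δ) (hs : 0 ≤ s) (hss : s ≤ s') :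
    t ^ s ≤ δ ^ s + δ ^ (s - s') * t ^ s' := by
  rcases le_or_gt t δ with h | h
  · have : 0 ≤ δ ^ (s - s') * t ^ s' := by positivity
    have : t ^ s ≤ δ ^ s := by gcongr
    linarith
  · have ht' : 0 < t := hδ.trans h
    have h1 : t ^ (s - s') ≤ δ ^ (s - s') :=
      Real.rpow_le_rpow_of_nonpos hδ h.le (by linarith)
    have h2 : t ^ s = t ^ (s - s') * t ^ s' := by
      rw [← Real.rpow_add ht']; ring_nf
    have h3 : 0 ≤ δ ^ s := by positivity
    rw [h2]
    have : t ^ (s - s') * t ^ s' ≤ δ ^ (s - s') * t ^ s' := by gcongr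
    linarith

/-- Completeness with respect to the modular. -/
theorem exists_modular_limit [CompleteSpace H] {μ : Measure X} [IsFiniteMeasure μ] {r : X → ℝ}
    (hr : Measurable r) {b : ℝ} (hb : ∀ x, 1 ≤ r x ∧ r x ≤ b) {G : ℕ → X → H}
    (hG : ∀ k, MemModular μ r (G k))
    (hc : ∀ ε : ℝ, 0 < ε → ∃ N, ∀ k ≥ N, ∀ l ≥ N, ∫ x, ‖(G k - G l) x‖ ^ r x ∂μ ≤ ε) :
    ∃ G' : X → H, MemModular μ r G' ∧
      (∃ ns : ℕ → ℕ, StrictMono ns ∧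
        ∀ᵐ x ∂μ, Filter.Tendsto (fun k => G (ns k) x) Filter.atTop (nhds (G' x))) ∧
      ∀ ε : ℝ, 0 < ε → ∃ N, ∀ k ≥ N, ∫ x, ‖(G' - G k) x‖ ^ r x ∂μ ≤ ε := by
  have hi : ∀ k, Integrable (G k) μ := by
    intro k
    refine ((integrable_const (1 : ℝ)).add (hG k).2).mono' (hG k).1 (ae_of_all _ fun x => ?_)
    have := rpow_le_add_rpow (norm_nonneg (G k x)) one_pos zero_le_one (hb x).1
    simpa using this
  -- As `r ≥ 1` and `μ` is finite, `t ≤ δ + δ ^ (1 - b) * t ^ r` for `δ ≤ 1` turns a modular Cauchy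
  -- sequence into a Cauchy sequence in `L¹`, whose completeness supplies the limit.
  have hcau : CauchySeq (fun k => (hi k).toL1 (G k)) := by
    rw [Metric.cauchySeq_iff]
    intro ε hε
    set m := μ.real univ
    have hm : 0 ≤ m := measureReal_nonneg
    set δ : ℝ := min 1 (ε / (4 * (m + 1))) with hδdef
    have hδ : 0 < δ := by positivity
    obtain ⟨N, hN⟩ := hc (ε / (4 * δ ^ (1 - b))) (by positivity)
    refine ⟨N, fun k hk l hl => ?_⟩
    rw [dist_eq_norm, ← Integrable.toL1_sub, L1.norm_of_fun_eq_integral_norm]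
    have hd : MemModular μ r (G k - G l) := (hG k).sub hr hb (hG l)
    calc ∫ x, ‖(G k - G l) x‖ ∂μ ≤ ∫ x, (δ + δ ^ (1 - b) * ‖(G k - G l) x‖ ^ r x) ∂μ := by
          refine integral_mono ((hi k).sub (hi l)).norm
            ((integrable_const _).add (hd.2.const_mul _)) fun x => ?_
          have h1 := rpow_le_add_rpow (norm_nonneg ((G k - G l) x)) hδ zero_le_one (hb x).1
          simp only [Real.rpow_one] at h1
          have h2 : δ ^ (1 - r x) ≤ δ ^ (1 - b) :=
            Real.rpow_le_rpow_of_exponent_ge hδ (min_le_left _ _) (by linarith [(hb x).2])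
          refine h1.trans ?_
          gcongr
      _ = m * δ + δ ^ (1 - b) * ∫ x, ‖(G k - G l) x‖ ^ r x ∂μ := by
          rw [integral_add (integrable_const _) (hd.2.const_mul _), integral_const_mul]
          simp [m]
      _ ≤ m * δ + δ ^ (1 - b) * (ε / (4 * δ ^ (1 - b))) := by
          gcongr
          exact hN k hk l hl
      _ ≤ ε / 4 + ε / 4 := by
          have h1 : δ ≤ ε / (4 * (m + 1)) := min_le_right _ _
          have h2 : m * δ ≤ (m + 1) * (ε / (4 * (m + 1))) := by gcongr; linarith
          have h3 : (m + 1) * (ε / (4 * (m + 1))) = ε / 4 := by field_simp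
          have h4 : δ ^ (1 - b) * (ε / (4 * δ ^ (1 - b))) = ε / 4 := by
            have : δ ^ (1 - b) ≠ 0 := by positivity
            field_simp
          linarith
      _ < ε := by linarith
  obtain ⟨F, hFm, hmeas⟩ : ∃ F : X → H, AEStronglyMeasurable F μ ∧
      TendstoInMeasure μ G Filter.atTop F := by
    obtain ⟨F, hF⟩ := cauchySeq_tendsto_of_complete hcau
    exact ⟨F, Lp.aestronglyMeasurable F,
      (tendstoInMeasure_of_tendsto_Lp hF).congr_left fun k => (hi k).coeFn_toL1⟩
  obtain ⟨ns, hns, hlim⟩ := hmeas.exists_seq_tendsto_ae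
  -- Fatou's lemma along the subsequence, with `k` fixed, shows that the a.e. limit is the modular
  -- limit of the whole sequence.
  have hdiff : ∀ ε : ℝ, 0 < ε → ∃ N, ∀ k ≥ N, MemModular μ r (F - G k) ∧
      ∫ x, ‖(F - G k) x‖ ^ r x ∂μ ≤ ε := by
    intro ε hε
    obtain ⟨N, hN⟩ := hc ε hε
    refine ⟨N, fun k hk => ?_⟩
    have := integral_le_of_ae_tendsto (f := fun j x => ‖(G (ns j) - G k) x‖ ^ r x)
      (g := fun x => ‖(F - G k) x‖ ^ r x) (c := ε)
      (fun j => ((hG (ns j)).sub hr hb (hG k)).2) (fun j => ae_of_all _ fun x => by positivity)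
      (MemModular.aestronglyMeasurable_rpow hr (hFm.sub (hG k).1)) ?_ ?_
    · exact ⟨⟨hFm.sub (hG k).1, this.1⟩, this.2⟩
    · filter_upwards [hlim] with x hx
      have hr0 : 0 ≤ r x := by linarith [(hb x).1]
      exact ((hx.sub_const (G k x)).norm).rpow_const (Or.inr hr0)
    · filter_upwards [Filter.eventually_ge_atTop N] with j hj
      exact hN _ (hj.trans (hns.id_le j)) k hk
  refine ⟨F, ?_, ⟨ns, hns, hlim⟩, fun ε hε => ?_⟩
  · obtain ⟨N, hN⟩ := hdiff 1 one_pos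
    have := (hN N le_rfl).1.add hr hb (hG N)
    simpa using this
  · obtain ⟨N, hN⟩ := hdiff ε hε
    exact ⟨N, fun k hk => (hN k hk).2⟩

/-- A subspace of measurable fields that is closed with respect to the modular. -/
structure IsModularClosed (μ : Measure X) (r : X → ℝ) (𝒢 : Submodule ℝ (X → H)) : Prop where
  aestronglyMeasurable : ∀ G ∈ 𝒢, AEStronglyMeasurable G μ
  closed : ∀ G, MemModular μ r G → (∀ ε : ℝ, 0 < ε → ∃ G' ∈ 𝒢, MemModular μ r (G - G') ∧
    ∫ x, ‖(G - G') x‖ ^ r x ∂μ ≤ ε) → G ∈ 𝒢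

namespace IsMaterial

variable {μ : Measure X} {r : X → ℝ} {Φ : X → H → H} {Q : X → H → ℝ} [IsFiniteMeasure μ]
  {𝒢 : Submodule ℝ (X → H)} {G G' φ w : X → H} {a : ℝ}

/-- The competitor `a • w` has finite energy, hence so has the minimizer, and coercivity applies. -/
theorem memModular_of_isEnergyMin (hm : IsMaterial μ r Φ Q) (hcl : IsModularClosed μ r 𝒢)
    (hw : MemModular μ r w) (h : IsEnergyMin μ Q 𝒢 w a G) : MemModular μ r G := by
  obtain ⟨b, hb⟩ := hm.exponent_bounds
  have haw : MemModular μ r (a • w) := hw.const_smul hm.exponent_measurable hb a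
  refine hm.memModular_of_energy_lt_top ?_ ?_
  · have := (hcl.aestronglyMeasurable _ h.1).add haw.1
    simpa using this
  · refine (h.2 (a • w) (by simp)).trans_lt ?_
    rw [hm.energy_eq haw]
    exact ENNReal.ofReal_lt_top

/-- Direct method with strong convergence: midpoints of a minimizing sequence are competitors, so
uniform convexity makes the sequence Cauchy in modular. The limit stays in the class by closedness,
and Fatou's lemma along an a.e. convergent subsequence shows that it is minimal. -/
theorem exists_isEnergyMin [CompleteSpace H] (hm : IsMaterial μ r Φ Q)
    (hcl : IsModularClosed μ r 𝒢) (hw : MemModular μ r w) (a : ℝ) :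
    ∃ G, IsEnergyMin μ Q 𝒢 w a G := by
  obtain ⟨b, hb⟩ := hm.exponent_bounds
  have hr := hm.exponent_measurable
  have haw : MemModular μ r (a • w) := hw.const_smul hr hb a
  set S : Set ℝ := {t | ∃ G, G - a • w ∈ 𝒢 ∧ MemModular μ r G ∧ ∫ x, Q x (G x) ∂μ = t} with hS
  have hSne : S.Nonempty := ⟨_, a • w, by simp, haw, rfl⟩
  have hSb : BddBelow S := ⟨0, by rintro _ ⟨G, -, -, rfl⟩; exact hm.integral_density_nonneg G⟩
  set I := sInf S with hI
  have hIle : ∀ G, G - a • w ∈ 𝒢 → MemModular μ r G → I ≤ ∫ x, Q x (G x) ∂μ :=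
    fun G h1 h2 => csInf_le hSb ⟨G, h1, h2, rfl⟩
  have hex : ∀ k : ℕ, ∃ G, G - a • w ∈ 𝒢 ∧ MemModular μ r G ∧
      ∫ x, Q x (G x) ∂μ < I + 1 / ((k : ℝ) + 1) := by
    intro k
    obtain ⟨t, ⟨G, h1, h2, rfl⟩, h3⟩ := exists_lt_of_csInf_lt hSne
      (show sInf S < I + 1 / ((k : ℝ) + 1) from lt_add_of_pos_right _ (by positivity))
    exact ⟨G, h1, h2, h3⟩
  choose G hG1 hG2 hG3 using hex
  have hsmall : ∀ δ : ℝ, 0 < δ → ∃ N, ∀ k ≥ N, ∫ x, Q x (G k x) ∂μ ≤ I + δ := by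
    intro δ hδ
    obtain ⟨N, hN⟩ := exists_nat_one_div_lt hδ
    refine ⟨N, fun k hk => ?_⟩
    have : 1 / ((k : ℝ) + 1) ≤ 1 / ((N : ℝ) + 1) := by gcongr
    linarith [hG3 k]
  have hmid : ∀ k l, (2 : ℝ)⁻¹ • (G k + G l) - a • w ∈ 𝒢 := by
    intro k l
    have := 𝒢.smul_mem (2 : ℝ)⁻¹ (𝒢.add_mem (hG1 k) (hG1 l))
    convert this using 1
    module
  obtain ⟨G', hG', ⟨ns, hns, hlim⟩, hconv⟩ := exists_modular_limit hr hb hG2 (by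
    intro ε hε
    obtain ⟨δ, hδ, h⟩ := hm.integral_rpow_sub_le I hε
    obtain ⟨N, hN⟩ := hsmall δ hδ
    exact ⟨N, fun k hk l hl => h I (G l) (G k) le_rfl (hG2 l) (hG2 k) (hN l hl) (hN k hk)
      (hIle _ (hmid l k) (((hG2 l).add hr hb (hG2 k)).const_smul hr hb _))⟩)
  have hmem : G' - a • w ∈ 𝒢 := by
    refine hcl.closed _ (hG'.sub hr hb haw) fun ε hε => ?_
    obtain ⟨N, hN⟩ := hconv ε hε
    refine ⟨G N - a • w, hG1 N, ?_, ?_⟩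
    · rw [sub_sub_sub_cancel_right]; exact hG'.sub hr hb (hG2 N)
    · rw [sub_sub_sub_cancel_right]; exact hN N le_rfl
  have hmin : ∫ x, Q x (G' x) ∂μ ≤ I := by
    refine le_of_forall_pos_le_add fun δ hδ => ?_
    obtain ⟨N, hN⟩ := hsmall δ hδ
    refine (integral_le_of_ae_tendsto (f := fun k x => Q x (G (ns k) x))
      (fun k => hm.integrable_density (hG2 _)) (fun k => hm.density_nonneg.mono fun _ hx => hx _)
      (hm.density_aemeasurable G' hG'.1).aestronglyMeasurable ?_ ?_).2
    · filter_upwards [hlim, hm.density_continuous] with x hx hc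
      exact (hc.tendsto _).comp hx
    · filter_upwards [Filter.eventually_ge_atTop N] with j hj
      exact hN _ (hj.trans (hns.id_le j))
  refine ⟨G', hmem, fun F hF => ?_⟩
  rcases eq_or_ne (energy μ Q F) ⊤ with h | h
  · rw [h]; exact le_top
  · have hFm : AEStronglyMeasurable F μ := by
      have := (hcl.aestronglyMeasurable _ hF).add haw.1
      simpa using this
    have hF' := hm.memModular_of_energy_lt_top hFm h.lt_top
    rw [hm.energy_eq hG', hm.energy_eq hF']
    exact ENNReal.ofReal_le_ofReal (hmin.trans (hIle F hF hF'))

theorem integral_density_le (hm : IsMaterial μ r Φ Q) (hG : MemModular μ r G)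
    (h : IsEnergyMin μ Q 𝒢 w a G) (hG' : MemModular μ r G') (h' : G' - a • w ∈ 𝒢) :
    ∫ x, Q x (G x) ∂μ ≤ ∫ x, Q x (G' x) ∂μ := by
  have := h.2 G' h'
  rw [hm.energy_eq hG, hm.energy_eq hG'] at this
  exact (ENNReal.ofReal_le_ofReal_iff (hm.integral_density_nonneg G')).1 this

/-- Minimizers are unique. -/
theorem isEnergyMin_ae_eq (hm : IsMaterial μ r Φ Q) (hcl : IsModularClosed μ r 𝒢)
    (hw : MemModular μ r w) (h : IsEnergyMin μ Q 𝒢 w a G) (h' : IsEnergyMin μ Q 𝒢 w a G') :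
    G' =ᵐ[μ] G := by
  obtain ⟨b, hb⟩ := hm.exponent_bounds
  have hr := hm.exponent_measurable
  have hG := hm.memModular_of_isEnergyMin hcl hw h
  have hG' := hm.memModular_of_isEnergyMin hcl hw h'
  have hmid : (2 : ℝ)⁻¹ • (G + G') - a • w ∈ 𝒢 := by
    convert 𝒢.smul_mem (2 : ℝ)⁻¹ (𝒢.add_mem h.1 h'.1) using 1
    module
  have hd := hG'.sub hr hb hG
  -- Two minimizers are `δ`-almost minimizing for every `δ > 0`, and their midpoint is again a
  -- competitor.
  have h0 : ∫ x, ‖(G' - G) x‖ ^ r x ∂μ ≤ 0 := by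
    refine le_of_forall_pos_le_add fun ε hε => ?_
    rw [zero_add]
    obtain ⟨δ, hδ, hδ'⟩ := hm.integral_rpow_sub_le (∫ x, Q x (G x) ∂μ) hε
    exact hδ' _ G G' le_rfl hG hG' (by linarith)
      (by linarith [hm.integral_density_le hG' h' hG h.1])
      (hm.integral_density_le hG h ((hG.add hr hb hG').const_smul hr hb _) hmid)
  have h1 := (integral_eq_zero_iff_of_nonneg (fun x => by positivity) hd.2).1
    (le_antisymm h0 (integral_nonneg fun x => by positivity))
  filter_upwards [h1] with x hx
  have hr0 : r x ≠ 0 := by linarith [(hb x).1]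
  have := (Real.rpow_eq_zero (norm_nonneg _) hr0).1 hx
  exact sub_eq_zero.1 (norm_eq_zero.1 this)

/-- The density is never differentiated. Minimality of `G` against `G + t • φ`, combined with the
tangent inequality at `G + t • φ`, gives a nonnegative pairing of the flux there with `φ`; then `t →
0` by continuity of the flux and dominated convergence. -/
theorem integral_inner_nonneg (hm : IsMaterial μ r Φ Q) (hcl : IsModularClosed μ r 𝒢)
    (hw : MemModular μ r w) (h : IsEnergyMin μ Q 𝒢 w a G) (hφ : φ ∈ 𝒢)
    (hφ' : MemModular μ r φ) : 0 ≤ ∫ x, inner ℝ (Φ x (G x)) (φ x) ∂μ := by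
  obtain ⟨b, hb⟩ := hm.exponent_bounds
  have hr := hm.exponent_measurable
  have hG := hm.memModular_of_isEnergyMin hcl hw h
  set t : ℕ → ℝ := fun k => 1 / ((k : ℝ) + 1) with ht
  have htpos : ∀ k, 0 < t k := fun k => by positivity
  have ht1 : ∀ k, t k ≤ 1 := fun k => by
    rw [ht]; simp only; rw [div_le_one (by positivity)]; linarith [Nat.cast_nonneg (α := ℝ) k]
  have hmod : ∀ k, MemModular μ r (G + t k • φ) := fun k => hG.add hr hb (hφ'.const_smul hr hb _)
  have hpos : ∀ k, 0 ≤ ∫ x, inner ℝ (Φ x ((G + t k • φ) x)) (φ x) ∂μ := by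
    intro k
    have h1 := hm.integral_density_le hG h (hmod k) (by
      have := 𝒢.add_mem h.1 (𝒢.smul_mem (t k) hφ)
      convert this using 1
      module)
    have h2 : ∫ x, (Q x ((G + t k • φ) x) - t k * inner ℝ (Φ x ((G + t k • φ) x)) (φ x)) ∂μ ≤
        ∫ x, Q x (G x) ∂μ := by
      refine integral_mono_ae ((hm.integrable_density (hmod k)).sub
        ((hm.integrable_inner (hmod k) hφ').const_mul _)) (hm.integrable_density hG) ?_
      filter_upwards [hm.convex] with x hx
      have := hx ((G + t k • φ) x) (G x)
      have e : G x - (G + t k • φ) x = -(t k • φ x) := by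
        simp only [Pi.add_apply, Pi.smul_apply]; module
      rw [e, inner_neg_right, inner_smul_right] at this
      linarith
    rw [integral_sub (hm.integrable_density (hmod k))
      ((hm.integrable_inner (hmod k) hφ').const_mul _), integral_const_mul] at h2
    exact nonneg_of_mul_nonneg_right (by linarith) (htpos k)
  obtain ⟨C, hC, hbd⟩ := hm.flux_bound
  suffices hlim : Filter.Tendsto (fun k => ∫ x, inner ℝ (Φ x ((G + t k • φ) x)) (φ x) ∂μ)
      Filter.atTop (nhds (∫ x, inner ℝ (Φ x (G x)) (φ x) ∂μ)) from ge_of_tendsto' hlim hpos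
  refine tendsto_integral_of_dominated_convergence
    (fun x => C * (1 + 2 ^ b * (‖G x‖ ^ r x + ‖φ x‖ ^ r x) + ‖φ x‖ ^ r x))
    (fun k => (hm.integrable_inner (hmod k) hφ').1) ?_ ?_ ?_
  · exact ((((integrable_const (1 : ℝ)).add ((hG.2.add hφ'.2).const_mul _)).add hφ'.2).const_mul _)
  · intro k
    filter_upwards [hbd] with x hx
    refine (hx _ _).trans ?_
    have hr0 : 0 ≤ r x := by linarith [(hb x).1]
    have h1 := rpow_norm_add_le (G x) (t k • φ x) hr0 (hb x).2
    have h2 : ‖t k • φ x‖ ^ r x ≤ ‖φ x‖ ^ r x := by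
      gcongr
      rw [norm_smul, Real.norm_of_nonneg (htpos k).le]
      exact mul_le_of_le_one_left (norm_nonneg _) (ht1 k)
    simp only [Pi.add_apply, Pi.smul_apply]
    gcongr
    exact h1.trans (by gcongr)
  · filter_upwards [hm.flux_continuous] with x hx
    have h1 : Filter.Tendsto (fun k => (G + t k • φ) x) Filter.atTop (nhds (G x)) := by
      have h2 : Filter.Tendsto t Filter.atTop (nhds 0) := tendsto_one_div_add_atTop_nhds_zero_nat
      have := (h2.smul_const (φ x)).const_add (G x)
      simpa using this
    exact ((hx.tendsto _).comp h1).inner tendsto_const_nhds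

/-- The Euler–Lagrange equation. -/
theorem integral_inner_eq_zero (hm : IsMaterial μ r Φ Q) (hcl : IsModularClosed μ r 𝒢)
    (hw : MemModular μ r w) (h : IsEnergyMin μ Q 𝒢 w a G) (hφ : φ ∈ 𝒢)
    (hφ' : MemModular μ r φ) : ∫ x, inner ℝ (Φ x (G x)) (φ x) ∂μ = 0 := by
  obtain ⟨b, hb⟩ := hm.exponent_bounds
  refine le_antisymm ?_ (hm.integral_inner_nonneg hcl hw h hφ hφ')
  have h1 := hm.integral_inner_nonneg hcl hw h (𝒢.smul_mem (-1) hφ)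
    (hφ'.const_smul hm.exponent_measurable hb _)
  simp only [Pi.smul_apply, inner_smul_right, neg_mul, one_mul] at h1
  rw [integral_neg] at h1
  linarith

/-- The minimal energy is the integral of its derivative along a ray. -/
theorem integral_ray (hm : IsMaterial μ r Φ Q) (hcl : IsModularClosed μ r 𝒢)
    (hw : MemModular μ r w) {u : ℝ → X → H} (hu : ∀ a, IsEnergyMin μ Q 𝒢 w a (u a)) :
    IntervalIntegrable (fun a => ∫ x, inner ℝ (Φ x (u a x)) (w x) ∂μ) volume 0 1 ∧
      ENNReal.ofReal (∫ a in (0 : ℝ)..1, ∫ x, inner ℝ (Φ x (u a x)) (w x) ∂μ) =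
        energy μ Q (u 1) ∧ 0 ≤ ∫ a in (0 : ℝ)..1, ∫ x, inner ℝ (Φ x (u a x)) (w x) ∂μ := by
  obtain ⟨b, hb⟩ := hm.exponent_bounds
  have hr := hm.exponent_measurable
  have hG := fun a => hm.memModular_of_isEnergyMin hcl hw (hu a)
  set E : ℝ → ℝ := fun a => ∫ x, Q x (u a x) ∂μ with hE
  -- Convexity compares the energies of `u s` and `u t`. The increment `u t - u s` differs from `(t
  -- - s) • w` by an element of `𝒢`, against which the flux of `u s` integrates to zero.
  have hsub : ∀ s t, E s + (t - s) * ∫ x, inner ℝ (Φ x (u s x)) (w x) ∂μ ≤ E t := by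
    intro s t
    have hφ : u t - u s - (t - s) • w ∈ 𝒢 := by
      convert 𝒢.sub_mem (hu t).1 (hu s).1 using 1
      module
    have hφ' : MemModular μ r (u t - u s - (t - s) • w) :=
      ((hG t).sub hr hb (hG s)).sub hr hb (hw.const_smul hr hb _)
    have h0 := hm.integral_inner_eq_zero hcl hw (hu s) hφ hφ'
    have h1 : ∫ x, inner ℝ (Φ x (u s x)) ((u t - u s) x) ∂μ =
        (t - s) * ∫ x, inner ℝ (Φ x (u s x)) (w x) ∂μ := by
      rw [← integral_const_mul, ← sub_eq_zero, ← integral_sub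
        (hm.integrable_inner (hG s) ((hG t).sub hr hb (hG s)))
        ((hm.integrable_inner (hG s) hw).const_mul _), ← h0]
      refine integral_congr_ae (ae_of_all _ fun x => ?_)
      simp only [Pi.sub_apply, Pi.smul_apply, inner_sub_right, inner_smul_right]
    rw [← h1, hE]
    simp only
    rw [← integral_add (hm.integrable_density (hG s))
      (hm.integrable_inner (hG s) ((hG t).sub hr hb (hG s)))]
    refine integral_mono_ae ((hm.integrable_density (hG s)).add
      (hm.integrable_inner (hG s) ((hG t).sub hr hb (hG s)))) (hm.integrable_density (hG t)) ?_
    filter_upwards [hm.convex] with x hx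
    exact hx _ _
  -- For the datum `0` the zero field is a competitor of zero energy.
  have h0 : E 0 = 0 := by
    refine le_antisymm ?_ (hm.integral_density_nonneg _)
    have hz : MemModular μ r ((0 : ℝ) • w) := hw.const_smul hr hb 0
    refine (hm.integral_density_le (hG 0) (hu 0) hz (by simp)).trans (le_of_eq ?_)
    rw [integral_eq_zero_of_ae]
    filter_upwards [hm.density_zero] with x hx
    simpa using hx
  obtain ⟨h1, h2⟩ := integral_subgradient hsub 0 1
  rw [h0, sub_zero] at h2
  refine ⟨h1, ?_, ?_⟩
  · rw [h2, hm.energy_eq (hG 1)]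
  · rw [h2]; exact hm.integral_density_nonneg _

end IsMaterial

end Variational

/-! ### Pointwise properties of a radial flux -/

section Radial

variable {H : Type*} [NormedAddCommGroup H] [InnerProductSpace ℝ H]

/-- Growth, monotonicity and continuity of a conductivity at a fixed point. -/
structure IsRadialLaw (H : Type*) [NormedAddCommGroup H] [InnerProductSpace ℝ H]
    (r b E₀ κ : ℝ) (s : ℝ → ℝ≥0∞) : Prop where
  continuousOn : ContinuousOn s (Ioi 0)
  le : ∀ E : ℝ, 0 < E → s E ≤ if 2 ≤ r then ENNReal.ofReal (b * (1 + (E / E₀) ^ (r - 2)))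
      else ENNReal.ofReal (b * (E / E₀) ^ (r - 2))
  monotone : ∀ ξ₁ ξ₂ : H, (if 2 ≤ r then κ * ‖ξ₂ - ξ₁‖ ^ r
      else κ * (1 + ‖ξ₂‖ ^ 2 + ‖ξ₁‖ ^ 2) ^ ((r - 2) / 2) * ‖ξ₂ - ξ₁‖ ^ 2)
      ≤ inner ℝ ((s ‖ξ₂‖).toReal • ξ₂ - (s ‖ξ₁‖).toReal • ξ₁) (ξ₂ - ξ₁)

namespace IsRadialLaw

variable {r b E₀ κ : ℝ} {s : ℝ → ℝ≥0∞}

theorem ne_top (h : IsRadialLaw H r b E₀ κ s) {E : ℝ} (hE : 0 < E) : s E ≠ ⊤ := by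
  refine ne_top_of_le_ne_top ?_ (h.le E hE)
  split_ifs <;> exact ENNReal.ofReal_ne_top

/-- The factor `E` removes the singularity of the conductivity at `0` when `r < 2`. The linear term
comes from the constant in the upper bound and is present only for `r ≥ 2`. -/
theorem mul_le (h : IsRadialLaw H r b E₀ κ s) (hb : 0 < b) (hE₀ : 0 < E₀) {E : ℝ} (hE : 0 < E) :
    (s E).toReal * E ≤ b * (1 + E₀ ^ (2 - r)) * ((if 2 ≤ r then E else 0) + E ^ (r - 1)) := by
  have h1 := h.le E hE
  have e1 : (E / E₀) ^ (r - 2) * E = E₀ ^ (2 - r) * E ^ (r - 1) := by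
    rw [Real.div_rpow hE.le hE₀.le, show 2 - r = -(r - 2) by ring, Real.rpow_neg hE₀.le,
      show r - 1 = (r - 2) + 1 by ring, Real.rpow_add hE, Real.rpow_one]
    field_simp
  have p1 : 0 < E₀ ^ (2 - r) := by positivity
  have p2 : 0 < E ^ (r - 1) := by positivity
  split_ifs at h1 ⊢ with hr
  · have h2 : (s E).toReal ≤ b * (1 + (E / E₀) ^ (r - 2)) :=
      ENNReal.toReal_le_of_le_ofReal (by positivity) h1
    calc (s E).toReal * E ≤ b * (1 + (E / E₀) ^ (r - 2)) * E := by gcongr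
      _ = b * (E + E₀ ^ (2 - r) * E ^ (r - 1)) := by rw [← e1]; ring
      _ ≤ b * ((1 + E₀ ^ (2 - r)) * (E + E ^ (r - 1))) := by
          refine mul_le_mul_of_nonneg_left ?_ hb.le
          have : 0 ≤ E₀ ^ (2 - r) * E := by positivity
          linarith
      _ = _ := by ring
  · have h2 : (s E).toReal ≤ b * (E / E₀) ^ (r - 2) :=
      ENNReal.toReal_le_of_le_ofReal (by positivity) h1
    calc (s E).toReal * E ≤ b * (E / E₀) ^ (r - 2) * E := by gcongr
      _ = b * (E₀ ^ (2 - r) * E ^ (r - 1)) := by rw [← e1]; ring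
      _ ≤ b * ((1 + E₀ ^ (2 - r)) * (0 + E ^ (r - 1))) := by
          refine mul_le_mul_of_nonneg_left ?_ hb.le
          linarith
      _ = _ := by ring

/-- A crude Young inequality: products such as `‖ξ‖ ^ (r - 1) * ‖η‖` are bounded by replacing the
smaller norm with the larger. The linear term, present only for `r ≥ 2`, is treated with `t ^ 2 ≤ 1
+ t ^ r`. -/
theorem abs_inner_le (h : IsRadialLaw H r b E₀ κ s) (hr : 1 < r) (hb : 0 < b) (hE₀ : 0 < E₀)
    (ξ η : H) : |inner ℝ ((s ‖ξ‖).toReal • ξ) η| ≤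
      4 * (b * (1 + E₀ ^ (2 - r))) * (1 + ‖ξ‖ ^ r + ‖η‖ ^ r) := by
  rcases eq_or_ne ξ 0 with rfl | hξ
  · simp only [smul_zero, inner_zero_left, abs_zero]; positivity
  have hE : 0 < ‖ξ‖ := norm_pos_iff.2 hξ
  have h1 := h.mul_le hb hE₀ hE
  have h2 : |inner ℝ ((s ‖ξ‖).toReal • ξ) η| ≤ (s ‖ξ‖).toReal * ‖ξ‖ * ‖η‖ := by
    refine (abs_real_inner_le_norm _ _).trans ?_
    rw [norm_smul, Real.norm_of_nonneg ENNReal.toReal_nonneg]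
  refine h2.trans ((mul_le_mul_of_nonneg_right h1 (norm_nonneg η)).trans ?_)
  set C := b * (1 + E₀ ^ (2 - r))
  have hC : 0 ≤ C := by positivity
  have k1 : ‖ξ‖ ^ (r - 1) * ‖η‖ ≤ ‖ξ‖ ^ r + ‖η‖ ^ r := by
    rcases le_total ‖ξ‖ ‖η‖ with hle | hle
    · have : ‖ξ‖ ^ (r - 1) * ‖η‖ ≤ ‖η‖ ^ (r - 1) * ‖η‖ := by
        gcongr
      have e : ‖η‖ ^ (r - 1) * ‖η‖ = ‖η‖ ^ r := by
        nth_rewrite 2 [← Real.rpow_one ‖η‖]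
        rw [← Real.rpow_add (hE.trans_le hle)]; ring_nf
      have : 0 ≤ ‖ξ‖ ^ r := by positivity
      linarith
    · have : ‖ξ‖ ^ (r - 1) * ‖η‖ ≤ ‖ξ‖ ^ (r - 1) * ‖ξ‖ := by gcongr
      have e : ‖ξ‖ ^ (r - 1) * ‖ξ‖ = ‖ξ‖ ^ r := by
        nth_rewrite 2 [← Real.rpow_one ‖ξ‖]
        rw [← Real.rpow_add hE]; ring_nf
      have : 0 ≤ ‖η‖ ^ r := by positivity
      linarith
  have k2 : (if 2 ≤ r then ‖ξ‖ else 0) * ‖η‖ ≤ 2 + ‖ξ‖ ^ r + ‖η‖ ^ r := by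
    split_ifs with hr2
    · have sq : ∀ t : ℝ, 0 ≤ t → t ^ 2 ≤ 1 + t ^ r := by
        intro t ht
        have := rpow_le_add_rpow ht one_pos (by norm_num : (0 : ℝ) ≤ 2) hr2
        simpa using this
      have h3 := sq _ (norm_nonneg ξ)
      have h4 := sq _ (norm_nonneg η)
      have := two_mul_le_add_sq ‖ξ‖ ‖η‖
      have : 0 ≤ ‖ξ‖ * ‖η‖ := by positivity
      linarith
    · rw [zero_mul]; positivity
  have p1 : 0 ≤ ‖ξ‖ ^ r := by positivity
  have p2 : 0 ≤ ‖η‖ ^ r := by positivity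
  have : C * ((if 2 ≤ r then ‖ξ‖ else 0) + ‖ξ‖ ^ (r - 1)) * ‖η‖ =
    C * ((if 2 ≤ r then ‖ξ‖ else 0) * ‖η‖ + ‖ξ‖ ^ (r - 1) * ‖η‖) := by ring
  rw [this, show 4 * C * (1 + ‖ξ‖ ^ r + ‖η‖ ^ r) = C * (4 * (1 + ‖ξ‖ ^ r + ‖η‖ ^ r)) by ring]
  refine mul_le_mul_of_nonneg_left ?_ hC
  linarith

/-- Nothing is assumed about `s` at `0`; continuity at the origin comes from the growth bound, as `r
- 1 > 0`. -/
theorem continuous_flux (h : IsRadialLaw H r b E₀ κ s) (hr : 1 < r) (hb : 0 < b) (hE₀ : 0 < E₀) :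
    Continuous fun ξ : H => (s ‖ξ‖).toReal • ξ := by
  rw [continuous_iff_continuousAt]
  intro ξ
  rcases eq_or_ne ξ 0 with rfl | hξ
  · have h1 : Filter.Tendsto (fun ξ : H => b * (1 + E₀ ^ (2 - r)) * (‖ξ‖ + ‖ξ‖ ^ (r - 1)))
        (nhds 0) (nhds 0) := by
      have : Continuous (fun ξ : H => b * (1 + E₀ ^ (2 - r)) * (‖ξ‖ + ‖ξ‖ ^ (r - 1))) := by
        have : Continuous fun ξ : H => ‖ξ‖ ^ (r - 1) :=
          continuous_norm.rpow_const fun _ => Or.inr (by linarith)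
        fun_prop
      have h2 := this.tendsto 0
      simpa [Real.zero_rpow (show r - 1 ≠ 0 by linarith)] using h2
    unfold ContinuousAt
    simp only [smul_zero]
    refine squeeze_zero_norm (fun η => ?_) h1
    rcases eq_or_ne η 0 with rfl | hη
    · simp only [smul_zero, norm_zero]; positivity
    rw [norm_smul, Real.norm_of_nonneg ENNReal.toReal_nonneg]
    refine (h.mul_le hb hE₀ (norm_pos_iff.2 hη)).trans ?_
    gcongr
    split_ifs
    · rfl
    · positivity
  · have hE : 0 < ‖ξ‖ := norm_pos_iff.2 hξ
    have h1 : ContinuousAt s ‖ξ‖ := h.continuousOn.continuousAt (Ioi_mem_nhds hE)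
    have h2 : ContinuousAt (fun η : H => s ‖η‖) ξ :=
      ContinuousAt.comp (g := s) (f := fun η : H => ‖η‖) h1 continuous_norm.continuousAt
    have h3 : ContinuousAt (fun η : H => (s ‖η‖).toReal) ξ :=
      (ENNReal.tendsto_toReal (h.ne_top hE)).comp h2
    exact h3.smul continuousAt_id

theorem mul_ofReal_eq (h : IsRadialLaw H r b E₀ κ s) {E : ℝ} (hE : 0 < E) :
    s E * ENNReal.ofReal E = ENNReal.ofReal ((s E).toReal * E) := by
  rw [ENNReal.ofReal_mul ENNReal.toReal_nonneg, ENNReal.ofReal_toReal (h.ne_top hE)]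

/-- Strong monotonicity is tested on two multiples of one unit vector, which exists because `H` is
nontrivial. -/
theorem mul_mono [Nontrivial H] (h : IsRadialLaw H r b E₀ κ s) (hκ : 0 < κ) {E E' : ℝ}
    (hE : 0 < E) (hEE : E ≤ E') : (s E).toReal * E ≤ (s E').toReal * E' := by
  rcases hEE.eq_or_lt with rfl | hlt
  · rfl
  obtain ⟨e, he⟩ := exists_norm_eq H (zero_le_one (α := ℝ))
  have h1 := h.monotone (E • e) (E' • e)
  have hE' : 0 < E' := hE.trans hlt
  simp only [norm_smul, he, mul_one, Real.norm_of_nonneg hE.le, Real.norm_of_nonneg hE'.le] at h1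
  have e1 : (s E').toReal • E' • e - (s E).toReal • E • e =
      ((s E').toReal * E' - (s E).toReal * E) • e := by module
  have e2 : E' • e - E • e = (E' - E) • e := by module
  rw [e1, e2, inner_smul_left, inner_smul_right, real_inner_self_eq_norm_sq, he] at h1
  have h2 : 0 ≤ ((s E').toReal * E' - (s E).toReal * E) * (E' - E) := by
    refine le_trans ?_ (h1.trans (le_of_eq (by simp)))
    split_ifs <;> positivity
  have := nonneg_of_mul_nonneg_left h2 (sub_pos.2 hlt)
  linarith

/-- The primitive of `ξ ↦ s ξ * ξ`. -/
noncomputable def primitive (s : ℝ → ℝ≥0∞) (E : ℝ) : ℝ≥0∞ :=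
  ∫⁻ ξ in Ioc 0 E, s ξ * ENNReal.ofReal ξ

theorem primitive_ne_top [Nontrivial H] (h : IsRadialLaw H r b E₀ κ s) (hκ : 0 < κ) (E : ℝ) :
    primitive s E ≠ ⊤ := by
  have : primitive s E ≤ ∫⁻ _ in Ioc 0 E, ENNReal.ofReal ((s E).toReal * E) := by
    refine setLIntegral_mono measurable_const fun τ hτ => ?_
    rw [h.mul_ofReal_eq hτ.1]
    exact ENNReal.ofReal_le_ofReal (h.mul_mono hκ hτ.1 hτ.2)
  refine ne_top_of_le_ne_top ?_ this
  rw [setLIntegral_const, Real.volume_Ioc]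
  exact ENNReal.mul_ne_top ENNReal.ofReal_ne_top ENNReal.ofReal_ne_top

theorem primitive_add (s : ℝ → ℝ≥0∞) {E E' : ℝ} (hE : 0 ≤ E) (hEE : E ≤ E') :
    primitive s E' = primitive s E + ∫⁻ ξ in Ioc E E', s ξ * ENNReal.ofReal ξ := by
  unfold primitive
  rw [← lintegral_union measurableSet_Ioc (Ioc_disjoint_Ioc_of_le le_rfl),
    Ioc_union_Ioc_eq_Ioc hE hEE]

/-- The integrand `s ξ * ξ` is nondecreasing, so over the interval between `E` and `E'` it is
compared with its value at `E`. -/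
theorem primitive_subgradient [Nontrivial H] (h : IsRadialLaw H r b E₀ κ s) (hκ : 0 < κ)
    {E E' : ℝ} (hE : 0 ≤ E) (hE' : 0 ≤ E') :
    (primitive s E).toReal + (s E).toReal * E * (E' - E) ≤ (primitive s E').toReal := by
  have hn : 0 ≤ (s E).toReal * E := mul_nonneg ENNReal.toReal_nonneg hE
  rcases le_total E E' with hle | hle
  · have h1 : ENNReal.ofReal ((s E).toReal * E * (E' - E)) ≤
        ∫⁻ ξ in Ioc E E', s ξ * ENNReal.ofReal ξ := by
      rw [ENNReal.ofReal_mul hn, ← Real.volume_Ioc, ← setLIntegral_const]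
      refine setLIntegral_mono' measurableSet_Ioc fun τ hτ => ?_
      rw [h.mul_ofReal_eq (hE.trans_lt hτ.1)]
      rcases hE.eq_or_lt with rfl | hpos
      · simp
      · exact ENNReal.ofReal_le_ofReal (h.mul_mono hκ hpos hτ.1.le)
    have h2 := primitive_add s hE hle
    have h3 := h.primitive_ne_top hκ E'
    have h4 : ∫⁻ ξ in Ioc E E', s ξ * ENNReal.ofReal ξ ≠ ⊤ := by
      rw [h2] at h3; exact (ENNReal.add_ne_top.1 h3).2
    rw [h2, ENNReal.toReal_add (h.primitive_ne_top hκ E) h4]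
    gcongr
    exact (ENNReal.ofReal_le_iff_le_toReal h4).1 h1
  · have h1 : ∫⁻ ξ in Ioc E' E, s ξ * ENNReal.ofReal ξ ≤
        ENNReal.ofReal ((s E).toReal * E * (E - E')) := by
      rw [ENNReal.ofReal_mul hn, ← Real.volume_Ioc, ← setLIntegral_const]
      refine setLIntegral_mono measurable_const fun τ hτ => ?_
      rw [h.mul_ofReal_eq (hE'.trans_lt hτ.1)]
      exact ENNReal.ofReal_le_ofReal (h.mul_mono hκ (hE'.trans_lt hτ.1) hτ.2)
    have h2 := primitive_add s hE' hle
    have h4 : ∫⁻ ξ in Ioc E' E, s ξ * ENNReal.ofReal ξ ≠ ⊤ :=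
      ne_top_of_le_ne_top ENNReal.ofReal_ne_top h1
    rw [h2, ENNReal.toReal_add (h.primitive_ne_top hκ E') h4]
    have h5 := ENNReal.toReal_le_of_le_ofReal (mul_nonneg hn (by linarith)) h1
    linarith

/-- By Cauchy–Schwarz, the tangent in direction `η - ξ` is at most the one-dimensional tangent at
`‖ξ‖` evaluated at `‖η‖`. -/
theorem convex [Nontrivial H] (h : IsRadialLaw H r b E₀ κ s) (hκ : 0 < κ) (ξ η : H) :
    (primitive s ‖ξ‖).toReal + inner ℝ ((s ‖ξ‖).toReal • ξ) (η - ξ) ≤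
      (primitive s ‖η‖).toReal := by
  refine le_trans ?_ (h.primitive_subgradient hκ (norm_nonneg ξ) (norm_nonneg η))
  gcongr
  rw [inner_smul_left, inner_sub_right, real_inner_self_eq_norm_sq]
  have h1 := real_inner_le_norm ξ η
  have : (s ‖ξ‖).toReal * (inner ℝ ξ η - ‖ξ‖ ^ 2) ≤ (s ‖ξ‖).toReal * (‖ξ‖ * ‖η‖ - ‖ξ‖ ^ 2) := by
    have : (0 : ℝ) ≤ (s ‖ξ‖).toReal := ENNReal.toReal_nonneg
    gcongr
  simp only [RCLike.conj_to_real]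
  linarith

/-- The constant is chosen before `s`, so it is uniform in the point `x`. For `r < 2`, put `S = 1 +
‖η‖² + ‖ξ‖²` and interpolate: `t ^ (r / 2) ≤ δ ^ (r / 2) + δ ^ (r / 2 - 1) * t` at `t = ‖η - ξ‖² /
S`, multiplied by `S ^ (r / 2)`. -/
theorem strong (hr : 1 < r) (hκ : 0 < κ) {ε : ℝ} (hε : 0 < ε) :
    ∃ C : ℝ, 0 ≤ C ∧ ∀ s, IsRadialLaw H r b E₀ κ s → ∀ ξ η : H, ‖η - ξ‖ ^ r ≤
      ε * (1 + ‖ξ‖ ^ r + ‖η‖ ^ r) +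
        C * inner ℝ ((s ‖η‖).toReal • η - (s ‖ξ‖).toReal • ξ) (η - ξ) := by
  rcases le_or_gt 2 r with hr2 | hr2
  · refine ⟨κ⁻¹, by positivity, fun s h ξ η => ?_⟩
    have h1 := h.monotone ξ η
    rw [if_pos hr2] at h1
    have h2 := mul_le_mul_of_nonneg_left h1 (inv_nonneg.2 hκ.le)
    rw [inv_mul_cancel_left₀ hκ.ne'] at h2
    have : 0 ≤ ε * (1 + ‖ξ‖ ^ r + ‖η‖ ^ r) := by positivity
    linarith
  · set δ : ℝ := ε ^ (2 / r) with hδ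
    have hδpos : 0 < δ := by positivity
    refine ⟨κ⁻¹ * δ ^ (r / 2 - 1), by positivity, fun s h ξ η => ?_⟩
    have h1 := h.monotone ξ η
    rw [if_neg (not_le.2 hr2)] at h1
    set P := inner ℝ ((s ‖η‖).toReal • η - (s ‖ξ‖).toReal • ξ) (η - ξ)
    set S : ℝ := 1 + ‖η‖ ^ 2 + ‖ξ‖ ^ 2 with hS
    have hSpos : 0 < S := by positivity
    have h2 := rpow_le_add_rpow (t := ‖η - ξ‖ ^ 2 / S) (s := r / 2) (s' := 1) (by positivity)
      hδpos (by linarith) (by linarith)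
    rw [Real.rpow_one, Real.div_rpow (by positivity) hSpos.le, ← Real.rpow_natCast,
      ← Real.rpow_mul (norm_nonneg _), Nat.cast_ofNat, show 2 * (r / 2) = r by ring,
      div_le_iff₀ (by positivity)] at h2
    have e1 : δ ^ (r / 2) = ε := by
      rw [hδ, ← Real.rpow_mul hε.le]
      rw [show 2 / r * (r / 2) = 1 by field_simp, Real.rpow_one]
    have e2 : S ^ (r / 2) ≤ 1 + ‖ξ‖ ^ r + ‖η‖ ^ r := by
      have sq : ∀ ζ : H, (‖ζ‖ ^ 2) ^ (r / 2) = ‖ζ‖ ^ r := by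
        intro ζ
        rw [← Real.rpow_natCast, ← Real.rpow_mul (norm_nonneg _), Nat.cast_ofNat]
        congr 1; ring
      have a1 := Real.rpow_add_le_add_rpow (p := r / 2) (show 0 ≤ 1 + ‖η‖ ^ 2 by positivity)
        (show 0 ≤ ‖ξ‖ ^ 2 by positivity) (by linarith) (by linarith)
      have a2 := Real.rpow_add_le_add_rpow (p := r / 2) (zero_le_one (α := ℝ))
        (show 0 ≤ ‖η‖ ^ 2 by positivity) (by linarith) (by linarith)
      rw [sq] at a1 a2
      rw [Real.one_rpow] at a2
      linarith
    have e3 : ‖η - ξ‖ ^ (2 : ℝ) / S * S ^ (r / 2) = S ^ ((r - 2) / 2) * ‖η - ξ‖ ^ 2 := by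
      rw [show (r - 2) / 2 = r / 2 - 1 by ring, Real.rpow_sub_one hSpos.ne', Real.rpow_ofNat]
      ring
    have h3 : S ^ ((r - 2) / 2) * ‖η - ξ‖ ^ 2 ≤ κ⁻¹ * P := by
      rw [mul_assoc] at h1
      have := mul_le_mul_of_nonneg_left h1 (inv_nonneg.2 hκ.le)
      rwa [inv_mul_cancel_left₀ hκ.ne'] at this
    rw [e1, add_mul, mul_assoc, e3] at h2
    have h4 : δ ^ (r / 2 - 1) * (S ^ ((r - 2) / 2) * ‖η - ξ‖ ^ 2) ≤
        δ ^ (r / 2 - 1) * (κ⁻¹ * P) := by gcongr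
    have h5 : ε * S ^ (r / 2) ≤ ε * (1 + ‖ξ‖ ^ r + ‖η‖ ^ r) := by gcongr
    calc _ ≤ _ := h2
      _ ≤ _ := add_le_add h5 h4
      _ = _ := by ring

end IsRadialLaw

end Radial

/-! ### Measurability of Carathéodory functions -/

/-- Measurability is known for each `E` only up to a null set depending on `E`. Rational `E` give a
single good set `T` of full measure; continuity in `E` recovers the other values there. -/
theorem exists_measurable_uncurry {n : ℕ} {S : Set (Rn n)} {σ : Rn n → ℝ → ℝ≥0∞}
    (h : IsCaratheodoryOn S σ) : ∃ s : Rn n → ℝ → ℝ≥0∞, Measurable (Function.uncurry s) ∧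
      ∀ᵐ x ∂(volume.restrict S), ∀ E : ℝ, 0 < E → σ x E = s x E := by
  have hq : ∀ᵐ x ∂(volume.restrict S), ∀ q : {q : ℚ // 0 < q},
      σ x q = (h.1 q (by exact_mod_cast q.2)).mk _ x :=
    ae_all_iff.2 fun q => (h.1 q (by exact_mod_cast q.2)).ae_eq_mk
  obtain ⟨T, hT, hTm, hT'⟩ := (h.2.and hq).exists_measurable_mem
  have hrat : ∀ q : ℚ, 0 < q → Measurable (T.indicator fun x => σ x q) := by
    intro q hq
    have h1 := (h.1 q (by exact_mod_cast hq)).measurable_mk.indicator hTm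
    have h2 : (T.indicator fun x => σ x q) = T.indicator _ :=
      indicator_congr fun x hx => (hT' x hx).2 ⟨q, hq⟩
    rw [h2]
    exact h1
  have hmeas : ∀ E : ℝ, 0 < E → Measurable (T.indicator fun x => σ x E) := by
    intro E hE
    obtain ⟨u, -, hu1, hu2⟩ := Real.exists_seq_rat_strictAnti_tendsto E
    refine measurable_of_tendsto_metrizable
      (f := fun k => T.indicator fun x => σ x (u k)) (fun k => ?_) ?_
    · exact hrat (u k) (by exact_mod_cast hE.trans (hu1 k))
    · rw [tendsto_pi_nhds]
      intro x
      by_cases hx : x ∈ T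
      · simp only [indicator_of_mem hx]
        exact (((hT' x hx).1.continuousAt (Ioi_mem_nhds hE)).tendsto).comp hu2
      · simp only [indicator_of_notMem hx]
        exact tendsto_const_nhds
  -- Joint measurability requires continuity in a parameter ranging over all of `ℝ`; writing `E =
  -- exp t` provides this from continuity on `(0, ∞)`.
  have hjoint : Measurable (Function.uncurry fun (t : ℝ) (x : Rn n) =>
      T.indicator (fun x => σ x (Real.exp t)) x) := by
    refine measurable_uncurry_of_continuous_of_measurable (fun x => ?_)
      fun t => hmeas _ (Real.exp_pos t)
    by_cases hx : x ∈ T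
    · simp only [indicator_of_mem hx]
      exact (hT' x hx).1.comp_continuous Real.continuous_exp fun t => Real.exp_pos t
    · simp only [indicator_of_notMem hx]
      exact continuous_const
  refine ⟨fun x E => T.indicator (fun x => σ x (Real.exp (Real.log E))) x, ?_, ?_⟩
  · exact hjoint.comp ((Real.measurable_log.comp measurable_snd).prodMk measurable_fst)
  · filter_upwards [hT] with x hx E hE
    rw [indicator_of_mem hx, Real.exp_log hE]

theorem energyDensity_congr {n : ℕ} {σ s : Rn n → ℝ → ℝ≥0∞} {x : Rn n}
    (h : ∀ E : ℝ, 0 < E → σ x E = s x E) (E : ℝ) : energyDensity σ x E = energyDensity s x E :=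
  setLIntegral_congr_fun measurableSet_Ioc fun τ hτ => by simp only [h τ hτ.1]

theorem measurable_energyDensity {n : ℕ} {s : Rn n → ℝ → ℝ≥0∞}
    (hs : Measurable (Function.uncurry s)) :
    Measurable fun y : Rn n × ℝ => energyDensity s y.1 y.2 := by
  have h1 : Measurable fun z : (Rn n × ℝ) × ℝ =>
      {z : (Rn n × ℝ) × ℝ | 0 < z.2 ∧ z.2 ≤ z.1.2}.indicator
        (fun z => s z.1.1 z.2 * ENNReal.ofReal z.2) z := by
    refine Measurable.indicator ?_ ?_
    · exact (hs.comp ((measurable_fst.comp measurable_fst).prodMk measurable_snd)).mul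
        measurable_snd.ennreal_ofReal
    · exact (measurableSet_lt measurable_const measurable_snd).inter
        (measurableSet_le measurable_snd (measurable_snd.comp measurable_fst))
  convert h1.lintegral_prod_right' (ν := volume) using 2 with y
  unfold energyDensity
  rw [← lintegral_indicator measurableSet_Ioc]
  rfl

theorem aemeasurable_energyDensity {n : ℕ} {S : Set (Rn n)} {σ : Rn n → ℝ → ℝ≥0∞}
    (h : IsCaratheodoryOn S σ) {G : Rn n → Rn n} (hG : AEStronglyMeasurable G (volume.restrict S)) :
    AEMeasurable (fun x => energyDensity σ x ‖G x‖) (volume.restrict S) := by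
  obtain ⟨s, hs, hσ⟩ := exists_measurable_uncurry h
  refine AEMeasurable.congr (f := fun x => energyDensity s x ‖G x‖) ?_ ?_
  · exact (measurable_energyDensity hs).comp_aemeasurable
      (aemeasurable_id.prodMk hG.norm.aemeasurable)
  · filter_upwards [hσ] with x hx
    exact (energyDensity_congr hx _).symm

theorem aestronglyMeasurable_flux {n : ℕ} {S : Set (Rn n)} {σ : Rn n → ℝ → ℝ≥0∞}
    (h : IsCaratheodoryOn S σ) {G : Rn n → Rn n} (hG : AEStronglyMeasurable G (volume.restrict S)) :
    AEStronglyMeasurable (fun x => flux σ x (G x)) (volume.restrict S) := by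
  obtain ⟨s, hs, hσ⟩ := exists_measurable_uncurry h
  refine AEStronglyMeasurable.congr (f := fun x => flux s x (G x)) ?_ ?_
  · have h1 : AEMeasurable (fun x => (s x ‖G x‖).toReal) (volume.restrict S) :=
      (hs.comp_aemeasurable (aemeasurable_id.prodMk hG.norm.aemeasurable)).ennreal_toReal
    exact h1.aestronglyMeasurable.smul hG
  · filter_upwards [hσ] with x hx
    -- At field strength `0` the values of `σ` and `s` are unrelated, but the factor `G x = 0` makes
    -- both fluxes vanish.
    rcases eq_or_ne (G x) 0 with h0 | h0
    · simp [flux, h0]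
    · simp only [flux, hx _ (norm_pos_iff.2 h0)]

/-! ### Conductivities as materials -/

theorem exists_isRadialLaw {n : ℕ} {r : ℝ} {S : Set (Rn n)} {σ : Rn n → ℝ → ℝ≥0∞}
    (hc : IsCaratheodoryOn S σ) (hg : HasGrowthOn r S σ) (hm : IsStronglyMonotoneOn r S σ) :
    ∃ b E₀ κ : ℝ, 0 < b ∧ 0 < E₀ ∧ 0 < κ ∧
      ∀ᵐ x ∂(volume.restrict S), IsRadialLaw (Rn n) r b E₀ κ (σ x) := by
  obtain ⟨a, b, E₀, ha, hab, hE₀, hg⟩ := hg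
  obtain ⟨κ, hκ, hm⟩ := hm
  refine ⟨b, E₀, κ, ha.trans_le hab, hE₀, hκ, ?_⟩
  filter_upwards [hc.2, hg, hm] with x h1 h2 h3
  exact ⟨h1, fun E hE => (h2 E hE).2, h3⟩

theorem isMaterial_restrict {n : ℕ} [Nontrivial (Rn n)] {r₀ : ℝ} (hr₀ : 1 < r₀) {S : Set (Rn n)}
    {σ : Rn n → ℝ → ℝ≥0∞} (hc : IsCaratheodoryOn S σ) (hg : HasGrowthOn r₀ S σ)
    (hm : IsStronglyMonotoneOn r₀ S σ) {r : Rn n → ℝ} (hr : Measurable r) {B : ℝ}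
    (hB : ∀ x, 1 ≤ r x ∧ r x ≤ B) (hrr : ∀ᵐ x ∂(volume.restrict S), r x = r₀) :
    IsMaterial (volume.restrict S) r (flux σ) (fun x ξ => (energyDensity σ x ‖ξ‖).toReal) := by
  obtain ⟨b, E₀, κ, hb, hE₀, hκ, hlaw⟩ := exists_isRadialLaw hc hg hm
  refine ⟨hr, ⟨B, hB⟩, fun G hG => aestronglyMeasurable_flux hc hG,
    fun G hG => (aemeasurable_energyDensity hc hG).ennreal_toReal,
    ae_of_all _ fun x => by simp [flux],
    ?_, ae_of_all _ fun x ξ => ENNReal.toReal_nonneg, ae_of_all _ fun x => by simp [energyDensity],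
    ?_, ?_, ?_⟩
  · filter_upwards [hlaw] with x hx
    exact hx.continuous_flux hr₀ hb hE₀
  · filter_upwards [hlaw] with x hx ξ η
    exact hx.convex hκ ξ η
  · refine ⟨4 * (b * (1 + E₀ ^ (2 - r₀))), by positivity, ?_⟩
    filter_upwards [hlaw, hrr] with x hx hxr ξ η
    rw [hxr]
    exact hx.abs_inner_le hr₀ hb hE₀ ξ η
  · intro ε hε
    obtain ⟨C, hC, h⟩ := IsRadialLaw.strong (H := Rn n) (b := b) (E₀ := E₀) hr₀ hκ hε
    refine ⟨C, hC, ?_⟩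
    filter_upwards [hlaw, hrr] with x hx hxr ξ η
    rw [hxr]
    exact h (σ x) hx ξ η

theorem energyDensity_ne_top_ae {n : ℕ} [Nontrivial (Rn n)] {r₀ : ℝ} {S : Set (Rn n)}
    {σ : Rn n → ℝ → ℝ≥0∞} (hc : IsCaratheodoryOn S σ) (hg : HasGrowthOn r₀ S σ)
    (hm : IsStronglyMonotoneOn r₀ S σ) :
    ∀ᵐ x ∂(volume.restrict S), ∀ E, energyDensity σ x E ≠ ⊤ := by
  obtain ⟨b, E₀, κ, hb, hE₀, hκ, hlaw⟩ := exists_isRadialLaw hc hg hm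
  filter_upwards [hlaw] with x hx E
  exact hx.primitive_ne_top hκ E

theorem IsMaterial.inner_nonneg {X H : Type*} [MeasurableSpace X] [NormedAddCommGroup H]
    [InnerProductSpace ℝ H] {μ : Measure X} {r : X → ℝ} {Φ : X → H → H} {Q : X → H → ℝ}
    (hm : IsMaterial μ r Φ Q) : ∀ᵐ x ∂μ, ∀ ξ η, 0 ≤ inner ℝ (Φ x η - Φ x ξ) (η - ξ) := by
  filter_upwards [hm.convex] with x hx ξ η
  have h1 := hx ξ η
  have h2 := hx η ξ
  rw [← neg_sub η ξ, inner_neg_right] at h2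
  rw [inner_sub_left]
  linarith

/-- Glues the laws outside and inside a growth inclusion. In `strong` the larger constant `C + C'`
is allowed because the pairing is nonnegative. -/
theorem IsMaterial.union {X H : Type*} [MeasurableSpace X] [NormedAddCommGroup H]
    [InnerProductSpace ℝ H] {μ : Measure X} {r : X → ℝ} {Φ : X → H → H} {Q : X → H → ℝ}
    {S T : Set X} (hS : IsMaterial (μ.restrict S) r Φ Q) (hT : IsMaterial (μ.restrict T) r Φ Q) :
    IsMaterial (μ.restrict (S ∪ T)) r Φ Q := by
  refine ⟨hS.exponent_measurable, hS.exponent_bounds, fun G hG => ?_, fun G hG => ?_,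
    (ae_restrict_union_iff _ _ _).2 ⟨hS.flux_zero, hT.flux_zero⟩,
    (ae_restrict_union_iff _ _ _).2 ⟨hS.flux_continuous, hT.flux_continuous⟩,
    (ae_restrict_union_iff _ _ _).2 ⟨hS.density_nonneg, hT.density_nonneg⟩,
    (ae_restrict_union_iff _ _ _).2 ⟨hS.density_zero, hT.density_zero⟩,
    (ae_restrict_union_iff _ _ _).2 ⟨hS.convex, hT.convex⟩, ?_, fun ε hε => ?_⟩
  · have := aestronglyMeasurable_union_iff.1 hG
    exact aestronglyMeasurable_union_iff.2
      ⟨hS.flux_aestronglyMeasurable G this.1, hT.flux_aestronglyMeasurable G this.2⟩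
  · have := aestronglyMeasurable_union_iff.1 hG
    exact aemeasurable_union_iff.2
      ⟨hS.density_aemeasurable G this.1, hT.density_aemeasurable G this.2⟩
  · obtain ⟨C, hC, h⟩ := hS.flux_bound
    obtain ⟨C', hC', h'⟩ := hT.flux_bound
    refine ⟨C + C', by positivity, (ae_restrict_union_iff _ _ _).2 ⟨?_, ?_⟩⟩
    · filter_upwards [h] with x hx ξ η
      refine (hx ξ η).trans ?_
      gcongr
      linarith
    · filter_upwards [h'] with x hx ξ η
      refine (hx ξ η).trans ?_
      gcongr
      linarith
  · obtain ⟨C, hC, h⟩ := hS.strong ε hε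
    obtain ⟨C', hC', h'⟩ := hT.strong ε hε
    refine ⟨C + C', by positivity, (ae_restrict_union_iff _ _ _).2 ⟨?_, ?_⟩⟩
    · filter_upwards [h, hS.inner_nonneg] with x hx h0 ξ η
      have := mul_nonneg hC' (h0 ξ η)
      linarith [hx ξ η]
    · filter_upwards [h', hT.inner_nonneg] with x hx h0 ξ η
      have := mul_nonneg hC (h0 ξ η)
      linarith [hx ξ η]

/-! ### Weak gradients -/

section WeakGrad

variable {n : ℕ} {U V : Set (Rn n)} {u u' : Rn n → ℝ} {g g' : Rn n → Rn n}

theorem integrable_smul_of_tsupport_subset {F : Type*} [NormedAddCommGroup F] [NormedSpace ℝ F]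
    {f : Rn n → F} (hf : LocallyIntegrableOn f U) {ψ : Rn n → ℝ} (hψ : Continuous ψ)
    (hc : HasCompactSupport ψ) (hs : tsupport ψ ⊆ U) : Integrable fun x => ψ x • f x := by
  have h1 : IntegrableOn (fun x => ψ x • f x) (tsupport ψ) :=
    (hf.integrableOn_compact_subset hs hc).continuousOn_smul hψ.continuousOn hc
  refine (integrableOn_iff_integrable_of_support_subset fun x hx => ?_).1 h1
  exact subset_tsupport ψ fun h0 => hx (by simp [h0])

theorem continuous_fderiv_apply_of_contDiff {φ : Rn n → ℝ} (hφ : ContDiff ℝ 1 φ) (v : Rn n) :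
    Continuous fun x => fderiv ℝ φ x v :=
  (hφ.continuous_fderiv one_ne_zero).clm_apply continuous_const

theorem continuous_gradient {φ : Rn n → ℝ} (hφ : ContDiff ℝ 1 φ) : Continuous (gradient φ) :=
  (InnerProductSpace.toDual ℝ (Rn n)).symm.continuous.comp (hφ.continuous_fderiv one_ne_zero)

theorem gradient_eq_zero_of_notMem_tsupport {φ : Rn n → ℝ} {x : Rn n} (hx : x ∉ tsupport φ) :
    gradient φ x = 0 := by
  have : fderiv ℝ φ x = 0 := by
    by_contra h
    exact hx (tsupport_fderiv_subset ℝ (subset_tsupport _ h))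
  simp [gradient, this]

theorem hasCompactSupport_gradient {φ : Rn n → ℝ} (hφ : HasCompactSupport φ) :
    HasCompactSupport (gradient φ) :=
  HasCompactSupport.intro hφ fun _ hx => gradient_eq_zero_of_notMem_tsupport hx

namespace HasWeakGrad

theorem integrable_fderiv_mul (hu : LocallyIntegrableOn u U) {φ : Rn n → ℝ}
    (hφ : ContDiff ℝ ∞ φ) (hc : HasCompactSupport φ) (hs : tsupport φ ⊆ U) (v : Rn n) :
    Integrable fun x => fderiv ℝ φ x v * u x :=
  integrable_smul_of_tsupport_subset hu
    (continuous_fderiv_apply_of_contDiff (hφ.of_le (by exact_mod_cast le_top)) v)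
    (hc.fderiv_apply ℝ v) ((tsupport_fderiv_apply_subset ℝ v).trans hs)

theorem integrable_mul_inner (hg : LocallyIntegrableOn g U) {φ : Rn n → ℝ}
    (hφ : ContDiff ℝ ∞ φ) (hc : HasCompactSupport φ) (hs : tsupport φ ⊆ U) (v : Rn n) :
    Integrable fun x => φ x * inner ℝ (g x) v := by
  have := (integrable_smul_of_tsupport_subset hg hφ.continuous hc hs).inner_const (𝕜 := ℝ) v
  simpa [inner_smul_left] using this

/-- The defining identity as one integral over the whole space. It no longer refers to `U`, which
makes restriction to smaller open sets and linearity immediate; `of_integral` is the converse. -/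
theorem integral_add_eq_zero (h : HasWeakGrad U u g) {φ : Rn n → ℝ}
    (hφ : ContDiff ℝ ∞ φ) (hc : HasCompactSupport φ) (hs : tsupport φ ⊆ U) (v : Rn n) :
    ∫ x, (fderiv ℝ φ x v * u x + φ x * inner ℝ (g x) v) = 0 := by
  rw [integral_add (integrable_fderiv_mul h.1 hφ hc hs v) (integrable_mul_inner h.2.1 hφ hc hs v)]
  have h1 := h.2.2 φ hφ hc hs v
  rw [setIntegral_eq_integral_of_forall_compl_eq_zero,
    setIntegral_eq_integral_of_forall_compl_eq_zero] at h1
  · simp only [mul_comm (fderiv ℝ φ _ v)]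
    linarith
  · intro x hx
    rw [image_eq_zero_of_notMem_tsupport fun h => hx (hs h), zero_mul]
  · intro x hx
    have : fderiv ℝ φ x v = 0 := by
      by_contra h
      exact hx (hs (tsupport_fderiv_apply_subset ℝ v (subset_tsupport _ h)))
    rw [this, mul_zero]

theorem of_integral (hu : LocallyIntegrableOn u U) (hg : LocallyIntegrableOn g U)
    (h : ∀ φ : Rn n → ℝ, ContDiff ℝ ∞ φ → HasCompactSupport φ → tsupport φ ⊆ U →
      ∀ v : Rn n, ∫ x, (fderiv ℝ φ x v * u x + φ x * inner ℝ (g x) v) = 0) :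
    HasWeakGrad U u g := by
  refine ⟨hu, hg, fun φ hφ hc hs v => ?_⟩
  have h1 := h φ hφ hc hs v
  rw [integral_add (integrable_fderiv_mul hu hφ hc hs v) (integrable_mul_inner hg hφ hc hs v)]
    at h1
  rw [setIntegral_eq_integral_of_forall_compl_eq_zero,
    setIntegral_eq_integral_of_forall_compl_eq_zero]
  · simp only [mul_comm (u _)]
    linarith
  · intro x hx
    rw [image_eq_zero_of_notMem_tsupport fun h => hx (hs h), zero_mul]
  · intro x hx
    have : fderiv ℝ φ x v = 0 := by
      by_contra h
      exact hx (hs (tsupport_fderiv_apply_subset ℝ v (subset_tsupport _ h)))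
    rw [this, mul_zero]

theorem mono (h : HasWeakGrad U u g) (hV : V ⊆ U) : HasWeakGrad V u g :=
  of_integral (h.1.mono_set hV) (h.2.1.mono_set hV)
    fun _ hφ hc hs v => h.integral_add_eq_zero hφ hc (hs.trans hV) v

theorem add (h : HasWeakGrad U u g) (h' : HasWeakGrad U u' g') :
    HasWeakGrad U (u + u') (g + g') := by
  refine of_integral (h.1.add h'.1) (h.2.1.add h'.2.1) fun φ hφ hc hs v => ?_
  have h1 := h.integral_add_eq_zero hφ hc hs v
  have h2 := h'.integral_add_eq_zero hφ hc hs v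
  rw [← add_zero (0 : ℝ)]
  nth_rewrite 1 [← h1]
  rw [← h2, ← integral_add]
  · refine integral_congr_ae (ae_of_all _ fun x => ?_)
    simp only [Pi.add_apply, inner_add_left]
    ring
  · exact (integrable_fderiv_mul h.1 hφ hc hs v).add (integrable_mul_inner h.2.1 hφ hc hs v)
  · exact (integrable_fderiv_mul h'.1 hφ hc hs v).add (integrable_mul_inner h'.2.1 hφ hc hs v)

theorem const_smul (c : ℝ) (h : HasWeakGrad U u g) : HasWeakGrad U (c • u) (c • g) := by
  refine of_integral (h.1.smul c) (h.2.1.smul c) fun φ hφ hc hs v => ?_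
  rw [← mul_zero c, ← h.integral_add_eq_zero hφ hc hs v, ← integral_const_mul]
  refine integral_congr_ae (ae_of_all _ fun x => ?_)
  simp only [Pi.smul_apply, inner_smul_left, smul_eq_mul, RCLike.conj_to_real]
  ring

theorem sub (h : HasWeakGrad U u g) (h' : HasWeakGrad U u' g') :
    HasWeakGrad U (u - u') (g - g') := by
  rw [sub_eq_add_neg, sub_eq_add_neg, ← neg_one_smul ℝ u', ← neg_one_smul ℝ g']
  exact h.add (h'.const_smul _)

/-- The fundamental lemma of the calculus of variations; it makes the arbitrary choice in `weakGrad`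
harmless. -/
theorem ae_eq (hU : IsOpen U) (h : HasWeakGrad U u g) (h' : HasWeakGrad U u g') :
    g =ᵐ[volume.restrict U] g' := by
  have hl : LocallyIntegrableOn (g - g') U := h.2.1.sub h'.2.1
  have := hU.ae_eq_zero_of_integral_contDiff_smul_eq_zero hl fun φ hφ hc hs => by
    refine ext_inner_left ℝ fun v => ?_
    rw [← integral_inner (integrable_smul_of_tsupport_subset hl hφ.continuous hc hs),
      inner_zero_right]
    have h1 := h.integral_add_eq_zero hφ hc hs v
    have h2 := h'.integral_add_eq_zero hφ hc hs v
    rw [← sub_self (0 : ℝ)]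
    nth_rewrite 1 [← h1]
    rw [← h2, ← integral_sub]
    · refine integral_congr_ae (ae_of_all _ fun x => ?_)
      simp only [Pi.sub_apply, inner_smul_right, inner_sub_right, real_inner_comm v]
      ring
    · exact (integrable_fderiv_mul h.1 hφ hc hs v).add (integrable_mul_inner h.2.1 hφ hc hs v)
    · exact (integrable_fderiv_mul h'.1 hφ hc hs v).add (integrable_mul_inner h'.2.1 hφ hc hs v)
  rw [Filter.EventuallyEq, ae_restrict_iff' hU.measurableSet]
  filter_upwards [this] with x hx hxU
  exact sub_eq_zero.1 (hx hxU)

theorem weakGrad_spec (h : ∃ g, HasWeakGrad U u g) : HasWeakGrad U u (weakGrad U u) := by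
  unfold weakGrad
  rw [dif_pos h]
  exact h.choose_spec

theorem weakGrad_ae_eq (hU : IsOpen U) (h : HasWeakGrad U u g) :
    weakGrad U u =ᵐ[volume.restrict U] g :=
  (weakGrad_spec ⟨g, h⟩).ae_eq hU h

/-- The classical gradient is a weak gradient. -/
theorem of_contDiff {φ : Rn n → ℝ} (hφ : ContDiff ℝ 1 φ) : HasWeakGrad U φ (gradient φ) := by
  have hl : LocallyIntegrableOn φ univ := (hφ.continuous.locallyIntegrable).locallyIntegrableOn _
  have hl' : LocallyIntegrableOn (gradient φ) univ :=
    (continuous_gradient hφ).locallyIntegrable.locallyIntegrableOn _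
  refine mono (U := univ) (of_integral hl hl' fun ψ hψ hc hs v => ?_) (subset_univ U)
  have i1 := integrable_fderiv_mul hl hψ hc hs v
  have i2 := integrable_mul_inner hl' hψ hc hs v
  rw [integral_add i1 i2]
  simp only [inner_gradient_left] at i2 ⊢
  have h1 := integral_mul_fderiv_eq_neg_fderiv_mul_of_integrable (μ := volume) (f := ψ) (g := φ)
    (v := v) i1 i2 ?_ (fun x _ => hψ.differentiable (by simp) x)
    (fun x _ => hφ.differentiable one_ne_zero x)
  · rw [h1]; ring
  · exact integrable_smul_of_tsupport_subset hl hψ.continuous hc hs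

/-- Multiplication by a smooth cutoff function supported in `U` gives a function on `ℝⁿ`. -/
theorem mul_cutoff (h : HasWeakGrad U u g) {χ : Rn n → ℝ} (hχ : ContDiff ℝ ∞ χ)
    (hχc : HasCompactSupport χ) (hχs : tsupport χ ⊆ U) :
    HasWeakGrad univ (fun x => χ x * u x) (fun x => χ x • g x + u x • gradient χ x) := by
  have hχ1 : ContDiff ℝ 1 χ := hχ.of_le (by exact_mod_cast le_top)
  have i1 : Integrable fun x => χ x * u x :=
    integrable_smul_of_tsupport_subset h.1 hχ.continuous hχc hχs
  have i2 : Integrable fun x => χ x • g x :=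
    integrable_smul_of_tsupport_subset h.2.1 hχ.continuous hχc hχs
  have i3 : Integrable fun x => u x • gradient χ x := by
    have h1 : IntegrableOn (fun x => u x • gradient χ x) (tsupport χ) :=
      (h.1.integrableOn_compact_subset hχs hχc).smul_continuousOn
        (continuous_gradient hχ1).continuousOn hχc
    refine (integrableOn_iff_integrable_of_support_subset fun x hx => ?_).1 h1
    by_contra h0
    exact hx (by simp [gradient_eq_zero_of_notMem_tsupport h0])
  refine of_integral (i1.locallyIntegrable.locallyIntegrableOn _)
    ((i2.add i3).locallyIntegrable.locallyIntegrableOn _) fun φ hφ hc _ v => ?_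
  -- The product `φ * χ` is a valid test function for `u` on `U` although `φ` need not be supported
  -- there; the product rule then produces the extra term `u • ∇χ`.
  have hs : tsupport (fun x => φ x * χ x) ⊆ U := (tsupport_mul_subset_right).trans hχs
  rw [← h.integral_add_eq_zero (hφ.mul hχ) hc.mul_right hs v]
  refine integral_congr_ae (ae_of_all _ fun x => ?_)
  have hd : fderiv ℝ (fun x => φ x * χ x) x = φ x • fderiv ℝ χ x + χ x • fderiv ℝ φ x :=
    fderiv_fun_mul (hφ.differentiable (by simp) x) (hχ.differentiable (by simp) x)
  simp only [hd, add_apply, smul_apply, smul_eq_mul,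
    inner_add_left, inner_smul_left, RCLike.conj_to_real, inner_gradient_left]
  ring

theorem congr_left (h : HasWeakGrad U u g)
    (hu : u =ᵐ[volume.restrict U] u') : HasWeakGrad U u' g := by
  refine ⟨?_, h.2.1, fun φ hφ hc hs v => ?_⟩
  · intro x hx
    obtain ⟨t, ht, hi⟩ := h.1 x hx
    refine ⟨t ∩ U, Filter.inter_mem ht self_mem_nhdsWithin, ?_⟩
    refine (hi.mono_set inter_subset_left).congr_fun_ae ?_
    exact ae_restrict_of_ae_restrict_of_subset inter_subset_right hu
  · rw [← h.2.2 φ hφ hc hs v]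
    refine integral_congr_ae ?_
    filter_upwards [hu] with x hx
    rw [hx]

end HasWeakGrad

/-- Hölder's inequality for an integral against a bounded function. -/
theorem enorm_integral_mul_le {μ : Measure (Rn n)} {P : ℝ≥0∞} (hP : 1 ≤ P) {f ψ : Rn n → ℝ}
    (hf : AEStronglyMeasurable f μ) (hψ : AEStronglyMeasurable ψ μ) :
    ‖∫ x, ψ x * f x ∂μ‖ₑ ≤ eLpNorm ψ P.conjExponent μ * eLpNorm f P μ := by
  have : P.HolderConjugate P.conjExponent := .conjExponent hP
  calc ‖∫ x, ψ x * f x ∂μ‖ₑ ≤ ∫⁻ x, ‖ψ x * f x‖ₑ ∂μ := enorm_integral_le_lintegral_enorm _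
    _ = eLpNorm (ψ • f) 1 μ := by rw [eLpNorm_one_eq_lintegral_enorm]; rfl
    _ ≤ _ := eLpNorm_smul_le_mul_eLpNorm hf hψ

theorem MemLp.locallyIntegrableOn_restrict {F : Type*} [NormedAddCommGroup F]
    {P : ℝ≥0∞} (hP : 1 ≤ P) {f : Rn n → F}
    (hf : MemLp f P (volume.restrict U)) : LocallyIntegrableOn f U :=
  locallyIntegrableOn_of_locallyIntegrable_restrict (hf.locallyIntegrable hP)

/-- Weak gradients are stable under limits in `L^P`. -/
theorem HasWeakGrad.of_approx {P : ℝ≥0∞} (hP : 1 ≤ P)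
    (hu : MemLp u P (volume.restrict U)) (hg : MemLp g P (volume.restrict U))
    (h : ∀ ε : ℝ≥0∞, 0 < ε → ∃ u' g', HasWeakGrad U u' g' ∧
      AEStronglyMeasurable u' (volume.restrict U) ∧ AEStronglyMeasurable g' (volume.restrict U) ∧
      eLpNorm (fun x => u x - u' x) P (volume.restrict U) < ε ∧
      eLpNorm (fun x => g x - g' x) P (volume.restrict U) < ε) : HasWeakGrad U u g := by
  have lu := MemLp.locallyIntegrableOn_restrict hP hu
  have lg := MemLp.locallyIntegrableOn_restrict hP hg
  refine ⟨lu, lg, fun φ hφ hc hs v => ?_⟩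
  have hφ1 : ContDiff ℝ 1 φ := hφ.of_le (by exact_mod_cast le_top)
  set ψ : Rn n → ℝ := fun x => fderiv ℝ φ x v with hψ
  have cψ : Continuous ψ := continuous_fderiv_apply_of_contDiff hφ1 v
  have sψ : HasCompactSupport ψ := hc.fderiv_apply ℝ v
  set M := eLpNorm ψ P.conjExponent (volume.restrict U) with hM
  set M' := eLpNorm φ P.conjExponent (volume.restrict U) with hM'
  have hMt : M ≠ ⊤ := ((cψ.memLp_of_hasCompactSupport sψ).restrict U).eLpNorm_ne_top
  have hMt' : M' ≠ ⊤ := ((hφ.continuous.memLp_of_hasCompactSupport hc).restrict U).eLpNorm_ne_top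
  have iu : IntegrableOn (fun x => u x * ψ x) U := by
    have := HasWeakGrad.integrable_fderiv_mul lu hφ hc hs v
    simp only [mul_comm (fderiv ℝ φ _ v)] at this
    exact this.integrableOn
  have ig : IntegrableOn (fun x => φ x * inner ℝ (g x) v) U :=
    (HasWeakGrad.integrable_mul_inner lg hφ hc hs v).integrableOn
  rw [← sub_eq_zero, sub_neg_eq_add]
  suffices hz : ‖(∫ x in U, u x * ψ x) + ∫ x in U, φ x * inner ℝ (g x) v‖ₑ = 0 by
    simpa using hz
  by_contra hne
  have hC : M + ‖v‖ₑ * M' ≠ ⊤ :=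
    ENNReal.add_ne_top.2 ⟨hMt, ENNReal.mul_ne_top enorm_ne_top hMt'⟩
  set D := ‖(∫ x in U, u x * ψ x) + ∫ x in U, φ x * inner ℝ (g x) v‖ₑ with hD
  have hDt : D ≠ ⊤ := enorm_ne_top
  -- If the defect `D` were nonzero, Hölder's inequality would bound it by `(M + ‖v‖ M') * ε`. The
  -- `+ 1` in the denominator makes this strictly less than `D`.
  obtain ⟨u', g', hw, mu, mg, e1, e2⟩ := h (D / (M + ‖v‖ₑ * M' + 1))
    (ENNReal.div_pos hne (ENNReal.add_ne_top.2 ⟨hC, ENNReal.one_ne_top⟩))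
  set ε := D / (M + ‖v‖ₑ * M' + 1) with hε
  have iu' : IntegrableOn (fun x => u' x * ψ x) U := by
    have := HasWeakGrad.integrable_fderiv_mul hw.1 hφ hc hs v
    simp only [mul_comm (fderiv ℝ φ _ v)] at this
    exact this.integrableOn
  have ig' : IntegrableOn (fun x => φ x * inner ℝ (g' x) v) U :=
    (HasWeakGrad.integrable_mul_inner hw.2.1 hφ hc hs v).integrableOn
  have eq : (∫ x in U, u x * ψ x) + ∫ x in U, φ x * inner ℝ (g x) v =
      (∫ x in U, ψ x * (u x - u' x)) + ∫ x in U, φ x * inner ℝ (g x - g' x) v := by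
    have h1 : ∫ x in U, ψ x * (u x - u' x) = (∫ x in U, u x * ψ x) - ∫ x in U, u' x * ψ x := by
      rw [← integral_sub iu iu']
      exact integral_congr_ae (ae_of_all _ fun x => by simp only; ring)
    have h2 : ∫ x in U, φ x * inner ℝ (g x - g' x) v =
        (∫ x in U, φ x * inner ℝ (g x) v) - ∫ x in U, φ x * inner ℝ (g' x) v := by
      rw [← integral_sub ig ig']
      exact integral_congr_ae (ae_of_all _ fun x => by simp only [inner_sub_left]; ring)
    rw [h1, h2, hw.2.2 φ hφ hc hs v]
    ring
  have b1 : ‖∫ x in U, ψ x * (u x - u' x)‖ₑ ≤ M * ε :=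
    (enorm_integral_mul_le hP (hu.1.sub mu) cψ.aestronglyMeasurable).trans
      (mul_le_mul_right e1.le _)
  have b2 : ‖∫ x in U, φ x * inner ℝ (g x - g' x) v‖ₑ ≤ M' * (‖v‖ₑ * ε) := by
    refine (enorm_integral_mul_le hP ((hg.1.sub mg).inner_const)
      hφ.continuous.aestronglyMeasurable).trans (mul_le_mul_right ?_ _)
    calc eLpNorm (fun x => inner ℝ (g x - g' x) v) P (volume.restrict U)
        ≤ eLpNorm (‖v‖ • fun x => g x - g' x) P (volume.restrict U) := by
          refine eLpNorm_mono fun x => ?_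
          rw [Pi.smul_apply, norm_smul, norm_norm, mul_comm]
          exact norm_inner_le_norm _ _
      _ = ‖v‖ₑ * eLpNorm (fun x => g x - g' x) P (volume.restrict U) := by
          rw [eLpNorm_const_smul, enorm_norm]
      _ ≤ ‖v‖ₑ * ε := mul_le_mul_right e2.le _
  have : D ≤ (M + ‖v‖ₑ * M') * ε := by
    rw [hD, eq]
    refine (enorm_add_le _ _).trans ((add_le_add b1 b2).trans (le_of_eq ?_))
    ring
  have hlt : (M + ‖v‖ₑ * M') * ε < D := by
    have hK0 : M + ‖v‖ₑ * M' + 1 ≠ 0 := by simp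
    have hKt : M + ‖v‖ₑ * M' + 1 ≠ ⊤ := ENNReal.add_ne_top.2 ⟨hC, ENNReal.one_ne_top⟩
    have h1 : (M + ‖v‖ₑ * M' + 1) * ε = D := ENNReal.mul_div_cancel hK0 hKt
    have h2 : ε ≠ 0 := (ENNReal.div_pos hne hKt).ne'
    have h3 : ε ≠ ⊤ := (ENNReal.div_lt_top hDt hK0).ne
    calc (M + ‖v‖ₑ * M') * ε < (M + ‖v‖ₑ * M' + 1) * ε :=
          (ENNReal.mul_lt_mul_iff_left h2 h3).2 (ENNReal.lt_add_right hC one_ne_zero)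
      _ = D := h1
  exact absurd this (not_le.2 hlt)

end WeakGrad

/-! ### Lipschitz boundaries -/

section Geometry

variable {n : ℕ} {U : Set (Rn n)} {x y e : Rn n} {r : ℝ} {γ : Rn n → ℝ}

/-- The strict hypograph of `γ` is open and, inside the ball, disjoint from `U`. -/
theorem notMem_closure_of_lt_chart (hγ : Continuous γ)
    (h : ∀ y ∈ Metric.ball x r, (y ∈ U ↔ γ (y - inner ℝ y e • e) < inner ℝ y e))
    (hy : y ∈ Metric.ball x r) (hlt : inner ℝ y e < γ (y - inner ℝ y e • e)) :
    y ∉ closure U := by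
  intro hcl
  have hopen : IsOpen {y | inner ℝ y e < γ (y - inner ℝ y e • e)} :=
    isOpen_lt (by fun_prop) (by fun_prop)
  obtain ⟨z, ⟨hz1, hz2⟩, hz3⟩ := mem_closure_iff.1 hcl _ (Metric.isOpen_ball.inter hopen) ⟨hy, hlt⟩
  exact lt_asymm hz2 ((h z hz1).1 hz3)

theorem chart_eq_of_mem_frontier (hU : IsOpen U) (hγ : Continuous γ)
    (h : ∀ y ∈ Metric.ball x r, (y ∈ U ↔ γ (y - inner ℝ y e • e) < inner ℝ y e))
    (hy : y ∈ Metric.ball x r) (hf : y ∈ frontier U) :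
    γ (y - inner ℝ y e • e) = inner ℝ y e := by
  refine le_antisymm ?_ ?_
  · by_contra hlt
    exact notMem_closure_of_lt_chart hγ h hy (not_le.1 hlt) (frontier_subset_closure hf)
  · by_contra hlt
    have := (h y hy).2 (not_le.1 hlt)
    rw [hU.frontier_eq] at hf
    exact hf.2 this

theorem inner_add_smul_unit (he : ‖e‖ = 1) (y : Rn n) (t : ℝ) :
    inner ℝ (y + t • e) e = inner ℝ y e + t := by
  rw [inner_add_left, inner_smul_left, real_inner_self_eq_norm_sq, he]
  simp

theorem proj_add_smul_unit (he : ‖e‖ = 1) (y : Rn n) (t : ℝ) :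
    y + t • e - inner ℝ (y + t • e) e • e = y - inner ℝ y e • e := by
  rw [inner_add_smul_unit he]
  module

/-- A Lipschitz boundary is a null set. -/
theorem volume_frontier_eq_zero (hU : IsOpen U) (h : HasLipschitzBoundary U) :
    volume (frontier U) = 0 := by
  refine measure_null_of_locally_null _ fun x hx => ?_
  obtain ⟨e, he, r, hr, K, γ, hγ, hch⟩ := h x hx
  refine ⟨frontier U ∩ Metric.ball x r,
    Filter.inter_mem self_mem_nhdsWithin (mem_nhdsWithin_of_mem_nhds (Metric.ball_mem_nhds x hr)),
    ?_⟩
  refine measure_mono_null (t := {y | γ (y - inner ℝ y e • e) = inner ℝ y e})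
    (fun y hy => chart_eq_of_mem_frontier hU hγ.continuous hch hy.2 hy.1) ?_
  have hcl : IsClosed {y : Rn n | γ (y - inner ℝ y e • e) = inner ℝ y e} :=
    isClosed_eq (hγ.continuous.comp (by fun_prop)) (by fun_prop)
  -- The shifts of a graph by distinct multiples of `e` are disjoint. Infinitely many disjoint
  -- translates by a bounded sequence force measure zero.
  refine Measure.addHaar_eq_zero_of_disjoint_translates volume
    (fun k : ℕ => (1 / ((k : ℝ) + 1)) • e) ?_ ?_ hcl.measurableSet
  · refine (Metric.isBounded_closedBall (x := (0 : Rn n)) (r := 1)).subset ?_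
    rintro _ ⟨k, rfl⟩
    rw [mem_closedBall_zero_iff, norm_smul, he, mul_one, Real.norm_of_nonneg (by positivity),
      div_le_one (by positivity)]
    linarith [Nat.cast_nonneg (α := ℝ) k]
  · intro k l hkl
    rw [Function.onFun, Set.disjoint_left]
    rintro z hz1 hz2
    rw [singleton_add, mem_image] at hz1 hz2
    obtain ⟨y1, hy1, rfl⟩ := hz1
    obtain ⟨y2, hy2, hyy⟩ := hz2
    simp only [mem_ofPred_eq] at hy1 hy2
    rw [add_comm, add_comm _ y1] at hyy
    have h1 := proj_add_smul_unit he y1 (1 / ((k : ℝ) + 1))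
    have h2 := proj_add_smul_unit he y2 (1 / ((l : ℝ) + 1))
    have h3 := inner_add_smul_unit he y1 (1 / ((k : ℝ) + 1))
    have h4 := inner_add_smul_unit he y2 (1 / ((l : ℝ) + 1))
    rw [hyy, h1] at h2
    rw [hyy, h3, ← hy1, ← hy2, h2] at h4
    have h5 : 1 / ((k : ℝ) + 1) = 1 / ((l : ℝ) + 1) := by linarith
    have h6 : (k : ℝ) + 1 = l + 1 := by
      have := congrArg (fun t : ℝ => t⁻¹) h5
      simpa using this
    exact hkl (by exact_mod_cast add_right_cancel h6)

end Geometry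

/-! ### Poincaré's inequality -/

section Poincare

/-- Jensen's inequality for powers. -/
theorem lintegral_rpow_le_of_isProbabilityMeasure {α : Type*} [MeasurableSpace α] {ν : Measure α}
    [IsProbabilityMeasure ν] {p : ℝ} (hp : 1 ≤ p) {f : α → ℝ≥0∞} (hf : AEMeasurable f ν) :
    (∫⁻ x, f x ∂ν) ^ p ≤ ∫⁻ x, f x ^ p ∂ν := by
  rcases hp.eq_or_lt with rfl | hp
  · simp
  have hpq : p.HolderConjugate (Real.conjExponent p) := Real.HolderConjugate.conjExponent hp
  have h := ENNReal.lintegral_mul_le_Lp_mul_Lq ν hpq hf (aemeasurable_const (b := (1 : ℝ≥0∞)))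
  simp only [Pi.mul_apply, mul_one, ENNReal.one_rpow, lintegral_const, measure_univ] at h
  have hp0 : 0 < p := by linarith
  calc (∫⁻ x, f x ∂ν) ^ p ≤ ((∫⁻ x, f x ^ p ∂ν) ^ (1 / p)) ^ p := by gcongr
    _ = ∫⁻ x, f x ^ p ∂ν := by
      rw [← ENNReal.rpow_mul, one_div_mul_cancel hp0.ne', ENNReal.rpow_one]

variable {n : ℕ} {Ω A S T : Set (Rn n)} {p : ℝ}

theorem setLIntegral_translate_le (hT : MeasurableSet T) (v : Rn n) (h : ∀ x ∈ S, x + v ∈ T)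
    (F : Rn n → ℝ≥0∞) : ∫⁻ x in S, F (x + v) ≤ ∫⁻ x in T, F x := by
  have hT' : MeasurableSet ((fun x => x + v) ⁻¹' T) := measurable_add_const v hT
  calc ∫⁻ x in S, F (x + v) ≤ ∫⁻ x in (fun x => x + v) ⁻¹' T, F (x + v) :=
        lintegral_mono_set h
    _ = ∫⁻ x, (T.indicator F) (x + v) := by
        rw [← lintegral_indicator hT']; rfl
    _ = ∫⁻ x, T.indicator F x := lintegral_add_right_eq_self _ v
    _ = ∫⁻ x in T, F x := lintegral_indicator hT _

/-- The fundamental theorem of calculus along the segment from `x` to `x + v`, followed by Jensen's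
inequality on `(0, 1)`. -/
theorem enorm_rpow_le_translate (hp : 1 ≤ p) {φ : Rn n → ℝ} (hφ : ContDiff ℝ 1 φ) (x v : Rn n) :
    ‖φ x‖ₑ ^ p ≤ 2 ^ p * (‖φ (x + v)‖ₑ ^ p +
      ‖v‖ₑ ^ p * ∫⁻ t in Ioo (0 : ℝ) 1, ‖gradient φ (x + t • v)‖ₑ ^ p) := by
  have hp0 : 0 ≤ p := by linarith
  have hd : ∀ t : ℝ, HasDerivAt (fun t : ℝ => φ (x + t • v)) (fderiv ℝ φ (x + t • v) v) t := by
    intro t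
    have h1 : HasDerivAt (fun t : ℝ => x + t • v) v t := by
      simpa using ((hasDerivAt_id t).smul_const v).const_add x
    exact ((hφ.differentiable one_ne_zero _).hasFDerivAt).comp_hasDerivAt t h1
  have hcont : Continuous fun t : ℝ => fderiv ℝ φ (x + t • v) v :=
    (continuous_fderiv_apply_of_contDiff hφ v).comp (by fun_prop)
  have hftc := intervalIntegral.integral_eq_sub_of_hasDerivAt (a := 0) (b := 1)
    (fun t _ => hd t) (hcont.intervalIntegrable 0 1)
  simp only [one_smul, zero_smul, add_zero] at hftc
  have hcg : Continuous fun t : ℝ => ‖gradient φ (x + t • v)‖ₑ :=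
    ((continuous_gradient hφ).comp (by fun_prop)).enorm
  have : IsProbabilityMeasure (volume.restrict (Ioo (0 : ℝ) 1)) := ⟨by simp⟩
  have h1 : ‖φ x‖ₑ ≤ ‖φ (x + v)‖ₑ + ‖v‖ₑ * ∫⁻ t in Ioo (0 : ℝ) 1, ‖gradient φ (x + t • v)‖ₑ := by
    have e : φ x = φ (x + v) - ∫ t in (0 : ℝ)..1, fderiv ℝ φ (x + t • v) v := by rw [hftc]; ring
    rw [e]
    refine enorm_sub_le.trans ?_
    gcongr
    rw [intervalIntegral.integral_of_le zero_le_one, integral_Ioc_eq_integral_Ioo]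
    refine (enorm_integral_le_lintegral_enorm _).trans ?_
    rw [← lintegral_const_mul' _ _ enorm_ne_top]
    refine lintegral_mono fun t => ?_
    rw [← inner_gradient_left, mul_comm]
    rw [← ofReal_norm, ← ofReal_norm, ← ofReal_norm, ← ENNReal.ofReal_mul (norm_nonneg _)]
    exact ENNReal.ofReal_le_ofReal (norm_inner_le_norm _ _)
  have h2 : (∫⁻ t in Ioo (0 : ℝ) 1, ‖gradient φ (x + t • v)‖ₑ) ^ p ≤
      ∫⁻ t in Ioo (0 : ℝ) 1, ‖gradient φ (x + t • v)‖ₑ ^ p :=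
    lintegral_rpow_le_of_isProbabilityMeasure hp hcg.measurable.aemeasurable
  set a := ‖φ (x + v)‖ₑ
  set b := ‖v‖ₑ * ∫⁻ t in Ioo (0 : ℝ) 1, ‖gradient φ (x + t • v)‖ₑ with hb
  calc ‖φ x‖ₑ ^ p ≤ (a + b) ^ p := by gcongr
    _ ≤ (2 * max a b) ^ p := by
        gcongr
        rw [two_mul]
        exact add_le_add (le_max_left _ _) (le_max_right _ _)
    _ = 2 ^ p * (max a b) ^ p := ENNReal.mul_rpow_of_nonneg _ _ hp0
    _ ≤ 2 ^ p * (a ^ p + b ^ p) := by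
        gcongr
        rcases max_cases a b with ⟨h, _⟩ | ⟨h, _⟩ <;> rw [h]
        · exact le_self_add
        · exact le_add_self
    _ ≤ _ := by
        gcongr
        rw [hb, ENNReal.mul_rpow_of_nonneg _ _ hp0]
        gcongr

/-- Test functions are controlled on `S` by their gradients outside of `closure A`. -/
def PoincareOn (Ω A : Set (Rn n)) (p : ℝ) (S : Set (Rn n)) : Prop :=
  ∃ C : ℝ≥0, ∀ φ : Rn n → ℝ, ContDiff ℝ 1 φ → HasCompactSupport φ → tsupport φ ⊆ Ω →
    ∫⁻ x in S, ‖φ x‖ₑ ^ p ≤ C * ∫⁻ x in (closure A)ᶜ, ‖gradient φ x‖ₑ ^ p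

namespace PoincareOn

theorem mono (h : PoincareOn Ω A p T) (hST : S ⊆ T) : PoincareOn Ω A p S := by
  obtain ⟨C, hC⟩ := h
  exact ⟨C, fun φ h1 h2 h3 => (lintegral_mono_set hST).trans (hC φ h1 h2 h3)⟩

theorem union (h : PoincareOn Ω A p S) (h' : PoincareOn Ω A p T) : PoincareOn Ω A p (S ∪ T) := by
  obtain ⟨C, hC⟩ := h
  obtain ⟨C', hC'⟩ := h'
  refine ⟨C + C', fun φ h1 h2 h3 => (lintegral_union_le _ _ _).trans ?_⟩
  rw [ENNReal.coe_add, add_mul]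
  exact add_le_add (hC φ h1 h2 h3) (hC' φ h1 h2 h3)

theorem of_disjoint (hp : 0 < p) (hS : MeasurableSet S) (h : Disjoint S Ω) :
    PoincareOn Ω A p S := by
  refine ⟨0, fun φ _ _ h3 => ?_⟩
  rw [setLIntegral_congr_fun (g := fun _ => 0) hS]
  · simp
  · intro x hx
    have : x ∉ tsupport φ := fun hx' => Set.disjoint_left.1 h hx (h3 hx')
    simp [image_eq_zero_of_notMem_tsupport this, hp]

/-- Control on `T` passes to `S` by shifting along `v`, at the cost of the gradient on the segments,
integrated by Tonelli. Segments must avoid `closure A` but may leave `Ω`, where test functions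
vanish; hence the integral over all of `(closure A)ᶜ` in `PoincareOn`. -/
theorem translate (hp : 1 ≤ p) (hT : PoincareOn Ω A p T) (hTm : MeasurableSet T) (v : Rn n)
    (h1 : ∀ x ∈ S, x + v ∈ T)
    (h2 : ∀ x ∈ S, ∀ t ∈ Ioo (0 : ℝ) 1, x + t • v ∈ (closure A)ᶜ) : PoincareOn Ω A p S := by
  obtain ⟨C, hC⟩ := hT
  have hp0 : 0 ≤ p := by linarith
  have hD : (2 : ℝ≥0∞) ^ p * (C + ‖v‖ₑ ^ p) ≠ ⊤ := by
    refine ENNReal.mul_ne_top (ENNReal.rpow_ne_top_of_nonneg hp0 (by simp)) ?_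
    exact ENNReal.add_ne_top.2 ⟨ENNReal.coe_ne_top, ENNReal.rpow_ne_top_of_nonneg hp0 enorm_ne_top⟩
  refine ⟨((2 : ℝ≥0∞) ^ p * (C + ‖v‖ₑ ^ p)).toNNReal, fun φ hφ hc hs => ?_⟩
  rw [ENNReal.coe_toNNReal hD]
  set I := ∫⁻ x in (closure A)ᶜ, ‖gradient φ x‖ₑ ^ p with hI
  have hcg := continuous_gradient hφ
  have hmeas : Measurable fun z : Rn n × ℝ => ‖gradient φ (z.1 + z.2 • v)‖ₑ ^ p :=
    ((hcg.comp (by fun_prop : Continuous fun z : Rn n × ℝ => z.1 + z.2 • v)).enorm).measurable.pow_const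
      p
  have hin : Measurable fun x : Rn n =>
      ∫⁻ t in Ioo (0 : ℝ) 1, ‖gradient φ (x + t • v)‖ₑ ^ p :=
    hmeas.lintegral_prod_right'
  have m1 : Measurable fun x : Rn n => ‖φ (x + v)‖ₑ ^ p :=
    ((hφ.continuous.comp (by fun_prop)).enorm).measurable.pow_const p
  calc ∫⁻ x in S, ‖φ x‖ₑ ^ p ≤ ∫⁻ x in S, 2 ^ p * (‖φ (x + v)‖ₑ ^ p +
        ‖v‖ₑ ^ p * ∫⁻ t in Ioo (0 : ℝ) 1, ‖gradient φ (x + t • v)‖ₑ ^ p) :=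
        lintegral_mono fun x => enorm_rpow_le_translate hp hφ x v
    _ = 2 ^ p * ((∫⁻ x in S, ‖φ (x + v)‖ₑ ^ p) +
        ‖v‖ₑ ^ p * ∫⁻ x in S, ∫⁻ t in Ioo (0 : ℝ) 1, ‖gradient φ (x + t • v)‖ₑ ^ p) := by
        rw [lintegral_const_mul' _ _ (ENNReal.rpow_ne_top_of_nonneg hp0 (by simp)),
          lintegral_add_left m1,
          lintegral_const_mul _ hin]
    _ ≤ 2 ^ p * (C * I + ‖v‖ₑ ^ p * I) := by
        gcongr
        · exact (setLIntegral_translate_le hTm v h1 fun x => ‖φ x‖ₑ ^ p).trans (hC φ hφ hc hs)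
        · rw [lintegral_lintegral_swap hmeas.aemeasurable]
          calc ∫⁻ t in Ioo (0 : ℝ) 1, ∫⁻ x in S, ‖gradient φ (x + t • v)‖ₑ ^ p
              ≤ ∫⁻ _ in Ioo (0 : ℝ) 1, I := by
                refine setLIntegral_mono measurable_const fun t ht => ?_
                exact setLIntegral_translate_le isClosed_closure.isOpen_compl.measurableSet (t • v)
                  (fun x hx => h2 x hx t ht) fun x => ‖gradient φ x‖ₑ ^ p
            _ = I := by simp
    _ = _ := by ring

end PoincareOn

end Poincare

/-! ### Propagation of Poincaré's inequality through the exterior region -/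

section Poincare

variable {n : ℕ} {Ω A : Set (Rn n)} {p : ℝ}

/-- `y` has a neighbourhood on which test functions are controlled. -/
def PoincareAt (Ω A : Set (Rn n)) (p : ℝ) (y : Rn n) : Prop :=
  ∃ r : ℝ, 0 < r ∧ PoincareOn Ω A p (Metric.ball y r)

/-- A small ball at `y` is shifted to `z`. The segment from `y` to `z` stays in the convex
half-radius ball, and the other half of the radius leaves room for the moving ball. -/
theorem PoincareAt.of_near (hp : 1 ≤ p) {c y z : Rn n} {ρ : ℝ} (hρ : 0 < ρ)
    (hball : Metric.ball c ρ ⊆ (closure A)ᶜ) (hy : y ∈ Metric.ball c (ρ / 2))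
    (hz : z ∈ Metric.ball c (ρ / 2)) (h : PoincareAt Ω A p z) : PoincareAt Ω A p y := by
  obtain ⟨r, hr, h⟩ := h
  refine ⟨min r (ρ / 2), by positivity, h.translate hp Metric.isOpen_ball.measurableSet (z - y)
    (fun x hx => ?_) fun x hx t ht => hball ?_⟩
  · have h1 : dist x y < min r (ρ / 2) := hx
    rw [Metric.mem_ball, dist_eq_norm, show x + (z - y) - z = x - y by abel, ← dist_eq_norm]
    exact h1.trans_le (min_le_left _ _)
  · have h1 : dist x y < min r (ρ / 2) := hx
    have h2 : y + t • (z - y) ∈ Metric.ball c (ρ / 2) :=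
      (convex_ball c (ρ / 2)).add_smul_sub_mem hy hz ⟨ht.1.le, ht.2.le⟩
    have h3 : dist (x + t • (z - y)) (y + t • (z - y)) = dist x y := dist_add_right _ _ _
    have h4 : dist (y + t • (z - y)) c < ρ / 2 := h2
    rw [Metric.mem_ball]
    have := dist_triangle (x + t • (z - y)) (y + t • (z - y)) c
    have := min_le_right r (ρ / 2)
    linarith

theorem exists_ball_subset_compl_closure {y : Rn n} (hy : y ∉ closure A) :
    ∃ ρ : ℝ, 0 < ρ ∧ Metric.ball y ρ ⊆ (closure A)ᶜ :=
  Metric.isOpen_iff.1 isClosed_closure.isOpen_compl y hy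

/-- Test functions vanish just beyond a point `z` of `closure Ω` that is extremal in a direction
`e`, so `z` is controlled. Off `closure A` the property is locally constant, hence it spreads from
points of `Ω` near `z` to the whole connected exterior. -/
theorem poincareAt_of_mem_outer [Nontrivial (Rn n)] (hp : 1 ≤ p) (hΩ : IsOpen Ω)
    (hb : Bornology.IsBounded Ω) (hA : IsInclusion Ω A) :
    ∀ y ∈ outer Ω A, PoincareAt Ω A p y := by
  obtain ⟨e, he⟩ := exists_norm_eq (Rn n) (zero_le_one (α := ℝ))
  have hne : Ω.Nonempty := hA.outer_connected.nonempty.mono sdiff_subset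
  obtain ⟨z, hz, hmax⟩ := hb.isCompact_closure.exists_isMaxOn hne.closure
    (f := fun y => inner ℝ y e) (by fun_prop)
  have hzΩ : z ∉ Ω := by
    intro hzΩ
    obtain ⟨ε, hε, hball⟩ := Metric.isOpen_iff.1 hΩ z hzΩ
    have h1 : z + (ε / 2) • e ∈ Ω := hball (by
      rw [Metric.mem_ball, dist_eq_norm, add_sub_cancel_left, norm_smul, he, mul_one,
        Real.norm_of_nonneg (by positivity)]
      linarith)
    have h2 := hmax (subset_closure h1)
    simp only [mem_ofPred_eq, inner_add_smul_unit he] at h2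
    linarith
  obtain ⟨ρ, hρ, hball⟩ := exists_ball_subset_compl_closure
    (fun h => hzΩ (hA.closure_subset h) : z ∉ closure A)
  -- On this ball `inner ℝ y e` exceeds its maximum over `closure Ω`, so the ball misses `Ω`.
  have good1 : PoincareAt Ω A p (z + (ρ / 4) • e) := by
    refine ⟨ρ / 8, by positivity, PoincareOn.of_disjoint (by linarith)
      Metric.isOpen_ball.measurableSet (Set.disjoint_left.2 fun y hy hyΩ => ?_)⟩
    have h1 := hmax (subset_closure hyΩ)
    simp only [mem_ofPred_eq] at h1
    have h2 : ‖y - (z + (ρ / 4) • e)‖ < ρ / 8 := by rw [← dist_eq_norm]; exact hy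
    have h3 := abs_real_inner_le_norm (y - (z + (ρ / 4) • e)) e
    rw [he, mul_one, inner_sub_left, inner_add_smul_unit he] at h3
    have := (abs_le.1 h3).1
    linarith
  have good2 : PoincareAt Ω A p z := by
    refine PoincareAt.of_near hp hρ hball (Metric.mem_ball_self (by positivity)) ?_ good1
    rw [Metric.mem_ball, dist_eq_norm, add_sub_cancel_left, norm_smul, he, mul_one,
      Real.norm_of_nonneg (by positivity)]
    linarith
  have hloc : ∀ y ∉ closure A, ∃ ρ : ℝ, 0 < ρ ∧ ∀ y' ∈ Metric.ball y ρ, y' ∉ closure A ∧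
      (PoincareAt Ω A p y' ↔ PoincareAt Ω A p y) := by
    intro y hy
    obtain ⟨ρ, hρ, hball⟩ := exists_ball_subset_compl_closure hy
    refine ⟨ρ / 2, by positivity, fun y' hy' =>
      ⟨hball (Metric.ball_subset_ball (by linarith) hy'), ?_, ?_⟩⟩
    · exact PoincareAt.of_near hp hρ hball (Metric.mem_ball_self (by positivity)) hy'
    · exact PoincareAt.of_near hp hρ hball hy' (Metric.mem_ball_self (by positivity))
  have o1 : IsOpen {y | y ∉ closure A ∧ PoincareAt Ω A p y} := by
    refine Metric.isOpen_iff.2 fun y hy => ?_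
    obtain ⟨ρ, hρ, h⟩ := hloc y hy.1
    exact ⟨ρ, hρ, fun y' hy' => ⟨(h y' hy').1, (h y' hy').2.2 hy.2⟩⟩
  have o2 : IsOpen {y | y ∉ closure A ∧ ¬PoincareAt Ω A p y} := by
    refine Metric.isOpen_iff.2 fun y hy => ?_
    obtain ⟨ρ, hρ, h⟩ := hloc y hy.1
    exact ⟨ρ, hρ, fun y' hy' => ⟨(h y' hy').1, fun hg => hy.2 ((h y' hy').2.1 hg)⟩⟩
  have hsub : outer Ω A ⊆ {y | y ∉ closure A ∧ PoincareAt Ω A p y} := by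
    refine hA.outer_connected.isPreconnected.subset_left_of_subset_union o1 o2 ?_ ?_ ?_
    · exact Set.disjoint_left.2 fun y h1 h2 => h2.2 h1.2
    · intro y hy
      by_cases h : PoincareAt Ω A p y
      · exact Or.inl ⟨hy.2, h⟩
      · exact Or.inr ⟨hy.2, h⟩
    · obtain ⟨y, hyΩ, hy⟩ := Metric.mem_closure_iff.1 hz (ρ / 2) (by positivity)
      have hy' : y ∈ Metric.ball z (ρ / 2) := by rwa [Metric.mem_ball, dist_comm]
      have hyA : y ∉ closure A := hball (Metric.ball_subset_ball (by linarith) hy')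
      exact ⟨y, ⟨hyΩ, hyA⟩, hyA, PoincareAt.of_near hp hρ hball hy'
        (Metric.mem_ball_self (by positivity)) good2⟩
  exact fun y hy => (hsub hy).2

theorem poincareAt_of_mem_closure [Nontrivial (Rn n)] (hp : 1 ≤ p) (hΩ : IsOpen Ω)
    (hb : Bornology.IsBounded Ω) (hA : IsInclusion Ω A) {y : Rn n} (hy : y ∈ closure Ω)
    (hyA : y ∉ closure A) : PoincareAt Ω A p y := by
  obtain ⟨ρ, hρ, hball⟩ := exists_ball_subset_compl_closure hyA
  obtain ⟨z, hzΩ, hz⟩ := Metric.mem_closure_iff.1 hy (ρ / 2) (by positivity)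
  have hz' : z ∈ Metric.ball y (ρ / 2) := by rwa [Metric.mem_ball, dist_comm]
  exact PoincareAt.of_near hp hρ hball (Metric.mem_ball_self (by positivity)) hz'
    (poincareAt_of_mem_outer hp hΩ hb hA z
      ⟨hzΩ, hball (Metric.ball_subset_ball (by linarith) hz')⟩)

/-- Near `y` the inclusion lies above a graph in direction `e`. Moving an exterior point by `-τ • e`
keeps it off `closure A` and takes it near `y - τ • e`, an interior point of the exterior region
where control is known. -/
theorem exists_poincareOn_of_mem_frontier [Nontrivial (Rn n)] (hp : 1 ≤ p) (hΩ : IsOpen Ω)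
    (hb : Bornology.IsBounded Ω) (hA : IsInclusion Ω A) {y : Rn n} (hy : y ∈ frontier A) :
    ∃ δ : ℝ, 0 < δ ∧ PoincareOn Ω A p (Metric.ball y δ ∩ (closure A)ᶜ) := by
  obtain ⟨e, he, r, hr, K, γ, hγ, hch⟩ := hA.lipschitz y hy
  have hyΩ : y ∈ Ω := hA.closure_subset (frontier_subset_closure hy)
  obtain ⟨ε, hε, hball⟩ := Metric.isOpen_iff.1 hΩ y hyΩ
  set τ : ℝ := min r ε / 4 with hτ
  have hτ0 : 0 < τ := by positivity
  have hτr : 4 * τ ≤ r := by have := min_le_left r ε; linarith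
  have hτε : 4 * τ ≤ ε := by have := min_le_right r ε; linarith
  have hdown : ∀ x : Rn n, x ∈ Metric.ball y τ → x ∉ A → ∀ t : ℝ, 0 < t → t ≤ τ →
      x + (-t) • e ∉ closure A := by
    intro x hx hxA t ht htτ
    have hxr : x ∈ Metric.ball y r := Metric.ball_subset_ball (by linarith) hx
    have h1 : x + (-t) • e ∈ Metric.ball y r := by
      rw [Metric.mem_ball]
      have h2 : dist (x + (-t) • e) x = t := by
        rw [dist_eq_norm, add_sub_cancel_left, norm_smul, he, mul_one, norm_neg,
          Real.norm_of_nonneg ht.le]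
      have h3 : dist x y < τ := hx
      have := dist_triangle (x + (-t) • e) x y
      linarith
    refine notMem_closure_of_lt_chart hγ.continuous hch h1 ?_
    rw [proj_add_smul_unit he, inner_add_smul_unit he]
    have := not_lt.1 fun h => hxA ((hch x hxr).2 h)
    linarith
  have hyA : y ∉ A := by
    rw [hA.isOpen.frontier_eq] at hy
    exact hy.2
  have hc : y + (-τ) • e ∉ closure A :=
    hdown y (Metric.mem_ball_self hτ0) hyA τ hτ0 le_rfl
  have hcΩ : y + (-τ) • e ∈ Ω := hball (by
    rw [Metric.mem_ball, dist_eq_norm, add_sub_cancel_left, norm_smul, he, mul_one, norm_neg,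
      Real.norm_of_nonneg hτ0.le]
    linarith)
  obtain ⟨r', hr', hP⟩ := poincareAt_of_mem_outer hp hΩ hb hA _ ⟨hcΩ, hc⟩
  refine ⟨min r' τ, by positivity, hP.translate hp Metric.isOpen_ball.measurableSet ((-τ) • e)
    (fun x hx => ?_) fun x hx t ht => ?_⟩
  · rw [Metric.mem_ball, dist_add_right]
    exact lt_of_lt_of_le hx.1 (min_le_left _ _)
  · have h1 := hdown x (Metric.ball_subset_ball (min_le_right _ _) hx.1)
      (fun h => hx.2 (subset_closure h)) (t * τ) (by have := ht.1; positivity)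
      (by nlinarith [ht.1, ht.2])
    rwa [smul_smul, mul_neg]

/-- The local estimates, at points off `closure A` and at points of `∂A`, are patched by compactness
of `closure Ω`; inside `A` there is nothing to prove. -/
theorem poincareOn_outer [Nontrivial (Rn n)] (hp : 1 ≤ p) (hΩ : IsOpen Ω)
    (hb : Bornology.IsBounded Ω) (hA : IsInclusion Ω A) : PoincareOn Ω A p (outer Ω A) := by
  have h : PoincareOn Ω A p (closure Ω ∩ (closure A)ᶜ) := by
    refine hb.isCompact_closure.induction_on (p := fun S => PoincareOn Ω A p (S ∩ (closure A)ᶜ))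
      ?_ (fun S T hST h => h.mono (inter_subset_inter_left _ hST)) (fun S T hS hT => ?_)
      fun y hy => ?_
    · rw [empty_inter]; exact PoincareOn.of_disjoint (by linarith) MeasurableSet.empty (by simp)
    · rw [union_inter_distrib_right]; exact hS.union hT
    · by_cases h1 : y ∈ closure A
      · by_cases h2 : y ∈ A
        · refine ⟨A, mem_nhdsWithin_of_mem_nhds (hA.isOpen.mem_nhds h2), ?_⟩
          have : A ∩ (closure A)ᶜ = ∅ := by
            rw [← Set.disjoint_iff_inter_eq_empty]
            exact disjoint_compl_right.mono_left subset_closure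
          rw [this]
          exact PoincareOn.of_disjoint (by linarith) MeasurableSet.empty (by simp)
        · obtain ⟨δ, hδ, h⟩ := exists_poincareOn_of_mem_frontier hp hΩ hb hA
            (by rw [hA.isOpen.frontier_eq]; exact ⟨h1, h2⟩ : y ∈ frontier A)
          exact ⟨_, mem_nhdsWithin_of_mem_nhds (Metric.ball_mem_nhds y hδ), h⟩
      · obtain ⟨δ, hδ, h⟩ := poincareAt_of_mem_closure hp hΩ hb hA hy h1
        exact ⟨_, mem_nhdsWithin_of_mem_nhds (Metric.ball_mem_nhds y hδ),
          h.mono inter_subset_left⟩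
  exact h.mono fun x hx => ⟨subset_closure hx.1, hx.2⟩

/-- **Poincaré's inequality** on the complement of an inclusion, for functions that vanish near
the outer boundary. -/
theorem exists_eLpNorm_le_eLpNorm_gradient [Nontrivial (Rn n)] (hp : 1 ≤ p) (hΩ : IsOpen Ω)
    (hb : Bornology.IsBounded Ω) (hA : IsInclusion Ω A) :
    ∃ C : ℝ≥0∞, C ≠ ⊤ ∧ ∀ φ : Rn n → ℝ, ContDiff ℝ 1 φ → HasCompactSupport φ → tsupport φ ⊆ Ω →
      eLpNorm φ (ENNReal.ofReal p) (volume.restrict (outer Ω A)) ≤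
        C * eLpNorm (gradient φ) (ENNReal.ofReal p) (volume.restrict (outer Ω A)) := by
  obtain ⟨C, hC⟩ := poincareOn_outer hp hΩ hb hA
  have hp0 : 0 < p := by linarith
  have hne0 : ENNReal.ofReal p ≠ 0 := by simpa using hp0
  refine ⟨(C : ℝ≥0∞) ^ (1 / p),
    ENNReal.rpow_ne_top_of_nonneg (by positivity) ENNReal.coe_ne_top, fun φ h1 h2 h3 => ?_⟩
  have h := hC φ h1 h2 h3
  have hm : MeasurableSet (outer Ω A) := hΩ.measurableSet.diff isClosed_closure.measurableSet
  have heq : ∫⁻ x in (closure A)ᶜ, ‖gradient φ x‖ₑ ^ p =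
      ∫⁻ x in outer Ω A, ‖gradient φ x‖ₑ ^ p := by
    rw [← lintegral_indicator isClosed_closure.measurableSet.compl, ← lintegral_indicator hm]
    congr 1
    ext x
    by_cases hx : x ∈ Ω
    · by_cases hxA : x ∈ closure A
      · rw [indicator_of_notMem (show x ∉ (closure A)ᶜ from fun h => h hxA),
          indicator_of_notMem (show x ∉ outer Ω A from fun h => h.2 hxA)]
      · rw [indicator_of_mem (show x ∈ (closure A)ᶜ from hxA),
          indicator_of_mem (show x ∈ outer Ω A from ⟨hx, hxA⟩)]
    · have : gradient φ x = 0 := gradient_eq_zero_of_notMem_tsupport fun h => hx (h3 h)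
      simp [indicator, this, hp0]
  rw [heq] at h
  rw [eLpNorm_eq_lintegral_rpow_enorm_toReal hne0 ENNReal.ofReal_ne_top,
    eLpNorm_eq_lintegral_rpow_enorm_toReal hne0 ENNReal.ofReal_ne_top,
    ENNReal.toReal_ofReal hp0.le, ← ENNReal.mul_rpow_of_nonneg _ _ (by positivity)]
  gcongr

theorem outer_empty (Ω : Set (Rn n)) : outer Ω ∅ = Ω := by simp [outer]

/-- With `A = ∅` the results on `outer Ω A` contain the corresponding results on `Ω`. -/
theorem isInclusion_empty (hΩ : IsConnected Ω) : IsInclusion Ω ∅ where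
  isOpen := isOpen_empty
  closure_subset := by simp
  lipschitz := by intro x hx; simp at hx
  finite_components := by
    have : Subsingleton (ConnectedComponents (∅ : Set (Rn n))) := by
      refine ⟨fun a b => ?_⟩
      obtain ⟨x, rfl⟩ := ConnectedComponents.surjective_coe a
      exact x.2.elim
    infer_instance
  outer_connected := by rwa [outer_empty]

end Poincare

/-! ### Limits of gradients of test functions -/

section GradClosure

variable {n : ℕ} {Ω U A : Set (Rn n)} {m : ℝ} {G G' : Rn n → Rn n} {v : Rn n → ℝ}

/-- `φ` is a `C¹` function with compact support in `Ω`. -/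
structure IsTestFun (Ω : Set (Rn n)) (φ : Rn n → ℝ) : Prop where
  contDiff : ContDiff ℝ 1 φ
  compact : HasCompactSupport φ
  subset : tsupport φ ⊆ Ω

namespace IsTestFun

variable {φ ψ : Rn n → ℝ}

theorem add (h : IsTestFun Ω φ) (h' : IsTestFun Ω ψ) : IsTestFun Ω (φ + ψ) :=
  ⟨h.contDiff.add h'.contDiff, h.compact.add h'.compact,
    (tsupport_add φ ψ).trans (union_subset h.subset h'.subset)⟩

theorem const_smul (c : ℝ) (h : IsTestFun Ω φ) : IsTestFun Ω (c • φ) :=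
  ⟨h.contDiff.const_smul c, h.compact.smul_left (f := fun _ => c),
    (tsupport_smul_subset_right (fun _ => c) φ).trans h.subset⟩

theorem zero : IsTestFun Ω (0 : Rn n → ℝ) :=
  ⟨contDiff_const, HasCompactSupport.zero, by simp [tsupport]⟩

theorem gradient_add (h : IsTestFun Ω φ) (h' : IsTestFun Ω ψ) :
    gradient (φ + ψ) = gradient φ + gradient ψ := by
  ext1 x
  simp only [gradient, Pi.add_apply]
  rw [fderiv_add (h.contDiff.differentiable one_ne_zero x)
    (h'.contDiff.differentiable one_ne_zero x), map_add]

theorem gradient_const_smul (c : ℝ) (h : IsTestFun Ω φ) :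
    gradient (c • φ) = c • gradient φ := by
  ext1 x
  simp only [gradient, Pi.smul_apply]
  rw [fderiv_const_smul (h.contDiff.differentiable one_ne_zero x), map_smul]

theorem neg (h : IsTestFun Ω φ) : IsTestFun Ω (-φ) := by
  rw [← neg_one_smul ℝ φ]; exact h.const_smul _

theorem sub (h : IsTestFun Ω φ) (h' : IsTestFun Ω ψ) : IsTestFun Ω (φ - ψ) := by
  rw [sub_eq_add_neg]; exact h.add h'.neg

theorem gradient_sub (h : IsTestFun Ω φ) (h' : IsTestFun Ω ψ) :
    gradient (φ - ψ) = gradient φ - gradient ψ := by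
  rw [sub_eq_add_neg, h.gradient_add h'.neg, ← neg_one_smul ℝ ψ, h'.gradient_const_smul,
    neg_one_smul, sub_eq_add_neg]

theorem memLp (h : IsTestFun Ω φ) (P : ℝ≥0∞) (S : Set (Rn n)) : MemLp φ P (volume.restrict S) :=
  (h.contDiff.continuous.memLp_of_hasCompactSupport h.compact).restrict S

theorem memLp_gradient (h : IsTestFun Ω φ) (P : ℝ≥0∞) (S : Set (Rn n)) :
    MemLp (gradient φ) P (volume.restrict S) :=
  ((continuous_gradient h.contDiff).memLp_of_hasCompactSupport
    (hasCompactSupport_gradient h.compact)).restrict S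

end IsTestFun

/-- `G` is a limit in `L^m(U)` of gradients of test functions in `Ω`. -/
def IsGradLimit (Ω U : Set (Rn n)) (m : ℝ) (G : Rn n → Rn n) : Prop :=
  MemLp G (ENNReal.ofReal m) (volume.restrict U) ∧ ∀ ε : ℝ≥0∞, 0 < ε → ∃ φ, IsTestFun Ω φ ∧
    eLpNorm (fun x => G x - gradient φ x) (ENNReal.ofReal m) (volume.restrict U) < ε

theorem one_le_ofReal {m : ℝ} (hm : 1 ≤ m) : (1 : ℝ≥0∞) ≤ ENNReal.ofReal m := by
  rw [← ENNReal.ofReal_one]; exact ENNReal.ofReal_le_ofReal hm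

namespace IsGradLimit

theorem add (hm : 1 ≤ m) (h : IsGradLimit Ω U m G) (h' : IsGradLimit Ω U m G') :
    IsGradLimit Ω U m (G + G') := by
  refine ⟨h.1.add h'.1, fun ε hε => ?_⟩
  obtain ⟨φ, hφ, h1⟩ := h.2 (ε / 2) (ENNReal.half_pos hε.ne')
  obtain ⟨ψ, hψ, h2⟩ := h'.2 (ε / 2) (ENNReal.half_pos hε.ne')
  refine ⟨φ + ψ, hφ.add hψ, ?_⟩
  rw [hφ.gradient_add hψ]
  have e : (fun x => (G + G') x - (gradient φ + gradient ψ) x) =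
      (fun x => G x - gradient φ x) + fun x => G' x - gradient ψ x := by
    ext1 x; simp only [Pi.add_apply]; abel
  rw [e]
  refine (eLpNorm_add_le (h.1.sub (hφ.memLp_gradient _ U)).1
    (h'.1.sub (hψ.memLp_gradient _ U)).1 (one_le_ofReal hm)).trans_lt ?_
  calc _ < ε / 2 + ε / 2 := ENNReal.add_lt_add h1 h2
    _ = ε := ENNReal.add_halves ε

theorem const_smul (c : ℝ) (h : IsGradLimit Ω U m G) : IsGradLimit Ω U m (c • G) := by
  refine ⟨h.1.const_smul c, fun ε hε => ?_⟩
  rcases eq_or_ne c 0 with rfl | hc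
  · exact ⟨0, IsTestFun.zero, by simpa [gradient] using hε⟩
  · have hc' : ‖c‖ₑ ≠ 0 := by simpa using hc
    obtain ⟨φ, hφ, h1⟩ := h.2 (ε / ‖c‖ₑ) (ENNReal.div_pos hε.ne' enorm_ne_top)
    refine ⟨c • φ, hφ.const_smul c, ?_⟩
    rw [hφ.gradient_const_smul]
    have e : (fun x => (c • G) x - (c • gradient φ) x) = c • fun x => G x - gradient φ x := by
      ext1 x; simp only [Pi.smul_apply, smul_sub]
    rw [e, eLpNorm_const_smul, mul_comm]
    exact (ENNReal.lt_div_iff_mul_lt (Or.inl hc') (Or.inl enorm_ne_top)).1 h1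

theorem congr_ae (h : IsGradLimit Ω U m G) (hG : G =ᵐ[volume.restrict U] G') :
    IsGradLimit Ω U m G' := by
  refine ⟨(memLp_congr_ae hG).1 h.1, fun ε hε => ?_⟩
  obtain ⟨φ, hφ, h1⟩ := h.2 ε hε
  refine ⟨φ, hφ, ?_⟩
  rwa [eLpNorm_congr_ae (g := fun x => G x - gradient φ x)]
  filter_upwards [hG] with x hx
  rw [hx]

theorem of_approx (hm : 1 ≤ m) (hG : MemLp G (ENNReal.ofReal m) (volume.restrict U))
    (h : ∀ ε : ℝ≥0∞, 0 < ε → ∃ G', IsGradLimit Ω U m G' ∧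
      eLpNorm (fun x => G x - G' x) (ENNReal.ofReal m) (volume.restrict U) < ε) :
    IsGradLimit Ω U m G := by
  refine ⟨hG, fun ε hε => ?_⟩
  obtain ⟨G', hG', h1⟩ := h (ε / 2) (ENNReal.half_pos hε.ne')
  obtain ⟨φ, hφ, h2⟩ := hG'.2 (ε / 2) (ENNReal.half_pos hε.ne')
  refine ⟨φ, hφ, ?_⟩
  have e : (fun x => G x - gradient φ x) =
      (fun x => G x - G' x) + fun x => G' x - gradient φ x := by
    ext1 x; simp only [Pi.add_apply]; abel
  rw [e]
  refine (eLpNorm_add_le (hG.sub hG'.1).1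
    (hG'.1.sub (hφ.memLp_gradient _ U)).1 (one_le_ofReal hm)).trans_lt ?_
  calc _ < ε / 2 + ε / 2 := ENNReal.add_lt_add h1 h2
    _ = ε := ENNReal.add_halves ε

theorem of_vanishesOnBoundary (h : VanishesOnBoundary Ω U m v) :
    IsGradLimit Ω U m (weakGrad U v) := by
  refine ⟨h.1.2.2, fun ε hε => ?_⟩
  obtain ⟨φ, h1, h2, h3, -, h4⟩ := h.2 ε hε
  exact ⟨φ, ⟨h1, h2, h3⟩, h4⟩

end IsGradLimit

/-- A limit of gradients of test functions is a weak gradient of a limit of test functions. -/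
theorem IsGradLimit.exists_limit [Nontrivial (Rn n)] (hm : 1 ≤ m) (hΩ : IsOpen Ω)
    (hb : Bornology.IsBounded Ω) (hA : IsInclusion Ω A) (h : IsGradLimit Ω (outer Ω A) m G) :
    ∃ v : Rn n → ℝ, MemLp v (ENNReal.ofReal m) (volume.restrict (outer Ω A)) ∧
      HasWeakGrad (outer Ω A) v G ∧ ∀ ε : ℝ≥0∞, 0 < ε → ∃ φ : Rn n → ℝ, IsTestFun Ω φ ∧
        eLpNorm (fun x => v x - φ x) (ENNReal.ofReal m) (volume.restrict (outer Ω A)) < ε ∧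
        eLpNorm (fun x => G x - gradient φ x) (ENNReal.ofReal m)
          (volume.restrict (outer Ω A)) < ε := by
  set μ := (volume : Measure (Rn n)).restrict (outer Ω A) with hμ
  set P := ENNReal.ofReal m with hP
  have hP1 : 1 ≤ P := one_le_ofReal hm
  have : Fact (1 ≤ P) := ⟨hP1⟩
  obtain ⟨C, hC, hpo⟩ := exists_eLpNorm_le_eLpNorm_gradient hm hΩ hb hA
  have hε : ∀ k : ℕ, (0 : ℝ≥0∞) < ENNReal.ofReal (1 / ((k : ℝ) + 1)) :=
    fun k => ENNReal.ofReal_pos.2 (by positivity)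
  choose φ hφ hclose using fun k : ℕ => h.2 _ (hε k)
  have hlim : Filter.Tendsto (fun k : ℕ => ENNReal.ofReal (1 / ((k : ℝ) + 1))) Filter.atTop
      (nhds 0) := by
    have := ENNReal.tendsto_ofReal (tendsto_one_div_add_atTop_nhds_zero_nat (𝕜 := ℝ))
    simpa using this
  -- Poincaré's inequality for `φ k - φ l` makes the functions Cauchy once their gradients are.
  have hd : ∀ k l, eLpNorm (φ k - φ l) P μ ≤
      C * (ENNReal.ofReal (1 / ((k : ℝ) + 1)) + ENNReal.ofReal (1 / ((l : ℝ) + 1))) := by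
    intro k l
    have ht := (hφ k).sub (hφ l)
    refine (hpo _ ht.contDiff ht.compact ht.subset).trans ?_
    gcongr
    rw [(hφ k).gradient_sub (hφ l)]
    have e : gradient (φ k) - gradient (φ l) =
        (fun x => G x - gradient (φ l) x) - fun x => G x - gradient (φ k) x := by
      ext1 x; simp only [Pi.sub_apply]; abel
    rw [e, add_comm]
    exact (eLpNorm_sub_le (h.1.sub ((hφ l).memLp_gradient _ _)).1
      (h.1.sub ((hφ k).memLp_gradient _ _)).1 hP1).trans
      (add_le_add (hclose l).le (hclose k).le)
  have hcau : CauchySeq fun k => ((hφ k).memLp P (outer Ω A)).toLp (φ k) := by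
    rw [EMetric.cauchySeq_iff]
    intro ε hε
    have : Filter.Tendsto (fun k : ℕ => C * (ENNReal.ofReal (1 / ((k : ℝ) + 1)) +
        ENNReal.ofReal (1 / ((k : ℝ) + 1)))) Filter.atTop (nhds 0) := by
      have := ENNReal.Tendsto.const_mul (hlim.add hlim) (Or.inr hC) (a := C)
      simpa using this
    obtain ⟨N, hN⟩ := (this.eventually (gt_mem_nhds hε)).exists
    refine ⟨N, fun k hk l hl => ?_⟩
    rw [Lp.edist_toLp_toLp]
    refine (hd k l).trans_lt (lt_of_le_of_lt ?_ hN)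
    gcongr
  obtain ⟨v, hv⟩ := cauchySeq_tendsto_of_complete hcau
  have hvm : MemLp v P μ := Lp.memLp v
  have happ : ∀ ε : ℝ≥0∞, 0 < ε → ∃ φ : Rn n → ℝ, IsTestFun Ω φ ∧
        eLpNorm (fun x => v x - φ x) P μ < ε ∧
        eLpNorm (fun x => G x - gradient φ x) P μ < ε := by
    intro ε hε
    have h1 : ∀ᶠ k in Filter.atTop, edist (((hφ k).memLp P (outer Ω A)).toLp (φ k)) v < ε := by
      rw [EMetric.tendsto_nhds] at hv
      exact hv ε hε
    obtain ⟨k, hk1, hk2⟩ := (h1.and (hlim.eventually (gt_mem_nhds hε))).exists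
    refine ⟨φ k, hφ k, ?_, (hclose k).trans hk2⟩
    rw [edist_comm, Lp.edist_def] at hk1
    refine lt_of_le_of_lt (le_of_eq (eLpNorm_congr_ae ?_)) hk1
    filter_upwards [((hφ k).memLp P (outer Ω A)).coeFn_toLp] with x hx
    simp only [Pi.sub_apply, hx]
  refine ⟨v, hvm, HasWeakGrad.of_approx hP1 hvm h.1 fun ε hε => ?_, happ⟩
  obtain ⟨φ, hφ, h1, h2⟩ := happ ε hε
  exact ⟨φ, gradient φ, HasWeakGrad.of_contDiff hφ.contDiff, (hφ.memLp P _).1,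
    (hφ.memLp_gradient P _).1, h1, h2⟩

theorem IsInclusion.isOpen_outer (hΩ : IsOpen Ω) : IsOpen (outer Ω A) :=
  hΩ.sdiff isClosed_closure

/-- Provides the passage from minimizing fields back to potentials. -/
theorem IsGradLimit.exists_vanishesOnBoundary [Nontrivial (Rn n)] (hm : 1 ≤ m) (hΩ : IsOpen Ω)
    (hb : Bornology.IsBounded Ω) (hA : IsInclusion Ω A) (h : IsGradLimit Ω (outer Ω A) m G) :
    ∃ v : Rn n → ℝ, VanishesOnBoundary Ω (outer Ω A) m v ∧ HasWeakGrad (outer Ω A) v G := by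
  obtain ⟨v, hv, hw, happ⟩ := h.exists_limit hm hΩ hb hA
  have hae := HasWeakGrad.weakGrad_ae_eq (IsInclusion.isOpen_outer hΩ) hw
  refine ⟨v, ⟨⟨⟨G, hw⟩, hv, (memLp_congr_ae hae).2 h.1⟩, fun ε hε => ?_⟩, hw⟩
  obtain ⟨φ, hφ, h1, h2⟩ := happ ε hε
  refine ⟨φ, hφ.contDiff, hφ.compact, hφ.subset, h1, ?_⟩
  rwa [eLpNorm_congr_ae (g := fun x => G x - gradient φ x)]
  filter_upwards [hae] with x hx
  rw [hx]

end GradClosure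

/-! ### Mollification -/

open scoped Pointwise

section Mollify

variable {n : ℕ} {F : Type*} [NormedAddCommGroup F] [NormedSpace ℝ F]

/-- A smooth compactly supported probability density. -/
structure IsMollifier (ρ : Rn n → ℝ) : Prop where
  contDiff : ContDiff ℝ ∞ ρ
  compact : HasCompactSupport ρ
  nonneg : ∀ x, 0 ≤ ρ x
  integral : ∫ x, ρ x = 1

/-- The convolution `ρ * g`. -/
noncomputable def mollify (ρ : Rn n → ℝ) (g : Rn n → F) : Rn n → F :=
  convolution ρ g (ContinuousLinearMap.lsmul ℝ ℝ) volume

theorem mollify_apply (ρ : Rn n → ℝ) (g : Rn n → F) (x : Rn n) :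
    mollify ρ g x = ∫ t, ρ t • g (x - t) := rfl

theorem mollify_apply_swap (ρ : Rn n → ℝ) (g : Rn n → F) (x : Rn n) :
    mollify ρ g x = ∫ t, ρ (x - t) • g t :=
  convolution_lsmul_swap

theorem exists_isMollifier (c : Rn n) {δ : ℝ} (hδ : 0 < δ) :
    ∃ ρ : Rn n → ℝ, IsMollifier ρ ∧ Function.support ρ = Metric.ball c δ ∧
      tsupport ρ = Metric.closedBall c δ := by
  let f : ContDiffBump c := ⟨δ / 2, δ, by positivity, by linarith⟩
  exact ⟨f.normed volume, ⟨f.contDiff_normed, f.hasCompactSupport_normed, f.nonneg_normed,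
    f.integral_normed⟩, f.support_normed_eq, f.tsupport_normed_eq⟩

variable {ρ : Rn n → ℝ}

theorem IsMollifier.integrable (h : IsMollifier ρ) : Integrable ρ :=
  h.contDiff.continuous.integrable_of_hasCompactSupport h.compact

theorem mollify_congr_ae {g g' : Rn n → F} (h : g =ᵐ[volume] g') :
    mollify ρ g = mollify ρ g' :=
  convolution_congr _ (Filter.EventuallyEq.refl _ _) h

theorem IsMollifier.isProbabilityMeasure (h : IsMollifier ρ) :
    IsProbabilityMeasure (volume.withDensity fun x => ENNReal.ofReal (ρ x)) := by
  refine ⟨?_⟩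
  rw [withDensity_apply _ MeasurableSet.univ, setLIntegral_univ,
    ← ofReal_integral_eq_lintegral_ofReal h.integrable (ae_of_all _ h.nonneg), h.integral]
  simp

/-- Young's inequality. -/
theorem IsMollifier.eLpNorm_mollify_le (h : IsMollifier ρ) {p : ℝ} (hp : 1 ≤ p) {g : Rn n → F}
    (hg : AEStronglyMeasurable g) :
    eLpNorm (mollify ρ g) (ENNReal.ofReal p) volume ≤ eLpNorm g (ENNReal.ofReal p) volume := by
  wlog hs : StronglyMeasurable g generalizing g
  · have := this hg.stronglyMeasurable_mk.aestronglyMeasurable hg.stronglyMeasurable_mk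
    rw [mollify_congr_ae hg.ae_eq_mk, eLpNorm_congr_ae hg.ae_eq_mk]
    exact this
  have hp0 : 0 < p := by linarith
  have hne0 : ENNReal.ofReal p ≠ 0 := by simpa using hp0
  rw [eLpNorm_eq_lintegral_rpow_enorm_toReal hne0 ENNReal.ofReal_ne_top,
    eLpNorm_eq_lintegral_rpow_enorm_toReal hne0 ENNReal.ofReal_ne_top,
    ENNReal.toReal_ofReal hp0.le]
  refine ENNReal.rpow_le_rpow ?_ (by positivity)
  -- Mollification averages against the probability measure `ν`, so Jensen's inequality applies
  -- pointwise, and translation invariance after Tonelli.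
  set ν : Measure (Rn n) := volume.withDensity fun x => ENNReal.ofReal (ρ x) with hν
  have : IsProbabilityMeasure ν := h.isProbabilityMeasure
  have hρm : Measurable fun x => ENNReal.ofReal (ρ x) :=
    h.contDiff.continuous.measurable.ennreal_ofReal
  have hgm : Measurable fun x => ‖g x‖ₑ := hs.enorm
  have hm2 : Measurable fun z : Rn n × Rn n => ‖g (z.1 - z.2)‖ₑ ^ p :=
    (hgm.comp (measurable_fst.sub measurable_snd)).pow_const p
  have h1 : ∀ x, ‖mollify ρ g x‖ₑ ^ p ≤ ∫⁻ t, ‖g (x - t)‖ₑ ^ p ∂ν := by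
    intro x
    have hm1 : Measurable fun t => ‖g (x - t)‖ₑ := hgm.comp (measurable_const.sub measurable_id)
    refine le_trans ?_ (lintegral_rpow_le_of_isProbabilityMeasure hp hm1.aemeasurable)
    gcongr
    rw [mollify_apply]
    refine (enorm_integral_le_lintegral_enorm _).trans (le_of_eq ?_)
    rw [hν, lintegral_withDensity_eq_lintegral_mul _ hρm hm1]
    refine lintegral_congr fun t => ?_
    rw [enorm_smul, Pi.mul_apply, Real.enorm_of_nonneg (h.nonneg t)]
  calc ∫⁻ x, ‖mollify ρ g x‖ₑ ^ p ≤ ∫⁻ x, ∫⁻ t, ‖g (x - t)‖ₑ ^ p ∂ν := lintegral_mono h1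
    _ = ∫⁻ t, (∫⁻ x, ‖g (x - t)‖ₑ ^ p) ∂ν := lintegral_lintegral_swap hm2.aemeasurable
    _ = ∫⁻ _, (∫⁻ x, ‖g x‖ₑ ^ p) ∂ν := by
        refine lintegral_congr fun t => ?_
        exact lintegral_sub_right_eq_self (fun x => ‖g x‖ₑ ^ p) t
    _ = ∫⁻ x, ‖g x‖ₑ ^ p := by simp

theorem mollify_sub (hρ : IsMollifier ρ) {g g' : Rn n → F} (hg : LocallyIntegrable g)
    (hg' : LocallyIntegrable g') : mollify ρ (g - g') = mollify ρ g - mollify ρ g' := by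
  have key : ∀ f : Rn n → F, LocallyIntegrable f → ∀ x, Integrable fun t => ρ t • f (x - t) :=
    fun f hf x => hρ.compact.convolutionExists_left (ContinuousLinearMap.lsmul ℝ ℝ)
      hρ.contDiff.continuous hf x
  ext1 x
  simp only [mollify_apply, Pi.sub_apply, smul_sub]
  exact integral_sub (key g hg x) (key g' hg' x)

variable [FiniteDimensional ℝ F]

theorem IsMollifier.aestronglyMeasurable_mollify (hρ : IsMollifier ρ) {g : Rn n → F}
    (hg : LocallyIntegrable g) : AEStronglyMeasurable (mollify ρ g) := by
  have : CompleteSpace F := FiniteDimensional.complete ℝ F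
  have : Continuous (mollify ρ g) :=
    hρ.compact.continuous_convolution_left _ hρ.contDiff.continuous hg
  exact this.aestronglyMeasurable

/-- Mollifications with kernels supported near the origin converge in `L^p`. -/
theorem exists_eLpNorm_mollify_sub_lt {p : ℝ} (hp : 1 ≤ p) {g : Rn n → F}
    (hg : MemLp g (ENNReal.ofReal p)) {ε : ℝ≥0∞} (hε : 0 < ε) :
    ∃ η : ℝ, 0 < η ∧ ∀ ρ : Rn n → ℝ, IsMollifier ρ → Function.support ρ ⊆ Metric.ball 0 η →
      eLpNorm (fun x => g x - mollify ρ g x) (ENNReal.ofReal p) volume < ε := by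
  have hP := one_le_ofReal hp
  have hε4 : ε / 4 ≠ 0 := (ENNReal.div_pos hε.ne' (by simp)).ne'
  wlog hεt : ε ≠ ⊤ generalizing ε
  · obtain ⟨η, hη, h⟩ := this (ε := 1) one_pos (by simp) (by simp)
    refine ⟨η, hη, fun ρ h1 h2 => (h ρ h1 h2).trans_le ?_⟩
    rw [not_not.1 hεt]; exact le_top
  -- The threshold `η` comes from the modulus of continuity of a compactly supported approximation
  -- `h`. It therefore suits every kernel supported in the ball, including kernels not centred at
  -- the origin.
  obtain ⟨h, hh1, hh2, hh3, hh4⟩ := hg.exists_hasCompactSupport_eLpNorm_sub_le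
    ENNReal.ofReal_ne_top hε4
  set K : Set (Rn n) := Metric.cthickening 1 (tsupport h) with hK
  have hKc : IsCompact K := hh1.isCompact.cthickening
  have hKt : volume K ^ (1 / (ENNReal.ofReal p).toReal) ≠ ⊤ :=
    ENNReal.rpow_ne_top_of_nonneg (by positivity) hKc.measure_lt_top.ne
  obtain ⟨c, hc, hcK⟩ : ∃ c : ℝ, 0 < c ∧
      ENNReal.ofReal c * volume K ^ (1 / (ENNReal.ofReal p).toReal) ≤ ε / 4 := by
    set V := volume K ^ (1 / (ENNReal.ofReal p).toReal)
    have hd : ε / 4 / (V + 1) ≠ ⊤ :=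
      (ENNReal.div_lt_top (ENNReal.div_lt_top hεt (by simp)).ne (by simp)).ne
    refine ⟨(ε / 4 / (V + 1)).toReal, ENNReal.toReal_pos
      (ENNReal.div_pos hε4 (ENNReal.add_ne_top.2 ⟨hKt, by simp⟩)).ne' hd, ?_⟩
    rw [ENNReal.ofReal_toReal hd]
    calc ε / 4 / (V + 1) * V ≤ ε / 4 / (V + 1) * (V + 1) := by gcongr; exact le_self_add
      _ ≤ ε / 4 :=
        (ENNReal.div_mul_cancel (by simp) (ENNReal.add_ne_top.2 ⟨hKt, by simp⟩)).le
  have huc : UniformContinuous h := hh1.uniformContinuous_of_continuous hh3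
  obtain ⟨η, hη, huη⟩ := Metric.uniformContinuous_iff.1 huc c hc
  refine ⟨min η 1, by positivity, fun ρ hρ hsupp => ?_⟩
  have hsη : Function.support ρ ⊆ Metric.ball 0 η :=
    hsupp.trans (Metric.ball_subset_ball (min_le_left _ _))
  have lg : LocallyIntegrable g := hg.locallyIntegrable hP
  have lh : LocallyIntegrable h := hh3.locallyIntegrable
  have d1 : ∀ x, dist (h x) (mollify ρ h x) ≤ c := by
    intro x
    rw [dist_comm]
    refine dist_convolution_le hc.le hsη hρ.nonneg hρ.integral hh3.aestronglyMeasurable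
      fun y hy => (huη hy).le
  have s2 : Function.support (mollify ρ h) ⊆ K := by
    refine (support_convolution_subset_swap _).trans ?_
    rintro _ ⟨y, hy, z, hz, rfl⟩
    refine Metric.mem_cthickening_of_dist_le _ y 1 _ (subset_tsupport _ hy) ?_
    have hz' := hsupp hz
    rw [mem_ball_zero_iff] at hz'
    simp only [dist_self_add_left]
    exact hz'.le.trans (min_le_right _ _)
  have b2 : eLpNorm (h - mollify ρ h) (ENNReal.ofReal p) volume ≤ ε / 4 :=
    (eLpNorm_sub_le_of_dist_bdd volume ENNReal.ofReal_ne_top hKc.measurableSet hc.le d1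
      ((subset_tsupport h).trans (Metric.self_subset_cthickening _)) s2).trans hcK
  have b3 : eLpNorm (mollify ρ (g - h)) (ENNReal.ofReal p) volume ≤ ε / 4 :=
    (hρ.eLpNorm_mollify_le hp (hg.1.sub hh4.1)).trans hh2
  have e : (fun x => g x - mollify ρ g x) = (g - h) + (h - mollify ρ h) - mollify ρ (g - h) := by
    rw [mollify_sub hρ lg lh]
    ext1 x; simp only [Pi.add_apply, Pi.sub_apply]; abel
  have m1 : AEStronglyMeasurable (h - mollify ρ h) :=
    hh4.1.sub (hρ.aestronglyMeasurable_mollify lh)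
  rw [e]
  calc _ ≤ eLpNorm (g - h + (h - mollify ρ h)) (ENNReal.ofReal p) volume +
        eLpNorm (mollify ρ (g - h)) (ENNReal.ofReal p) volume :=
        eLpNorm_sub_le ((hg.1.sub hh4.1).add m1)
          (hρ.aestronglyMeasurable_mollify (lg.sub lh)) hP
    _ ≤ ε / 4 + ε / 4 + ε / 4 := by
        gcongr
        exact (eLpNorm_add_le (hg.1.sub hh4.1) m1 hP).trans (add_le_add hh2 b2)
    _ < ε := by
        have h4 : ε / 4 + ε / 4 + ε / 4 + ε / 4 = ε := by
          have : ε / 4 + ε / 4 + ε / 4 + ε / 4 = 4 * (ε / 4) := by ring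
          rw [this]; exact ENNReal.mul_div_cancel (by simp) (by simp)
        have ht : ε / 4 + ε / 4 + ε / 4 ≠ ⊤ := by
          have : ε / 4 ≠ ⊤ := (ENNReal.div_lt_top hεt (by simp)).ne
          simp [this]
        nth_rewrite 4 [← h4]
        exact ENNReal.lt_add_right ht hε4

end Mollify

/-! ### Mollification of Sobolev functions -/

section MollifyGrad

variable {n : ℕ} {ρ : Rn n → ℝ} {v : Rn n → ℝ} {G : Rn n → Rn n}

theorem IsMollifier.contDiff_mollify (hρ : IsMollifier ρ) (hv : LocallyIntegrable v) :
    ContDiff ℝ 1 (mollify ρ v) :=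
  hρ.compact.contDiff_convolution_left (n := 1) _
    (hρ.contDiff.of_le (by exact_mod_cast le_top)) hv

/-- The gradient of a mollification is the mollification of the weak gradient. -/
theorem IsMollifier.gradient_mollify (hρ : IsMollifier ρ) (h : HasWeakGrad univ v G) :
    gradient (mollify ρ v) = mollify ρ G := by
  have lv : LocallyIntegrable v := locallyIntegrableOn_univ.1 h.1
  have lG : LocallyIntegrable G := locallyIntegrableOn_univ.1 h.2.1
  have hρ1 : ContDiff ℝ 1 ρ := hρ.contDiff.of_le (by exact_mod_cast le_top)
  ext1 x
  refine ext_inner_right ℝ fun w => ?_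
  rw [inner_gradient_left]
  have hd : HasFDerivAt (mollify ρ v) _ x :=
    hρ.compact.hasFDerivAt_convolution_left (ContinuousLinearMap.lsmul ℝ ℝ) hρ1 lv x
  rw [hd.fderiv, convolution_eq_swap]
  have hcs : HasCompactSupport (fderiv ℝ ρ) := hρ.compact.fderiv ℝ
  have hex := hcs.convolutionExists_left ((ContinuousLinearMap.lsmul ℝ ℝ).precompL (Rn n))
    (hρ1.continuous_fderiv one_ne_zero) lv x
  have hex' : Integrable fun t => ((ContinuousLinearMap.lsmul ℝ ℝ).precompL (Rn n))
      (fderiv ℝ ρ (x - t)) (v t) := hex.integrable_swap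
  rw [ContinuousLinearMap.integral_apply hex']
  have hφ : ContDiff ℝ ∞ fun t => ρ (x - t) := hρ.contDiff.comp (contDiff_const.sub contDiff_id)
  have hφc : HasCompactSupport fun t => ρ (x - t) :=
    hρ.compact.comp_homeomorph (Homeomorph.subLeft x)
  have hi : Integrable fun t => ρ (x - t) • G t :=
    integrable_smul_of_tsupport_subset (h.2.1) hφ.continuous hφc (subset_univ _)
  rw [mollify_apply_swap, real_inner_comm, ← integral_inner hi]
  -- The weak gradient identity tested with the reflected kernel `t ↦ ρ (x - t)`.
  have hz := h.integral_add_eq_zero hφ hφc (subset_univ _) w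
  rw [integral_add (HasWeakGrad.integrable_fderiv_mul h.1 hφ hφc (subset_univ _) w)
    (HasWeakGrad.integrable_mul_inner h.2.1 hφ hφc (subset_univ _) w)] at hz
  have e1 : ∀ t, fderiv ℝ (fun t => ρ (x - t)) t w = -fderiv ℝ ρ (x - t) w := by
    intro t
    have h1 : HasFDerivAt (fun t => x - t) (-ContinuousLinearMap.id ℝ (Rn n)) t := by
      simpa using (hasFDerivAt_id t).const_sub x
    have h2 := ((hρ1.differentiable one_ne_zero (x - t)).hasFDerivAt).comp t h1
    have h3 : HasFDerivAt (fun t => ρ (x - t)) _ t := h2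
    rw [h3.fderiv]
    simp
  have e2 : ∫ t, ((ContinuousLinearMap.lsmul ℝ ℝ).precompL (Rn n)) (fderiv ℝ ρ (x - t)) (v t) w =
      -∫ t, fderiv ℝ (fun t => ρ (x - t)) t w * v t := by
    rw [← integral_neg]
    refine integral_congr_ae (ae_of_all _ fun t => ?_)
    simp only [e1, ContinuousLinearMap.precompL_apply, ContinuousLinearMap.lsmul_apply, smul_eq_mul]
    ring
  have e3 : ∫ t, inner ℝ w (ρ (x - t) • G t) = ∫ t, ρ (x - t) * inner ℝ (G t) w := by
    refine integral_congr_ae (ae_of_all _ fun t => ?_)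
    simp only [inner_smul_right, real_inner_comm w]
  rw [e2, e3]
  linarith

theorem IsMollifier.isTestFun_mollify (hρ : IsMollifier ρ) (hv : LocallyIntegrable v)
    {K Ω : Set (Rn n)} (hK : IsCompact K) (hvK : Function.support v ⊆ K)
    (hsum : K + tsupport ρ ⊆ Ω) : IsTestFun Ω (mollify ρ v) := by
  have hc : IsCompact (K + tsupport ρ) := hK.add hρ.compact
  have hsub : tsupport (mollify ρ v) ⊆ K + tsupport ρ :=
    closure_minimal ((support_convolution_subset_swap _).trans
      (add_subset_add hvK (subset_tsupport ρ))) hc.isClosed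
  exact ⟨hρ.contDiff_mollify hv, hc.of_isClosed_subset (isClosed_tsupport _) hsub,
    hsub.trans hsum⟩

end MollifyGrad

/-! ### Functions vanishing outside a Lipschitz domain -/

section ZeroBoundary

variable {n : ℕ} {Ω : Set (Rn n)} {m p q : ℝ} {v : Rn n → ℝ} {G : Rn n → Rn n}

theorem memLp_smul_cutoff {F : Type*} [NormedAddCommGroup F] [NormedSpace ℝ F] {S : Set (Rn n)}
    (hS : MeasurableSet S) {P : ℝ≥0∞} {f : Rn n → F} (hf : MemLp f P (volume.restrict S))
    {χ : Rn n → ℝ} (hχ : Continuous χ) (hc : HasCompactSupport χ) (hs : tsupport χ ⊆ S) :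
    MemLp (fun x => χ x • f x) P := by
  have h1 : MemLp (χ • f) P (volume.restrict S) :=
    hf.smul (hχ.memLp_top_of_hasCompactSupport hc _)
  rw [← memLp_indicator_iff_restrict hS] at h1
  have e : (fun x => χ x • f x) = S.indicator (χ • f) := by
    ext1 x
    by_cases hx : x ∈ S
    · rw [indicator_of_mem hx]; rfl
    · rw [indicator_of_notMem hx, image_eq_zero_of_notMem_tsupport fun h => hx (hs h), zero_smul]
  rw [e]
  exact h1

theorem memLp_smul_gradient_cutoff {S : Set (Rn n)}
    (hS : MeasurableSet S) {P : ℝ≥0∞} {f : Rn n → ℝ} (hf : MemLp f P (volume.restrict S))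
    {χ : Rn n → ℝ} (hχ : ContDiff ℝ 1 χ) (hc : HasCompactSupport χ) (hs : tsupport χ ⊆ S) :
    MemLp (fun x => f x • gradient χ x) P := by
  have h1 : MemLp (f • gradient χ) P (volume.restrict S) :=
    MemLp.smul (p := P) (q := ⊤) ((continuous_gradient hχ).memLp_top_of_hasCompactSupport
      (hasCompactSupport_gradient hc) _) hf
  rw [← memLp_indicator_iff_restrict hS] at h1
  have e : (fun x => f x • gradient χ x) = S.indicator (f • gradient χ) := by
    ext1 x
    by_cases hx : x ∈ S
    · rw [indicator_of_mem hx]; rfl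
    · rw [indicator_of_notMem hx, gradient_eq_zero_of_notMem_tsupport fun h => hx (hs h),
        smul_zero]
  rw [e]
  exact h1

theorem memLp_gradient_mul_cutoff {S : Set (Rn n)}
    (hS : MeasurableSet S) {P : ℝ≥0∞} {f : Rn n → ℝ} {g : Rn n → Rn n}
    (hf : MemLp f P (volume.restrict S)) (hg : MemLp g P (volume.restrict S))
    {χ : Rn n → ℝ} (hχ : ContDiff ℝ ∞ χ) (hc : HasCompactSupport χ) (hs : tsupport χ ⊆ S) :
    MemLp (fun x => χ x • g x + f x • gradient χ x) P :=
  (memLp_smul_cutoff hS hg hχ.continuous hc hs).add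
    (memLp_smul_gradient_cutoff hS hf (hχ.of_le (by exact_mod_cast le_top)) hc hs)

/-- The kernels need not be centred: an off-centre kernel also displaces the support of `v`, which
is how it is pushed off the boundary of `Ω`. -/
theorem isGradLimit_of_mollifiers (hp : 1 ≤ p) (h : HasWeakGrad univ v G)
    (hG : MemLp G (ENNReal.ofReal p)) {K : Set (Rn n)} (hK : IsCompact K)
    (hvK : Function.support v ⊆ K)
    (hmol : ∀ η : ℝ, 0 < η → ∃ ρ : Rn n → ℝ, IsMollifier ρ ∧
      Function.support ρ ⊆ Metric.ball 0 η ∧ K + tsupport ρ ⊆ Ω) :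
    IsGradLimit Ω univ p G := by
  refine ⟨by rwa [Measure.restrict_univ], fun ε hε => ?_⟩
  obtain ⟨η, hη, hη'⟩ := exists_eLpNorm_mollify_sub_lt hp hG hε
  obtain ⟨ρ, hρ, h1, h2⟩ := hmol η hη
  refine ⟨mollify ρ v, hρ.isTestFun_mollify (locallyIntegrableOn_univ.1 h.1) hK hvK h2, ?_⟩
  rw [hρ.gradient_mollify h, Measure.restrict_univ]
  exact hη' ρ hρ h1

theorem exists_isMollifier_add_subset (hΩ : IsOpen Ω) {K : Set (Rn n)} (hK : IsCompact K)
    (hKΩ : K ⊆ Ω) {η : ℝ} (hη : 0 < η) : ∃ ρ : Rn n → ℝ, IsMollifier ρ ∧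
      Function.support ρ ⊆ Metric.ball 0 η ∧ K + tsupport ρ ⊆ Ω := by
  obtain ⟨δ, hδ, hδ'⟩ := hK.exists_cthickening_subset_open hΩ hKΩ
  obtain ⟨ρ, hρ, h1, h2⟩ := exists_isMollifier (0 : Rn n) (lt_min hδ hη)
  refine ⟨ρ, hρ, h1.subset.trans (Metric.ball_subset_ball (min_le_right _ _)), ?_⟩
  rintro _ ⟨y, hy, z, hz, rfl⟩
  refine hδ' (Metric.mem_cthickening_of_dist_le _ y δ _ hy ?_)
  rw [h2, mem_closedBall_zero_iff] at hz
  simp only [dist_self_add_left]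
  exact hz.trans (min_le_left _ _)

theorem isGradLimit_of_support_subset_compact (hp : 1 ≤ p) (hΩ : IsOpen Ω)
    (h : HasWeakGrad univ v G) (hG : MemLp G (ENNReal.ofReal p)) {K : Set (Rn n)}
    (hK : IsCompact K) (hKΩ : K ⊆ Ω) (hvK : Function.support v ⊆ K) :
    IsGradLimit Ω univ p G :=
  isGradLimit_of_mollifiers hp h hG hK hvK fun _ hη => exists_isMollifier_add_subset hΩ hK hKΩ hη

/-- Mollifying with a kernel centred at `t • e` shifts the support by about `t` into the epigraph.
Its radius `δ` must be small compared with `t` and the Lipschitz constant. -/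
theorem isGradLimit_of_chart (hp : 1 ≤ p) {x e : Rn n} (he : ‖e‖ = 1) {r : ℝ} (hr : 0 < r)
    {L : ℝ≥0} {γ : Rn n → ℝ} (hγ : LipschitzWith L γ)
    (hch : ∀ y ∈ Metric.ball x r, (y ∈ Ω ↔ γ (y - inner ℝ y e • e) < inner ℝ y e))
    (h : HasWeakGrad univ v G) (hG : MemLp G (ENNReal.ofReal p))
    (hv : Function.support v ⊆ Ω) (hvb : Function.support v ⊆ Metric.closedBall x (r / 2)) :
    IsGradLimit Ω univ p G := by
  have hK : IsCompact (closure Ω ∩ Metric.closedBall x (r / 2)) :=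
    (isCompact_closedBall x (r / 2)).inter_left isClosed_closure
  refine isGradLimit_of_mollifiers hp h hG hK
    (fun y hy => ⟨subset_closure (hv hy), hvb hy⟩) fun η hη => ?_
  set t : ℝ := min (η / 2) (r / 8) with ht
  have ht0 : 0 < t := by positivity
  have htη : t ≤ η / 2 := min_le_left _ _
  have htr : t ≤ r / 8 := min_le_right _ _
  -- A point moved by `t • e + s` with `‖s‖ ≤ δ` gains height at least `t - δ`, while the graph
  -- rises by at most `2 * L * δ = t - 2 * δ`.
  set δ : ℝ := t / (2 * L + 2) with hδ
  have hL : (0 : ℝ) ≤ L := L.2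
  have hδ0 : 0 < δ := by positivity
  have hδt : (2 * L + 2) * δ = t := by rw [hδ]; field_simp
  have hLδ : 0 ≤ L * δ := by positivity
  obtain ⟨ρ, hρ, h1, h2⟩ := exists_isMollifier (t • e) hδ0
  refine ⟨ρ, hρ, fun z hz => ?_, ?_⟩
  · rw [h1, Metric.mem_ball, dist_eq_norm] at hz
    rw [mem_ball_zero_iff]
    have h3 := norm_add_le (z - t • e) (t • e)
    rw [sub_add_cancel, norm_smul, he, mul_one, Real.norm_of_nonneg ht0.le] at h3
    linarith
  · rintro _ ⟨y, hy, z, hz, rfl⟩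
    rw [h2, Metric.mem_closedBall, dist_eq_norm] at hz
    set s := z - t • e with hs
    have hzs : y + z = (y + s) + t • e := by rw [hs]; abel
    have hyr : y ∈ Metric.ball x r :=
      Metric.closedBall_subset_ball (by linarith) hy.2
    have hyz : y + z ∈ Metric.ball x r := by
      have h3 := norm_add_le s (t • e)
      rw [norm_smul, he, mul_one, Real.norm_of_nonneg ht0.le] at h3
      have h4 : dist y x ≤ r / 2 := hy.2
      have h5 : dist (y + z) y = ‖s + t • e‖ := by
        rw [dist_eq_norm, hs]; congr 1; abel
      have := dist_triangle (y + z) y x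
      rw [Metric.mem_ball]
      linarith
    refine (hch _ hyz).2 ?_
    rw [hzs, proj_add_smul_unit he, inner_add_smul_unit he]
    have hy1 : γ (y - inner ℝ y e • e) ≤ inner ℝ y e := by
      by_contra hlt
      exact notMem_closure_of_lt_chart hγ.continuous hch hyr (not_le.1 hlt) hy.1
    have hse : |inner ℝ s e| ≤ δ := by
      refine (abs_real_inner_le_norm s e).trans ?_
      rw [he, mul_one]; exact hz
    have h6 : dist (y + s - inner ℝ (y + s) e • e) (y - inner ℝ y e • e) ≤ 2 * δ := by
      have e1 : y + s - inner ℝ (y + s) e • e - (y - inner ℝ y e • e) = s - inner ℝ s e • e := by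
        rw [inner_add_left]; module
      rw [dist_eq_norm, e1]
      refine (norm_sub_le _ _).trans ?_
      rw [norm_smul, he, mul_one, Real.norm_eq_abs]
      linarith
    have h7 := hγ.dist_le_mul (y + s - inner ℝ (y + s) e • e) (y - inner ℝ y e • e)
    rw [Real.dist_eq] at h7
    have h8 := (abs_le.1 h7).2
    have h9 : (L : ℝ) * dist (y + s - inner ℝ (y + s) e • e) (y - inner ℝ y e • e) ≤
        L * (2 * δ) := by gcongr
    have h10 : inner ℝ (y + s) e = inner ℝ y e + inner ℝ s e := inner_add_left _ _ _
    have h11 := (abs_le.1 hse).1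
    linarith

/-- A Sobolev function on `ℝⁿ` that vanishes outside a Lipschitz domain has a gradient that is a
limit of gradients of test functions. -/
theorem isGradLimit_of_support_subset (hp : 1 ≤ p) (hΩ : IsLipschitzDomain Ω)
    (h : HasWeakGrad univ v G) (hv : MemLp v (ENNReal.ofReal p)) (hG : MemLp G (ENNReal.ofReal p))
    (hs : Function.support v ⊆ Ω) : IsGradLimit Ω univ p G := by
  have hfc : IsCompact (frontier Ω) :=
    hΩ.isBounded.isCompact_closure.of_isClosed_subset isClosed_frontier frontier_subset_closure
  choose! e he r hr L γ hγ hch using hΩ.lipschitz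
  -- Induction on the number of charts replaces a partition of unity: `O` is an open set where `v`
  -- already vanishes, and `O` with the remaining balls covers the boundary. When no ball is left,
  -- `closure Ω \ O` is a compact subset of `Ω`.
  have key : ∀ T : Finset (Rn n), (∀ x ∈ T, x ∈ frontier Ω) → ∀ (v : Rn n → ℝ) (G : Rn n → Rn n),
      HasWeakGrad univ v G → MemLp v (ENNReal.ofReal p) → MemLp G (ENNReal.ofReal p) →
      Function.support v ⊆ Ω → ∀ O : Set (Rn n), IsOpen O → (∀ x ∈ O, v x = 0) →
      frontier Ω ⊆ O ∪ ⋃ x ∈ T, Metric.ball x (r x / 4) → IsGradLimit Ω univ p G := by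
    intro T
    induction T using Finset.induction_on with
    | empty =>
      intro _ v G h hv hG hs O hO hvO hcov
      refine isGradLimit_of_support_subset_compact hp hΩ.isOpen h hG (K := closure Ω \ O)
        (hΩ.isBounded.isCompact_closure.diff hO) (fun x hx => ?_)
        fun x hx => ⟨subset_closure (hs hx), fun hxO => hx (hvO x hxO)⟩
      by_contra hxΩ
      have : x ∈ frontier Ω := by
        rw [hΩ.isOpen.frontier_eq]; exact ⟨hx.1, hxΩ⟩
      have := hcov this
      simp only [Finset.notMem_empty, iUnion_of_empty, iUnion_empty, union_empty] at this
      exact hx.2 this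
    | insert a T ha ih =>
      intro hT v G h hv hG hs O hO hvO hcov
      have haf : a ∈ frontier Ω := hT a (Finset.mem_insert_self a T)
      have hra := hr a haf
      let ψ : ContDiffBump a := ⟨r a / 4, r a / 2, by positivity, by linarith⟩
      have hψs : tsupport ψ = Metric.closedBall a (r a / 2) := ψ.tsupport_eq
      have hψ : ContDiff ℝ ∞ ψ := ψ.contDiff
      have w1 := h.mul_cutoff hψ ψ.hasCompactSupport (subset_univ _)
      have hv' : MemLp v (ENNReal.ofReal p) (volume.restrict univ) := by
        rwa [Measure.restrict_univ]
      have hG' : MemLp G (ENNReal.ofReal p) (volume.restrict univ) := by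
        rwa [Measure.restrict_univ]
      have m1 : MemLp (fun x => ψ x * v x) (ENNReal.ofReal p) :=
        memLp_smul_cutoff MeasurableSet.univ hv' hψ.continuous ψ.hasCompactSupport (subset_univ _)
      have m2 := memLp_gradient_mul_cutoff MeasurableSet.univ hv' hG' hψ ψ.hasCompactSupport
        (subset_univ _)
      have c1 := isGradLimit_of_chart hp (he a haf) hra (hγ a haf) (hch a haf) w1 m2
        (fun x hx => hs fun h0 => hx (by simp [h0]))
        (fun x hx => by
          rw [← hψs]
          exact subset_tsupport _ fun h0 => hx (by simp [h0]))
      -- Subtracting `ψ * v` makes the function vanish on the smaller ball of this chart, which is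
      -- added to `O`.
      have c2 := ih (fun x hx => hT x (Finset.mem_insert_of_mem hx)) _ _ (h.sub w1) (hv.sub m1)
        (hG.sub m2) (fun x hx => hs fun h0 => hx (by simp [h0])) (O ∪ Metric.ball a (r a / 4))
        (hO.union Metric.isOpen_ball) (fun x hx => by
          rcases hx with hx | hx
          · simp [hvO x hx]
          · have : ψ x = 1 := ψ.one_of_mem_closedBall (Metric.ball_subset_closedBall hx)
            simp [this])
        (by
          rw [union_assoc]
          simpa only [Finset.mem_insert, iUnion_iUnion_eq_or_left] using hcov)
      have := c2.add hp c1
      simpa using this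
  obtain ⟨T, hT, hcov⟩ := hfc.elim_nhds_subcover (fun x => Metric.ball x (r x / 4))
    fun x hx => Metric.ball_mem_nhds x (by have := hr x hx; positivity)
  exact key T hT v G h hv hG hs ∅ isOpen_empty (by simp) (by simpa using hcov)

theorem IsGradLimit.mono_set {S T : Set (Rn n)} (hST : S ⊆ T) (h : IsGradLimit Ω T p G) :
    IsGradLimit Ω S p G := by
  refine ⟨h.1.mono_measure (Measure.restrict_mono hST le_rfl), fun ε hε => ?_⟩
  obtain ⟨φ, hφ, h1⟩ := h.2 ε hε
  exact ⟨φ, hφ, (eLpNorm_mono_measure _ (Measure.restrict_mono hST le_rfl)).trans_lt h1⟩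

/-- Improvement of the exponent for functions with zero boundary values. -/
theorem IsGradLimit.of_memLp [Nontrivial (Rn n)] (hq : 1 ≤ q) (hp : 1 ≤ p)
    (hΩ : IsLipschitzDomain Ω) (h : IsGradLimit Ω Ω q G)
    (hG : MemLp G (ENNReal.ofReal p) (volume.restrict Ω)) : IsGradLimit Ω Ω p G := by
  have hΩm := hΩ.isOpen.measurableSet
  have hP := one_le_ofReal hp
  have hQ := one_le_ofReal hq
  obtain ⟨v, hv, -, happ⟩ := IsGradLimit.exists_limit (A := ∅) hq hΩ.isOpen hΩ.isBounded
    (isInclusion_empty hΩ.isConnected) (by rwa [outer_empty])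
  rw [outer_empty] at hv happ
  set v₀ := Ω.indicator v with hv₀
  set G₀ := Ω.indicator G with hG₀
  have hv₀q : MemLp v₀ (ENNReal.ofReal q) := (memLp_indicator_iff_restrict hΩm).2 hv
  have hG₀q : MemLp G₀ (ENNReal.ofReal q) := (memLp_indicator_iff_restrict hΩm).2 h.1
  have hG₀p : MemLp G₀ (ENNReal.ofReal p) := (memLp_indicator_iff_restrict hΩm).2 hG
  -- Extension by zero creates no jump across `∂Ω`, since `v₀` is a limit of test functions that
  -- vanish outside `Ω` themselves.
  have hw : HasWeakGrad univ v₀ G₀ := by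
    refine HasWeakGrad.of_approx hQ (by rwa [Measure.restrict_univ])
      (by rwa [Measure.restrict_univ]) fun ε hε => ?_
    obtain ⟨φ, hφ, h1, h2⟩ := happ ε hε
    refine ⟨φ, gradient φ, HasWeakGrad.of_contDiff hφ.contDiff, (hφ.memLp 1 _).1,
      (hφ.memLp_gradient 1 _).1, ?_, ?_⟩
    · rw [Measure.restrict_univ]
      rw [← eLpNorm_indicator_eq_eLpNorm_restrict hΩm] at h1
      have e : (fun x => v₀ x - φ x) = Ω.indicator fun x => v x - φ x := by
        ext1 x
        by_cases hx : x ∈ Ω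
        · simp [hv₀, hx]
        · simp [hv₀, hx, image_eq_zero_of_notMem_tsupport fun h => hx (hφ.subset h)]
      rw [e]
      exact h1
    · rw [Measure.restrict_univ]
      rw [← eLpNorm_indicator_eq_eLpNorm_restrict hΩm] at h2
      have e : (fun x => G₀ x - gradient φ x) = Ω.indicator fun x => G x - gradient φ x := by
        ext1 x
        by_cases hx : x ∈ Ω
        · simp [hG₀, hx]
        · simp [hG₀, hx, gradient_eq_zero_of_notMem_tsupport fun h => hx (hφ.subset h)]
      rw [e]
      exact h2
  have hsupp : Function.support v₀ ⊆ Ω := support_indicator_subset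
  -- Only the gradient is known to be in `L^p`. Mollifications of `v₀` are test functions in the
  -- larger ball `D`; Poincaré's inequality there and Young's inequality bound their `L^p` norms by
  -- that of `G₀`, and lower semicontinuity passes to `v₀`.
  have hv₀p : MemLp v₀ (ENNReal.ofReal p) := by
    obtain ⟨R, hR⟩ := hΩ.isBounded.subset_ball (0 : Rn n)
    have hRpos : 0 < R := by
      obtain ⟨x, hx⟩ := hΩ.isConnected.nonempty
      exact Metric.pos_of_mem_ball (hR hx)
    set D := Metric.ball (0 : Rn n) (R + 2) with hD
    have hDc : IsConnected D :=
      ⟨⟨0, Metric.mem_ball_self (by linarith)⟩, (convex_ball _ _).isPreconnected⟩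
    obtain ⟨C, hC, hpo⟩ := exists_eLpNorm_le_eLpNorm_gradient (A := ∅) hp
      (Metric.isOpen_ball : IsOpen D) Metric.isBounded_ball (isInclusion_empty hDc)
    rw [outer_empty] at hpo
    have hex : ∀ k : ℕ, ∃ ρ : Rn n → ℝ, IsMollifier ρ ∧ IsTestFun D (mollify ρ v₀) ∧
        eLpNorm (fun x => v₀ x - mollify ρ v₀ x) (ENNReal.ofReal q) volume <
          ENNReal.ofReal (1 / ((k : ℝ) + 1)) := by
      intro k
      obtain ⟨η, hη, hη'⟩ := exists_eLpNorm_mollify_sub_lt hq hv₀q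
        (ENNReal.ofReal_pos.2 (by positivity : 0 < 1 / ((k : ℝ) + 1)))
      obtain ⟨ρ, hρ, h1, h2⟩ := exists_isMollifier (0 : Rn n) (lt_min hη one_pos)
      refine ⟨ρ, hρ, hρ.isTestFun_mollify (hv₀q.locallyIntegrable hQ)
        hΩ.isBounded.isCompact_closure (hsupp.trans subset_closure) ?_,
        hη' ρ hρ (h1.subset.trans (Metric.ball_subset_ball (min_le_left _ _)))⟩
      rintro _ ⟨y, hy, z, hz, rfl⟩
      rw [h2, mem_closedBall_zero_iff] at hz
      have hy' : y ∈ Metric.closedBall (0 : Rn n) R :=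
        closure_minimal (hR.trans Metric.ball_subset_closedBall) Metric.isClosed_closedBall hy
      rw [mem_closedBall_zero_iff] at hy'
      rw [hD, mem_ball_zero_iff]
      have := norm_add_le y z
      have := min_le_right η 1
      simp only
      linarith
    choose ρ hρ htest hclose using hex
    have hlim : Filter.Tendsto (fun k => eLpNorm (mollify (ρ k) v₀ - v₀) (ENNReal.ofReal q) volume)
        Filter.atTop (nhds 0) := by
      have h1 := ENNReal.tendsto_ofReal (tendsto_one_div_add_atTop_nhds_zero_nat (𝕜 := ℝ))
      rw [ENNReal.ofReal_zero] at h1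
      refine tendsto_of_tendsto_of_tendsto_of_le_of_le tendsto_const_nhds h1
        (fun _ => zero_le) fun k => ?_
      rw [eLpNorm_sub_comm]
      exact (hclose k).le
    have hmeas := tendstoInMeasure_of_tendsto_eLpNorm
      (by have := zero_lt_one.trans_le hQ; exact this.ne')
      (fun k => ((htest k).contDiff.continuous.aestronglyMeasurable)) hv₀q.1 hlim
    obtain ⟨ns, -, hns⟩ := hmeas.exists_seq_tendsto_ae
    have hbd : ∀ k, eLpNorm (mollify (ρ k) v₀) (ENNReal.ofReal p) (volume.restrict D) ≤
        C * eLpNorm G₀ (ENNReal.ofReal p) volume := by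
      intro k
      refine (hpo _ (htest k).contDiff (htest k).compact (htest k).subset).trans ?_
      gcongr
      rw [(hρ k).gradient_mollify hw]
      exact (eLpNorm_mono_measure _ Measure.restrict_le_self).trans
        ((hρ k).eLpNorm_mollify_le hp hG₀p.1)
    have hfin : eLpNorm v₀ (ENNReal.ofReal p) (volume.restrict D) ≤
        C * eLpNorm G₀ (ENNReal.ofReal p) volume := by
      refine (Lp.eLpNorm_lim_le_liminf_eLpNorm (f := fun k => mollify (ρ (ns k)) v₀)
        (fun k => (htest (ns k)).contDiff.continuous.aestronglyMeasurable) v₀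
        (ae_restrict_of_ae hns)).trans ?_
      exact Filter.liminf_le_of_frequently_le' (Filter.Frequently.of_forall fun k => hbd (ns k))
    have hmD : MemLp v₀ (ENNReal.ofReal p) (volume.restrict D) :=
      ⟨hv₀q.1.restrict, hfin.trans_lt (ENNReal.mul_ne_top hC hG₀p.eLpNorm_ne_top).lt_top⟩
    rw [← memLp_indicator_iff_restrict Metric.isOpen_ball.measurableSet] at hmD
    rwa [indicator_eq_self.2 (hsupp.trans (hR.trans (Metric.ball_subset_ball (by linarith))))]
      at hmD
  refine ((isGradLimit_of_support_subset hp hΩ hw hv₀p hG₀p hsupp).mono_set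
    (subset_univ Ω)).congr_ae ?_
  filter_upwards [ae_restrict_mem hΩm] with x hx
  simp [hG₀, hx]

end ZeroBoundary

/-! ### Sobolev functions with prescribed boundary values -/

section Sobolev

variable {n : ℕ} {Ω U V A : Set (Rn n)} {m p : ℝ} {u v f : Rn n → ℝ} {g : Rn n → Rn n}

theorem MemW.hasWeakGrad (h : MemW U p u) : HasWeakGrad U u (weakGrad U u) :=
  HasWeakGrad.weakGrad_spec h.1

theorem MemW.of_hasWeakGrad (hU : IsOpen U) (h : HasWeakGrad U u g)
    (hu : MemLp u (ENNReal.ofReal p) (volume.restrict U))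
    (hg : MemLp g (ENNReal.ofReal p) (volume.restrict U)) : MemW U p u :=
  ⟨⟨g, h⟩, hu, (memLp_congr_ae (h.weakGrad_ae_eq hU)).2 hg⟩

theorem MemW.add (hU : IsOpen U) (hu : MemW U p u) (hv : MemW U p v) : MemW U p (u + v) :=
  .of_hasWeakGrad hU (hu.hasWeakGrad.add hv.hasWeakGrad) (hu.2.1.add hv.2.1) (hu.2.2.add hv.2.2)

theorem MemW.const_smul (hU : IsOpen U) (c : ℝ) (hu : MemW U p u) : MemW U p (c • u) :=
  .of_hasWeakGrad hU (hu.hasWeakGrad.const_smul c) (hu.2.1.const_smul c) (hu.2.2.const_smul c)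

theorem MemLp.mono_restrict {F : Type*} [NormedAddCommGroup F] {G : Rn n → F}
    (hU : volume U ≠ ⊤) (hVU : V ⊆ U) (hmp : m ≤ p)
    (hG : MemLp G (ENNReal.ofReal p) (volume.restrict U)) :
    MemLp G (ENNReal.ofReal m) (volume.restrict V) := by
  have : IsFiniteMeasure ((volume : Measure (Rn n)).restrict U) :=
    isFiniteMeasure_restrict.2 hU
  exact (hG.mono_exponent (ENNReal.ofReal_le_ofReal hmp)).mono_measure
    (Measure.restrict_mono hVU le_rfl)

theorem MemW.mono (hV : IsOpen V) (hU : volume U ≠ ⊤) (hVU : V ⊆ U) (hmp : m ≤ p)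
    (hu : MemW U p u) : MemW V m u :=
  .of_hasWeakGrad hV (hu.hasWeakGrad.mono hVU) (MemLp.mono_restrict hU hVU hmp hu.2.1)
    (MemLp.mono_restrict hU hVU hmp hu.2.2)

namespace VanishesOnBoundary

theorem of_approx (hU : IsOpen U) (h : HasWeakGrad U v g)
    (hv : MemLp v (ENNReal.ofReal m) (volume.restrict U))
    (hg : MemLp g (ENNReal.ofReal m) (volume.restrict U))
    (happ : ∀ ε : ℝ≥0∞, 0 < ε → ∃ φ : Rn n → ℝ, IsTestFun Ω φ ∧
      eLpNorm (fun x => v x - φ x) (ENNReal.ofReal m) (volume.restrict U) < ε ∧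
      eLpNorm (fun x => g x - gradient φ x) (ENNReal.ofReal m) (volume.restrict U) < ε) :
    VanishesOnBoundary Ω U m v := by
  refine ⟨.of_hasWeakGrad hU h hv hg, fun ε hε => ?_⟩
  obtain ⟨φ, hφ, h1, h2⟩ := happ ε hε
  refine ⟨φ, hφ.contDiff, hφ.compact, hφ.subset, h1, ?_⟩
  rwa [eLpNorm_congr_ae (g := fun x => g x - gradient φ x)]
  filter_upwards [h.weakGrad_ae_eq hU] with x hx
  rw [hx]

theorem add (hm : 1 ≤ m) (hU : IsOpen U) (hu : VanishesOnBoundary Ω U m u)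
    (hv : VanishesOnBoundary Ω U m v) : VanishesOnBoundary Ω U m (u + v) := by
  refine of_approx hU (hu.1.hasWeakGrad.add hv.1.hasWeakGrad) (hu.1.2.1.add hv.1.2.1)
    (hu.1.2.2.add hv.1.2.2) fun ε hε => ?_
  obtain ⟨φ, a1, a2, a3, a4, a5⟩ := hu.2 (ε / 2) (ENNReal.half_pos hε.ne')
  obtain ⟨ψ, b1, b2, b3, b4, b5⟩ := hv.2 (ε / 2) (ENNReal.half_pos hε.ne')
  have hφ : IsTestFun Ω φ := ⟨a1, a2, a3⟩
  have hψ : IsTestFun Ω ψ := ⟨b1, b2, b3⟩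
  have hP := one_le_ofReal hm
  refine ⟨φ + ψ, hφ.add hψ, ?_, ?_⟩
  · have e : (fun x => (u + v) x - (φ + ψ) x) = (fun x => u x - φ x) + fun x => v x - ψ x := by
      ext1 x; simp only [Pi.add_apply]; ring
    rw [e]
    refine (eLpNorm_add_le (hu.1.2.1.sub (hφ.memLp _ U)).1
      (hv.1.2.1.sub (hψ.memLp _ U)).1 hP).trans_lt ?_
    calc _ < ε / 2 + ε / 2 := ENNReal.add_lt_add a4 b4
      _ = ε := ENNReal.add_halves ε
  · rw [hφ.gradient_add hψ]
    have e : (fun x => (weakGrad U u + weakGrad U v) x - (gradient φ + gradient ψ) x) =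
        (fun x => weakGrad U u x - gradient φ x) + fun x => weakGrad U v x - gradient ψ x := by
      ext1 x; simp only [Pi.add_apply]; abel
    rw [e]
    refine (eLpNorm_add_le (hu.1.2.2.sub (hφ.memLp_gradient _ U)).1
      (hv.1.2.2.sub (hψ.memLp_gradient _ U)).1 hP).trans_lt ?_
    calc _ < ε / 2 + ε / 2 := ENNReal.add_lt_add a5 b5
      _ = ε := ENNReal.add_halves ε

theorem const_smul (hU : IsOpen U) (c : ℝ) (hu : VanishesOnBoundary Ω U m u) :
    VanishesOnBoundary Ω U m (c • u) := by
  refine of_approx hU (hu.1.hasWeakGrad.const_smul c) (hu.1.2.1.const_smul c)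
    (hu.1.2.2.const_smul c) fun ε hε => ?_
  rcases eq_or_ne c 0 with rfl | hc
  · exact ⟨0, IsTestFun.zero, by simpa using hε, by simpa [gradient] using hε⟩
  · have hc' : ‖c‖ₑ ≠ 0 := by simpa using hc
    obtain ⟨φ, a1, a2, a3, a4, a5⟩ := hu.2 (ε / ‖c‖ₑ) (ENNReal.div_pos hε.ne' enorm_ne_top)
    have hφ : IsTestFun Ω φ := ⟨a1, a2, a3⟩
    refine ⟨c • φ, hφ.const_smul c, ?_, ?_⟩
    · have e : (fun x => (c • u) x - (c • φ) x) = c • fun x => u x - φ x := by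
        ext1 x; simp only [Pi.smul_apply, smul_sub]
      rw [e, eLpNorm_const_smul, mul_comm]
      exact (ENNReal.lt_div_iff_mul_lt (Or.inl hc') (Or.inl enorm_ne_top)).1 a4
    · rw [hφ.gradient_const_smul]
      have e : (fun x => (c • weakGrad U u) x - (c • gradient φ) x) =
          c • fun x => weakGrad U u x - gradient φ x := by
        ext1 x; simp only [Pi.smul_apply, smul_sub]
      rw [e, eLpNorm_const_smul, mul_comm]
      exact (ENNReal.lt_div_iff_mul_lt (Or.inl hc') (Or.inl enorm_ne_top)).1 a5

theorem mono_set (hV : IsOpen V) (hVU : V ⊆ U) (hU : volume U ≠ ⊤)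
    (hv : VanishesOnBoundary Ω U m v) : VanishesOnBoundary Ω V m v := by
  have hle : (volume : Measure (Rn n)).restrict V ≤ volume.restrict U :=
    Measure.restrict_mono hVU le_rfl
  refine of_approx hV (hv.1.hasWeakGrad.mono hVU) (MemLp.mono_restrict hU hVU le_rfl hv.1.2.1)
    (MemLp.mono_restrict hU hVU le_rfl hv.1.2.2) fun ε hε => ?_
  obtain ⟨φ, a1, a2, a3, a4, a5⟩ := hv.2 ε hε
  exact ⟨φ, ⟨a1, a2, a3⟩, (eLpNorm_mono_measure _ hle).trans_lt a4,
    (eLpNorm_mono_measure _ hle).trans_lt a5⟩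

end VanishesOnBoundary

/-- `L^m` convergence follows from `L^p` convergence on sets of finite measure. -/
theorem exists_forall_eLpNorm_lt {F : Type*} [NormedAddCommGroup F] (hU : volume U ≠ ⊤)
    (hm : 1 ≤ m) (hmp : m ≤ p) {ε : ℝ≥0∞} (hε : 0 < ε) : ∃ δ : ℝ≥0∞, 0 < δ ∧ ∀ G : Rn n → F,
      AEStronglyMeasurable G (volume.restrict U) →
      eLpNorm G (ENNReal.ofReal p) (volume.restrict U) < δ →
      eLpNorm G (ENNReal.ofReal m) (volume.restrict U) < ε := by
  have : IsFiniteMeasure ((volume : Measure (Rn n)).restrict U) := isFiniteMeasure_restrict.2 hU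
  set C := volume.restrict U univ ^
    (1 / (ENNReal.ofReal m).toReal - 1 / (ENNReal.ofReal p).toReal) with hC
  have hCt : C ≠ ⊤ := by
    refine ENNReal.rpow_ne_top_of_nonneg ?_ (measure_ne_top _ _)
    rw [ENNReal.toReal_ofReal (by linarith), ENNReal.toReal_ofReal (by linarith), sub_nonneg]
    exact one_div_le_one_div_of_le (by linarith) hmp
  have hC1 : C + 1 ≠ ⊤ := ENNReal.add_ne_top.2 ⟨hCt, ENNReal.one_ne_top⟩
  refine ⟨ε / (C + 1), ENNReal.div_pos hε.ne' hC1, fun G hG h => ?_⟩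
  calc eLpNorm G (ENNReal.ofReal m) (volume.restrict U)
      ≤ eLpNorm G (ENNReal.ofReal p) (volume.restrict U) * C :=
        eLpNorm_le_eLpNorm_mul_rpow_measure_univ (ENNReal.ofReal_le_ofReal hmp) hG
    _ ≤ eLpNorm G (ENNReal.ofReal p) (volume.restrict U) * (C + 1) := by
        gcongr; exact le_self_add
    _ < ε := (ENNReal.lt_div_iff_mul_lt (Or.inl (by simp)) (Or.inl hC1)).1 h

theorem VanishesOnBoundary.mono_exponent (hU : IsOpen U) (hUf : volume U ≠ ⊤) (hm : 1 ≤ m)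
    (hmp : m ≤ p) (hv : VanishesOnBoundary Ω U p v) : VanishesOnBoundary Ω U m v := by
  refine of_approx hU hv.1.hasWeakGrad (MemLp.mono_restrict hUf subset_rfl hmp hv.1.2.1)
    (MemLp.mono_restrict hUf subset_rfl hmp hv.1.2.2) fun ε hε => ?_
  obtain ⟨δ, hδ, h1⟩ := exists_forall_eLpNorm_lt (F := ℝ) hUf hm hmp hε
  obtain ⟨δ', hδ', h2⟩ := exists_forall_eLpNorm_lt (F := Rn n) hUf hm hmp hε
  obtain ⟨φ, a1, a2, a3, a4, a5⟩ := hv.2 (min δ δ') (lt_min hδ hδ')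
  have hφ : IsTestFun Ω φ := ⟨a1, a2, a3⟩
  exact ⟨φ, hφ, h1 _ (hv.1.2.1.sub (hφ.memLp _ U)).1 (a4.trans_le (min_le_left _ _)),
    h2 _ (hv.1.2.2.sub (hφ.memLp_gradient _ U)).1 (a5.trans_le (min_le_right _ _))⟩

theorem exists_cutoff {K : Set (Rn n)} (hΩ : IsOpen Ω) (hK : IsCompact K) (hKΩ : K ⊆ Ω) :
    ∃ χ : Rn n → ℝ, ContDiff ℝ ∞ χ ∧ HasCompactSupport χ ∧ tsupport χ ⊆ Ω ∧
      ∀ x ∈ K, χ x = 1 := by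
  obtain ⟨L, hL, hKL, hLΩ⟩ := exists_compact_between hK hΩ hKΩ
  obtain ⟨χ, h1, h2, -⟩ := exists_contMDiffMap_one_nhds_of_subset_interior
    (modelWithCornersSelf ℝ (Rn n)) (n := ⊤) hK.isClosed hKL
  have hs : tsupport χ ⊆ L := closure_minimal
    (fun x hx => by_contra fun h => hx (h2 x h)) hL.isClosed
  refine ⟨χ, χ.contMDiff.contDiff, hL.of_isClosed_subset (isClosed_tsupport _) hs, hs.trans hLΩ,
    fun x hx => h1.self_of_nhdsSet x hx⟩

/-- A function compactly supported in `Ω` with a weak gradient vanishes on the boundary. -/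
theorem vanishesOnBoundary_of_support_subset_compact (hp : 1 ≤ p) (hΩ : IsOpen Ω)
    (h : HasWeakGrad univ v g) (hv : MemLp v (ENNReal.ofReal p)) (hg : MemLp g (ENNReal.ofReal p))
    {K : Set (Rn n)} (hK : IsCompact K) (hKΩ : K ⊆ Ω) (hvK : Function.support v ⊆ K) :
    VanishesOnBoundary Ω Ω p v := by
  refine .of_approx hΩ (h.mono (subset_univ _)) (hv.restrict _) (hg.restrict _) fun ε hε => ?_
  obtain ⟨η, hη, h1⟩ := exists_eLpNorm_mollify_sub_lt hp hv hε
  obtain ⟨η', hη', h2⟩ := exists_eLpNorm_mollify_sub_lt hp hg hε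
  obtain ⟨ρ, hρ, h3, h4⟩ := exists_isMollifier_add_subset hΩ hK hKΩ (lt_min hη hη')
  refine ⟨mollify ρ v, hρ.isTestFun_mollify (locallyIntegrableOn_univ.1 h.1) hK hvK h4, ?_, ?_⟩
  · exact (eLpNorm_mono_measure _ Measure.restrict_le_self).trans_lt
      (h1 ρ hρ (h3.trans (Metric.ball_subset_ball (min_le_left _ _))))
  · rw [hρ.gradient_mollify h]
    exact (eLpNorm_mono_measure _ Measure.restrict_le_self).trans_lt
      (h2 ρ hρ (h3.trans (Metric.ball_subset_ball (min_le_right _ _))))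

/-- Every boundary datum has an extension that vanishes in the inclusion. -/
theorem exists_extension_eq_zero (hp : 1 ≤ p) (hΩ : IsOpen Ω) (hb : Bornology.IsBounded Ω)
    (hA : closure A ⊆ Ω) (hf : MemW Ω p f) :
    ∃ w : Rn n → ℝ, MemW Ω p w ∧ VanishesOnBoundary Ω Ω p (w - f) ∧ ∀ x ∈ A, w x = 0 := by
  have hK : IsCompact (closure A) := Metric.isCompact_of_isClosed_isBounded isClosed_closure
    (hb.subset hA)
  obtain ⟨χ, h1, h2, h3, h4⟩ := exists_cutoff hΩ hK hA
  have hΩm := hΩ.measurableSet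
  have hv := vanishesOnBoundary_of_support_subset_compact hp hΩ
    (hf.hasWeakGrad.mul_cutoff h1 h2 h3) (memLp_smul_cutoff hΩm hf.2.1 h1.continuous h2 h3)
    (memLp_gradient_mul_cutoff hΩm hf.2.1 hf.2.2 h1 h2 h3) h2 h3
    (fun x hx => subset_tsupport χ fun h0 => hx (by simp [h0]))
  have hv' := hv.const_smul hΩ (-1)
  -- The extension is `f - χ f`, with a cutoff `χ` equal to `1` on `closure A`.
  refine ⟨f + (-1 : ℝ) • fun x => χ x * f x, hf.add hΩ hv'.1, ?_, fun x hx => ?_⟩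
  · rwa [add_sub_cancel_left]
  · simp [h4 x (subset_closure hx)]

theorem weakGrad_ae_eq_zero_of_eq_zero (hA : IsOpen A) (hAΩ : A ⊆ Ω)
    (hu : MemW Ω p u) (h : ∀ x ∈ A, u x = 0) : ∀ᵐ x ∂(volume.restrict A), weakGrad Ω u x = 0 := by
  have h1 : HasWeakGrad A 0 (weakGrad Ω u) := (hu.hasWeakGrad.mono hAΩ).congr_left <| by
    filter_upwards [ae_restrict_mem hA.measurableSet] with x hx
    exact h x hx
  have h2 : HasWeakGrad A 0 (gradient (0 : Rn n → ℝ)) := .of_contDiff contDiff_const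
  filter_upwards [h1.ae_eq hA h2] with x hx
  rw [hx]
  simp [gradient]

end Sobolev

/-! ### Modular convergence and convergence in mean -/

section Modular

variable {X H : Type*} [MeasurableSpace X] [NormedAddCommGroup H]
  {μ : Measure X} [IsFiniteMeasure μ] {r : X → ℝ} {m b : ℝ} {G : X → H}

theorem MemModular.memLp (hm : 1 ≤ m) (hr : ∀ x, m ≤ r x) (hG : MemModular μ r G) :
    MemLp G (ENNReal.ofReal m) μ := by
  have hm0 : 0 < m := by linarith
  rw [← integrable_norm_rpow_iff hG.1 (by simpa using hm0) ENNReal.ofReal_ne_top,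
    ENNReal.toReal_ofReal hm0.le]
  refine ((integrable_const (1 : ℝ)).add hG.2).mono'
    (hG.1.norm.aemeasurable.pow_const m).aestronglyMeasurable (ae_of_all _ fun x => ?_)
  rw [Real.norm_of_nonneg (by positivity)]
  simpa using rpow_le_add_rpow (norm_nonneg (G x)) one_pos hm0.le (hr x)

/-- Modular convergence implies convergence in `L^m` for every lower bound `m` of the exponent. -/
theorem exists_forall_eLpNorm_lt_of_modular (hm : 1 ≤ m) (hr : ∀ x, m ≤ r x ∧ r x ≤ b)
    {ε : ℝ≥0∞} (hε : 0 < ε) : ∃ η : ℝ, 0 < η ∧ ∀ G : X → H, MemModular μ r G →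
      ∫ x, ‖G x‖ ^ r x ∂μ ≤ η → eLpNorm G (ENNReal.ofReal m) μ < ε := by
  wlog hεt : ε ≠ ⊤ generalizing ε
  · obtain ⟨η, hη, h⟩ := this (ε := 1) one_pos (by simp)
    refine ⟨η, hη, fun G h1 h2 => (h G h1 h2).trans_le ?_⟩
    rw [not_not.1 hεt]; exact le_top
  have hm0 : 0 < m := by linarith
  have he : 0 < ε.toReal := ENNReal.toReal_pos hε.ne' hεt
  set e := ε.toReal ^ m with he'
  have hepos : 0 < e := by positivity
  set M := μ.real univ with hM
  have hM0 : 0 ≤ M := measureReal_nonneg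
  -- With this `δ` and the modular bound `e / 4 * δ ^ (b - m)`, the two terms of the interpolation
  -- integrate to at most `e / 2` and `e / 4`, strictly less than `e` in total.
  set δ := min 1 (e / (2 * (M + 1))) with hδ
  have hδ0 : 0 < δ := lt_min one_pos (by positivity)
  have hδ1 : δ ≤ 1 := min_le_left _ _
  have hδM : δ * M ≤ e / 2 := by
    have h1 : δ * (M + 1) ≤ e / 2 := by
      calc δ * (M + 1) ≤ e / (2 * (M + 1)) * (M + 1) := by gcongr; exact min_le_right _ _
        _ = e / 2 := by field_simp
    nlinarith
  refine ⟨e / 4 * δ ^ (b - m), by positivity, fun G hG hGη => ?_⟩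
  have hpt : ∀ x, ‖G x‖ ^ m ≤ δ + δ ^ (m - b) * ‖G x‖ ^ r x := fun x => by
    refine (rpow_le_add_rpow (norm_nonneg (G x)) hδ0 hm0.le (hr x).1).trans ?_
    gcongr ?_ + ?_ * _
    · calc δ ^ m ≤ δ ^ (1 : ℝ) := Real.rpow_le_rpow_of_exponent_ge hδ0 hδ1 hm
        _ = δ := Real.rpow_one δ
    · exact Real.rpow_le_rpow_of_exponent_ge hδ0 hδ1 (by linarith [(hr x).2])
  have hbound : ∫ x, ‖G x‖ ^ m ∂μ ≤ 3 / 4 * e := by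
    calc ∫ x, ‖G x‖ ^ m ∂μ ≤ ∫ x, (δ + δ ^ (m - b) * ‖G x‖ ^ r x) ∂μ := by
          refine integral_mono_of_nonneg (ae_of_all _ fun x => by positivity)
            ((integrable_const _).add (hG.2.const_mul _)) (ae_of_all _ hpt)
      _ = M * δ + δ ^ (m - b) * ∫ x, ‖G x‖ ^ r x ∂μ := by
          rw [integral_add (integrable_const _) (hG.2.const_mul _), integral_const,
            integral_const_mul, smul_eq_mul]
      _ ≤ M * δ + δ ^ (m - b) * (e / 4 * δ ^ (b - m)) := by gcongr
      _ = M * δ + e / 4 := by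
          have : δ ^ (m - b) * δ ^ (b - m) = 1 := by
            rw [← Real.rpow_add hδ0]; simp
          linear_combination (e / 4) * this
      _ ≤ 3 / 4 * e := by linarith
  have hL := hG.memLp hm fun x => (hr x).1
  rw [hL.eLpNorm_eq_integral_rpow_norm (by simpa using hm0) ENNReal.ofReal_ne_top,
    ENNReal.toReal_ofReal hm0.le, ← ENNReal.ofReal_toReal hεt]
  refine (ENNReal.ofReal_lt_ofReal_iff he).2 ?_
  rw [Real.rpow_inv_lt_iff_of_pos (integral_nonneg fun x => by positivity) he.le hm0]
  linarith

end Modular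

theorem energy_congr_ae {X H : Type*} [MeasurableSpace X] {μ : Measure X} {Q : X → H → ℝ}
    {G G' : X → H} (h : G =ᵐ[μ] G') : energy μ Q G = energy μ Q G' :=
  lintegral_congr_ae (h.mono fun x hx => by simp only [hx])

/-! ### The variational problem for gradients -/

section Frame

variable {n : ℕ} {Ω U D Z : Set (Rn n)} {m a : ℝ} {r : Rn n → ℝ} {u w f : Rn n → ℝ}
  {G : Rn n → Rn n}

/-- Potentials on `U`, with zero gradient on `Z` and energy integrated over `D` with
exponent `r`. -/
structure IsFrame (Ω U D Z : Set (Rn n)) (m : ℝ) (r : Rn n → ℝ) : Prop where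
  isOpen : IsOpen U
  volume_ne_top : volume U ≠ ⊤
  measurable_energy : MeasurableSet D
  measurable_zero : MeasurableSet Z
  energy_subset : D ⊆ U
  zero_subset : Z ⊆ U
  disjoint : Disjoint D Z
  cover : ∀ᵐ x ∂(volume.restrict U), x ∈ D ∨ x ∈ Z
  one_le : 1 ≤ m
  exponent_bounds : ∃ b, ∀ x, m ≤ r x ∧ r x ≤ b
  -- This is where Poincaré's inequality enters; it allows minimization over fields in place of
  -- functions.
  exists_primitive : ∀ H, IsGradLimit Ω U m H →
    ∃ v : Rn n → ℝ, VanishesOnBoundary Ω U m v ∧ HasWeakGrad U v H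

/-- Functions on `U` with the boundary values of `f` on `∂Ω` whose gradient vanishes on `Z`. -/
def IsCompetitor (Ω U Z : Set (Rn n)) (m : ℝ) (f u : Rn n → ℝ) : Prop :=
  MemW U m u ∧ VanishesOnBoundary Ω U m (u - f) ∧ ∀ᵐ x ∂(volume.restrict Z), weakGrad U u x = 0

/-- The restrictions to `D` of the gradients on `U` that vanish on `Z`, of functions vanishing
on `∂Ω`. -/
def gradSpace (Ω U D Z : Set (Rn n)) {m : ℝ} (hm : 1 ≤ m) : Submodule ℝ (Rn n → Rn n) where
  carrier := {G | ∃ H, IsGradLimit Ω U m H ∧ (∀ᵐ x ∂(volume.restrict Z), H x = 0) ∧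
    G =ᵐ[volume.restrict D] H}
  add_mem' := by
    rintro G G' ⟨H, h1, h2, h3⟩ ⟨H', h1', h2', h3'⟩
    refine ⟨H + H', h1.add hm h1', ?_, h3.add h3'⟩
    filter_upwards [h2, h2'] with x hx hx'
    simp [hx, hx']
  zero_mem' := ⟨0, ⟨MemLp.zero, fun ε hε => ⟨0, IsTestFun.zero, by simpa [gradient] using hε⟩⟩,
    ae_of_all _ fun _ => rfl, Filter.EventuallyEq.rfl⟩
  smul_mem' := by
    rintro c G ⟨H, h1, h2, h3⟩
    refine ⟨c • H, h1.const_smul c, ?_, h3.const_smul c⟩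
    filter_upwards [h2] with x hx
    simp [hx]

namespace IsFrame

theorem isFiniteMeasure (hF : IsFrame Ω U D Z m r) :
    IsFiniteMeasure ((volume : Measure (Rn n)).restrict D) :=
  isFiniteMeasure_restrict.2
    ((measure_mono hF.energy_subset).trans_lt hF.volume_ne_top.lt_top).ne

theorem restrict_restrict (hF : IsFrame Ω U D Z m r) :
    (volume.restrict U).restrict D = (volume : Measure (Rn n)).restrict D :=
  Measure.restrict_restrict_of_subset hF.energy_subset

theorem ae_eq_indicator (hF : IsFrame Ω U D Z m r) (h : ∀ᵐ x ∂(volume.restrict Z), G x = 0) :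
    G =ᵐ[volume.restrict U] D.indicator G := by
  have h1 : ∀ᵐ x ∂(volume.restrict U), x ∈ Z → G x = 0 :=
    ae_restrict_of_ae ((ae_restrict_iff' hF.measurable_zero).1 h)
  filter_upwards [hF.cover, h1] with x hx h1
  by_cases hD : x ∈ D
  · rw [indicator_of_mem hD]
  · rw [indicator_of_notMem hD, h1 (hx.resolve_left hD)]

theorem eLpNorm_eq (hF : IsFrame Ω U D Z m r) (h : ∀ᵐ x ∂(volume.restrict Z), G x = 0)
    (P : ℝ≥0∞) :
    eLpNorm G P (volume.restrict U) = eLpNorm G P (volume.restrict D) := by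
  rw [eLpNorm_congr_ae (hF.ae_eq_indicator h),
    eLpNorm_indicator_eq_eLpNorm_restrict hF.measurable_energy, hF.restrict_restrict]

/-- A limit field is extended by zero from `D` to `U`. Because `m ≤ r`, modular convergence on `D`
is `L^m` convergence on `U`, under which limits of test gradients are closed. -/
theorem isModularClosed (hF : IsFrame Ω U D Z m r) :
    IsModularClosed (volume.restrict D) r (gradSpace Ω U D Z hF.one_le) := by
  have := hF.isFiniteMeasure
  have hle : (volume : Measure (Rn n)).restrict D ≤ volume.restrict U :=
    Measure.restrict_mono hF.energy_subset le_rfl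
  obtain ⟨b, hb⟩ := hF.exponent_bounds
  refine ⟨?_, fun G hG h => ?_⟩
  · rintro G ⟨H, h1, -, h3⟩
    exact (h1.1.1.mono_measure hle).congr h3.symm
  · have hZ : ∀ x ∈ Z, D.indicator G x = 0 := fun x hx =>
      indicator_of_notMem (fun hD => hF.disjoint.le_bot ⟨hD, hx⟩) _
    have hL : MemLp (D.indicator G) (ENNReal.ofReal m) (volume.restrict U) := by
      rw [memLp_indicator_iff_restrict hF.measurable_energy, hF.restrict_restrict]
      exact hG.memLp hF.one_le fun x => (hb x).1
    refine ⟨D.indicator G, .of_approx hF.one_le hL fun ε hε => ?_, ?_, ?_⟩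
    · obtain ⟨η, hη, hη'⟩ := exists_forall_eLpNorm_lt_of_modular (H := Rn n)
        (μ := volume.restrict D) hF.one_le hb hε
      obtain ⟨G', ⟨H, h1, h2, h3⟩, h4, h5⟩ := h η hη
      refine ⟨H, h1, ?_⟩
      rw [hF.eLpNorm_eq]
      · refine lt_of_le_of_lt (le_of_eq (eLpNorm_congr_ae ?_)) (hη' _ h4 h5)
        filter_upwards [h3, ae_restrict_mem hF.measurable_energy] with x hx hxD
        rw [indicator_of_mem hxD, Pi.sub_apply, hx]
      · filter_upwards [h2, ae_restrict_mem hF.measurable_zero] with x hx hxZ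
        rw [hx, hZ x hxZ, sub_zero]
    · filter_upwards [ae_restrict_mem hF.measurable_zero] with x hx using hZ x hx
    · filter_upwards [ae_restrict_mem hF.measurable_energy] with x hx
      rw [indicator_of_mem hx]

theorem sub_mem_gradSpace (hF : IsFrame Ω U D Z m r) (hw : MemW U m w)
    (hwZ : ∀ᵐ x ∂(volume.restrict Z), weakGrad U w x = 0) (hu : IsCompetitor Ω U Z m (a • w) u) :
    weakGrad U u - a • weakGrad U w ∈ gradSpace Ω U D Z hF.one_le := by
  refine ⟨_, (IsGradLimit.of_vanishesOnBoundary hu.2.1).congr_ae ((hu.1.hasWeakGrad.sub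
    (hw.hasWeakGrad.const_smul a)).weakGrad_ae_eq hF.isOpen), ?_, Filter.EventuallyEq.rfl⟩
  filter_upwards [hwZ, hu.2.2] with x h1 h2
  simp [h1, h2]

/-- Together with `sub_mem_gradSpace` this translates between functions with prescribed boundary
values and fields in `a • weakGrad U w + gradSpace`, so the two minimization problems have the same
minimal energy. -/
theorem exists_isCompetitor (hF : IsFrame Ω U D Z m r) (hw : MemW U m w)
    (hwZ : ∀ᵐ x ∂(volume.restrict Z), weakGrad U w x = 0)
    (hG : G - a • weakGrad U w ∈ gradSpace Ω U D Z hF.one_le) :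
    ∃ u, IsCompetitor Ω U Z m (a • w) u ∧ weakGrad U u =ᵐ[volume.restrict D] G := by
  obtain ⟨H, h1, h2, h3⟩ := hG
  obtain ⟨v, hv, hvH⟩ := hF.exists_primitive H h1
  have hwg := ((hw.hasWeakGrad.const_smul a).add hvH).weakGrad_ae_eq hF.isOpen
  refine ⟨a • w + v, ⟨(hw.const_smul hF.isOpen a).add hF.isOpen hv.1, ?_, ?_⟩, ?_⟩
  · rwa [add_sub_cancel_left]
  · filter_upwards [ae_restrict_of_ae_restrict_of_subset hF.zero_subset hwg, hwZ, h2]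
      with x hx h4 h5
    simp [hx, h4, h5]
  · filter_upwards [ae_restrict_of_ae_restrict_of_subset hF.energy_subset hwg, h3] with x hx h4
    simp only [hx, Pi.add_apply, ← h4, Pi.sub_apply, add_sub_cancel]

variable {Φ : Rn n → Rn n → Rn n} {Q : Rn n → Rn n → ℝ}

theorem isEnergyMin_iff (hF : IsFrame Ω U D Z m r) (hw : MemW U m w)
    (hwZ : ∀ᵐ x ∂(volume.restrict Z), weakGrad U w x = 0)
    (hu : IsCompetitor Ω U Z m (a • w) u) :
    IsEnergyMin (volume.restrict D) Q (gradSpace Ω U D Z hF.one_le) (weakGrad U w) a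
        (weakGrad U u) ↔
      ∀ v, IsCompetitor Ω U Z m (a • w) v →
        energy (volume.restrict D) Q (weakGrad U u) ≤
          energy (volume.restrict D) Q (weakGrad U v) := by
  have := hF.isFiniteMeasure
  refine ⟨fun h v hv => h.2 _ (hF.sub_mem_gradSpace hw hwZ hv),
    fun h => ⟨hF.sub_mem_gradSpace hw hwZ hu, fun G hG => ?_⟩⟩
  obtain ⟨v, hv, hvG⟩ := hF.exists_isCompetitor hw hwZ hG
  rw [← energy_congr_ae hvG]
  exact h v hv

/-- The minimizers along the ray of data `a • w` and their energies. -/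
theorem exists_minimizers (hF : IsFrame Ω U D Z m r)
    (hm : IsMaterial (volume.restrict D) r Φ Q) (hw : MemW U m w)
    (hwZ : ∀ᵐ x ∂(volume.restrict Z), weakGrad U w x = 0)
    (hwr : MemModular (volume.restrict D) r (weakGrad U w)) :
    ∃ (L : ℝ → ℝ) (u : ℝ → Rn n → ℝ),
      (∀ a, IsCompetitor Ω U Z m (a • w) (u a) ∧ ∀ v, IsCompetitor Ω U Z m (a • w) v →
        energy (volume.restrict D) Q (weakGrad U (u a)) ≤
          energy (volume.restrict D) Q (weakGrad U v)) ∧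
      IntervalIntegrable L volume 0 1 ∧ 0 ≤ ∫ a in (0 : ℝ)..1, L a ∧
      ENNReal.ofReal (∫ a in (0 : ℝ)..1, L a) =
        energy (volume.restrict D) Q (weakGrad U (u 1)) ∧
      ∀ a v, IsCompetitor Ω U Z m (a • w) v → (∀ v', IsCompetitor Ω U Z m (a • w) v' →
        energy (volume.restrict D) Q (weakGrad U v) ≤
          energy (volume.restrict D) Q (weakGrad U v')) →
        ∀ w', IsCompetitor Ω U Z m w w' → MemModular (volume.restrict D) r (weakGrad U w') →
          IntegrableOn (fun x => inner ℝ (Φ x (weakGrad U v x)) (weakGrad U w' x)) D ∧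
          ∫ x in D, inner ℝ (Φ x (weakGrad U v x)) (weakGrad U w' x) = L a := by
  have := hF.isFiniteMeasure
  have hcl := hF.isModularClosed
  obtain ⟨b, hb⟩ := hm.exponent_bounds
  have hex : ∀ a : ℝ, ∃ u, IsCompetitor Ω U Z m (a • w) u ∧
      IsEnergyMin (volume.restrict D) Q (gradSpace Ω U D Z hF.one_le) (weakGrad U w) a
        (weakGrad U u) := by
    intro a
    obtain ⟨G, hG⟩ := hm.exists_isEnergyMin hcl hwr a
    obtain ⟨u, hu, huG⟩ := hF.exists_isCompetitor hw hwZ hG.1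
    refine ⟨u, hu, hF.sub_mem_gradSpace hw hwZ hu, fun G' hG' => ?_⟩
    rw [energy_congr_ae huG]
    exact hG.2 G' hG'
  choose u hu hmin using hex
  obtain ⟨h1, h2, h3⟩ := hm.integral_ray hcl hwr hmin
  refine ⟨_, u, fun a => ⟨hu a, (hF.isEnergyMin_iff hw hwZ (hu a)).1 (hmin a)⟩, h1, h3, h2,
    fun a v hv hvmin w' hw' hw'r => ?_⟩
  have hvmin' := (hF.isEnergyMin_iff hw hwZ hv).2 hvmin
  -- Uniqueness of the minimizing gradient makes the value independent of the potential.
  have hae := hm.isEnergyMin_ae_eq hcl hwr (hmin a) hvmin'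
  have hvr := hm.memModular_of_isEnergyMin hcl hwr hvmin'
  refine ⟨hm.integrable_inner hvr hw'r, ?_⟩
  -- Two extensions of the datum differ by an element of `gradSpace`, so by the Euler–Lagrange
  -- equation they give the same value.
  have hdiff : weakGrad U w' - weakGrad U w ∈ gradSpace Ω U D Z hF.one_le := by
    have := hF.sub_mem_gradSpace (a := 1) hw hwZ (by rwa [one_smul])
    rwa [one_smul] at this
  have hz := hm.integral_inner_eq_zero hcl hwr hvmin' hdiff
    (hw'r.sub hm.exponent_measurable hb hwr)
  have hs : ∫ x in D, inner ℝ (Φ x (weakGrad U v x)) ((weakGrad U w' - weakGrad U w) x) =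
      (∫ x in D, inner ℝ (Φ x (weakGrad U v x)) (weakGrad U w' x)) -
        ∫ x in D, inner ℝ (Φ x (weakGrad U v x)) (weakGrad U w x) := by
    rw [← integral_sub (hm.integrable_inner hvr hw'r) (hm.integrable_inner hvr hwr)]
    simp only [Pi.sub_apply, inner_sub_right]
  rw [hs, sub_eq_zero] at hz
  rw [hz]
  refine integral_congr_ae ?_
  filter_upwards [hae] with x hx
  rw [hx]

end IsFrame

end Frame

/-! ### The Dirichlet-to-Neumann operator -/

section DtN

variable {n : ℕ} {Ω A : Set (Rn n)} {p : ℝ} {k : Phase} {σ : Rn n → ℝ → ℝ≥0∞} {f u w : Rn n → ℝ}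

/-- The growth exponent in the inclusion. -/
def innerExponent (p : ℝ) : Phase → ℝ
  | .growth q => q
  | _ => p

/-- The set on which gradients of potentials have to vanish. -/
def zeroDomain (A : Set (Rn n)) : Phase → Set (Rn n)
  | .conductor => A
  | _ => ∅

open Classical in
/-- The growth exponent at a point. -/
noncomputable def exponent (p : ℝ) (k : Phase) (A : Set (Rn n)) (x : Rn n) : ℝ :=
  if x ∈ A then innerExponent p k else p

/-- One description for all phases: `innerExponent` is `p` except for growth inclusions, and
`zeroDomain` is empty except for conductors. -/
theorem isAdmissible_iff : IsAdmissible p k Ω A f u ↔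
    IsCompetitor Ω (potentialDomain k Ω A) (zeroDomain A k) (min p (innerExponent p k)) f u := by
  cases k <;> simp [IsAdmissible, IsCompetitor, potentialDomain, zeroDomain, innerExponent]

theorem one_lt_innerExponent (hp : 1 < p) (hk : IsPhase k A σ) : 1 < innerExponent p k := by
  cases k <;> first | exact hp | exact hk.1

theorem isOpen_potentialDomain (hΩ : IsOpen Ω) : IsOpen (potentialDomain k Ω A) := by
  cases k <;> first | exact hΩ | exact IsInclusion.isOpen_outer hΩ

theorem outer_subset : outer Ω A ⊆ Ω := sdiff_subset

theorem potentialDomain_subset : potentialDomain k Ω A ⊆ Ω := by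
  cases k <;> first | exact subset_rfl | exact outer_subset

/-- The Lipschitz boundary of `A` is a null set. -/
theorem restrict_eq_restrict_union (hA : IsInclusion Ω A) :
    (volume : Measure (Rn n)).restrict Ω = volume.restrict (outer Ω A ∪ A) := by
  refine Measure.restrict_congr_set (ae_eq_set.2 ⟨?_, ?_⟩)
  · refine measure_mono_null ?_ (volume_frontier_eq_zero hA.isOpen hA.lipschitz)
    rintro x ⟨hx, hx'⟩
    rw [hA.isOpen.frontier_eq]
    by_contra h
    exact hx' (by_contra fun h' => h ⟨by_contra fun h'' => h' (Or.inl ⟨hx, h''⟩),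
      fun h'' => h' (Or.inr h'')⟩)
  · rw [sdiff_eq_empty.2, measure_empty]
    exact union_subset outer_subset (subset_closure.trans hA.closure_subset)

theorem ae_mem_outer_or_mem (hΩ : IsOpen Ω) (hA : IsInclusion Ω A) :
    ∀ᵐ x ∂(volume.restrict Ω), x ∈ outer Ω A ∨ x ∈ A := by
  rw [restrict_eq_restrict_union hA]
  exact ae_restrict_mem
    ((IsInclusion.isOpen_outer hΩ).measurableSet.union hA.isOpen.measurableSet)

/-- Only the insulator needs Poincaré's inequality outside an inclusion; for the other phases
potentials live on `Ω`, and the case `A = ∅` is used. -/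
theorem isFrame [Nontrivial (Rn n)] (hΩ : IsLipschitzDomain Ω) (hA : IsInclusion Ω A)
    (hp : 1 < p) (hσ : IsConductivity p k Ω A σ) :
    IsFrame Ω (potentialDomain k Ω A) (energyDomain k Ω A) (zeroDomain A k)
      (min p (innerExponent p k)) (exponent p k A) := by
  have hq := one_lt_innerExponent hp hσ.phase
  have hm : 1 ≤ min p (innerExponent p k) := (lt_min hp hq).le
  refine ⟨isOpen_potentialDomain hΩ.isOpen,
    ((measure_mono potentialDomain_subset).trans_lt hΩ.isBounded.measure_lt_top).ne, ?_, ?_, ?_, ?_,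
    ?_, ?_, hm, ⟨max p (innerExponent p k), fun x => ?_⟩, fun H hH => ?_⟩
  · cases k <;>
      first | exact hΩ.isOpen.measurableSet |
        exact (IsInclusion.isOpen_outer hΩ.isOpen).measurableSet
  · cases k <;> first | exact hA.isOpen.measurableSet | exact MeasurableSet.empty
  · cases k <;> first | exact subset_rfl | exact outer_subset
  · cases k <;> first | exact subset_closure.trans hA.closure_subset | exact empty_subset _
  · cases k <;> first | exact disjoint_bot_right |
      exact disjoint_left.2 fun x hx hxA => hx.2 (subset_closure hxA)
  · cases k <;> first | exact ae_mem_outer_or_mem hΩ.isOpen hA |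
      (exact (ae_restrict_mem hΩ.isOpen.measurableSet).mono fun x hx => Or.inl hx) |
      (exact (ae_restrict_mem (IsInclusion.isOpen_outer hΩ.isOpen).measurableSet).mono
        fun x hx => Or.inl hx)
  · unfold exponent
    split_ifs
    · exact ⟨min_le_right _ _, le_max_right _ _⟩
    · exact ⟨min_le_left _ _, le_max_left _ _⟩
  · have h1 : ∀ {B : Set (Rn n)}, IsInclusion Ω B → ∀ {m : ℝ}, 1 ≤ m →
        IsGradLimit Ω (outer Ω B) m H →
        ∃ v : Rn n → ℝ, VanishesOnBoundary Ω (outer Ω B) m v ∧ HasWeakGrad (outer Ω B) v H :=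
      fun hB _ hm h => h.exists_vanishesOnBoundary hm hΩ.isOpen hΩ.isBounded hB
    have h2 := h1 (isInclusion_empty hΩ.isConnected) hm
    rw [outer_empty] at h2
    cases k <;> first | exact h1 hA hm hH | exact h2 hH

theorem IsConductivity.isMaterial [Nontrivial (Rn n)] (hΩ : IsOpen Ω) (hA : IsInclusion Ω A)
    (hp : 1 < p) (hσ : IsConductivity p k Ω A σ) :
    IsMaterial (volume.restrict (energyDomain k Ω A)) (exponent p k A) (flux σ)
      (fun x ξ => (energyDensity σ x ‖ξ‖).toReal) := by
  have hq := one_lt_innerExponent hp hσ.phase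
  have hr : Measurable (exponent p k A) :=
    Measurable.ite hA.isOpen.measurableSet measurable_const measurable_const
  have hB : ∀ x, 1 ≤ exponent p k A x ∧ exponent p k A x ≤ max p (innerExponent p k) := by
    intro x
    unfold exponent
    split_ifs
    · exact ⟨hq.le, le_max_right _ _⟩
    · exact ⟨hp.le, le_max_left _ _⟩
  have ho : IsMaterial (volume.restrict (outer Ω A)) (exponent p k A) (flux σ)
      (fun x ξ => (energyDensity σ x ‖ξ‖).toReal) := by
    refine isMaterial_restrict hp hσ.caratheodory_outer hσ.growth hσ.monotone hr hB ?_
    filter_upwards [ae_restrict_mem (IsInclusion.isOpen_outer hΩ).measurableSet] with x hx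
    exact if_neg fun h => hx.2 (subset_closure h)
  cases k with
  | empty =>
    obtain rfl : A = ∅ := hσ.phase
    rwa [outer_empty] at ho
  | growth q =>
    change IsMaterial (volume.restrict Ω) _ _ _
    rw [restrict_eq_restrict_union hA]
    refine ho.union
      (isMaterial_restrict hq hσ.caratheodory_inner hσ.phase.2.1 hσ.phase.2.2 hr hB ?_)
    filter_upwards [ae_restrict_mem hA.isOpen.measurableSet] with x hx
    exact if_pos hx
  | insulator => exact ho
  | conductor => exact ho

/-- The density is finite a.e. on the energy domain, so passing to real values loses nothing. -/
theorem dirichletEnergy_eq_energy [Nontrivial (Rn n)] (hA : IsInclusion Ω A)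
    (hσ : IsConductivity p k Ω A σ) :
    dirichletEnergy k Ω A σ u = energy (volume.restrict (energyDomain k Ω A))
      (fun x ξ => (energyDensity σ x ‖ξ‖).toReal) (weakGrad (potentialDomain k Ω A) u) := by
  have ho := energyDensity_ne_top_ae hσ.caratheodory_outer hσ.growth hσ.monotone
  have : ∀ᵐ x ∂(volume.restrict (energyDomain k Ω A)), ∀ E, energyDensity σ x E ≠ ⊤ := by
    cases k with
    | empty =>
      obtain rfl : A = ∅ := hσ.phase
      rwa [outer_empty] at ho
    | growth q =>
      change ∀ᵐ x ∂(volume.restrict Ω), _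
      rw [restrict_eq_restrict_union hA]
      exact (ae_restrict_union_iff _ _ _).2
        ⟨ho, energyDensity_ne_top_ae hσ.caratheodory_inner hσ.phase.2.1 hσ.phase.2.2⟩
    | insulator => exact ho
    | conductor => exact ho
  refine lintegral_congr_ae ?_
  filter_upwards [this] with x hx
  exact (ENNReal.ofReal_toReal (hx _)).symm

theorem MemLp.memModular {X H : Type*} [MeasurableSpace X] [NormedAddCommGroup H]
    {μ : Measure X} {q : ℝ} (hq : 0 < q) {r : X → ℝ} (hr : ∀ᵐ x ∂μ, r x = q) {G : X → H}
    (hG : MemLp G (ENNReal.ofReal q) μ) : MemModular μ r G := by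
  refine ⟨hG.1, ?_⟩
  have h1 := (integrable_norm_rpow_iff hG.1 (by simpa using hq) ENNReal.ofReal_ne_top).2 hG
  rw [ENNReal.toReal_ofReal hq.le] at h1
  refine h1.congr ?_
  filter_upwards [hr] with x hx
  rw [hx]

/-- Gradients of test extensions have finite modular. -/
theorem IsTestExtension.memModular (hΩ : IsOpen Ω) (hA : IsInclusion Ω A) (hp : 1 < p)
    (hk : IsPhase k A σ) (hw : IsTestExtension p k Ω A f w) :
    MemModular (volume.restrict (energyDomain k Ω A)) (exponent p k A)
      (weakGrad (potentialDomain k Ω A) w) := by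
  have hp0 : 0 < p := by linarith
  have hO : IsOpen (outer Ω A) := IsInclusion.isOpen_outer hΩ
  have ho : ∀ᵐ x ∂(volume.restrict (outer Ω A)), exponent p k A x = p := by
    filter_upwards [ae_restrict_mem hO.measurableSet] with x hx
    exact if_neg fun h => hx.2 (subset_closure h)
  cases k with
  | empty =>
    refine MemLp.memModular hp0 (ae_of_all _ fun x => ?_) hw.1.1.2.2
    unfold exponent
    split_ifs <;> rfl
  | growth q =>
    have hi : ∀ᵐ x ∂(volume.restrict A), exponent p (.growth q) A x = q := by
      filter_upwards [ae_restrict_mem hA.isOpen.measurableSet] with x hx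
      exact if_pos hx
    have hg := hw.1.1.hasWeakGrad
    have h1 : MemModular (volume.restrict (outer Ω A)) (exponent p (.growth q) A) (weakGrad Ω w) :=
      MemLp.memModular hp0 ho
        ((memLp_congr_ae ((hg.mono outer_subset).weakGrad_ae_eq hO)).1 hw.2.1.2.2)
    have h2 : MemModular (volume.restrict A) (exponent p (.growth q) A) (weakGrad Ω w) :=
      MemLp.memModular (by linarith [hk.1]) hi ((memLp_congr_ae
        ((hg.mono (subset_closure.trans hA.closure_subset)).weakGrad_ae_eq hA.isOpen)).1
          hw.2.2.2.2)
    change MemModular (volume.restrict Ω) _ (weakGrad Ω w)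
    rw [restrict_eq_restrict_union hA]
    exact ⟨aestronglyMeasurable_union_iff.2 ⟨h1.1, h2.1⟩, IntegrableOn.union h1.2 h2.2⟩
  | insulator => exact MemLp.memModular hp0 ho hw.1.1.2.2
  | conductor =>
    exact MemLp.memModular hp0 ho
      (hw.1.1.2.2.mono_measure (Measure.restrict_mono outer_subset le_rfl))

/-- Boundary data have test extensions vanishing in the inclusion. -/
theorem exists_isTestExtension (hΩ : IsOpen Ω) (hb : Bornology.IsBounded Ω) (hA : IsInclusion Ω A)
    (hp : 1 < p) (hk : IsPhase k A σ) (hf : MemW Ω p f) : ∃ w, IsTestExtension p k Ω A f w := by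
  obtain ⟨w, h1, h2, h3⟩ := exists_extension_eq_zero hp.le hΩ hb hA.closure_subset hf
  have hU : IsOpen (potentialDomain k Ω A) := isOpen_potentialDomain hΩ
  have hm : 1 ≤ min p (innerExponent p k) := (lt_min hp (one_lt_innerExponent hp hk)).le
  have hΩf : volume Ω ≠ ⊤ := hb.measure_lt_top.ne
  have hUf : volume (potentialDomain k Ω A) ≠ ⊤ :=
    ((measure_mono potentialDomain_subset).trans_lt hΩf.lt_top).ne
  have hAΩ : A ⊆ Ω := subset_closure.trans hA.closure_subset
  refine ⟨w, isAdmissible_iff.2 ⟨h1.mono hU hΩf potentialDomain_subset (min_le_left _ _),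
    (h2.mono_set hU potentialDomain_subset hΩf).mono_exponent hU hUf hm (min_le_left _ _), ?_⟩, ?_⟩
  · cases k <;> first | exact weakGrad_ae_eq_zero_of_eq_zero hA.isOpen hAΩ h1 h3 |
      simp [zeroDomain]
  · cases k with
    | growth q =>
      -- Since `w` vanishes on `A`, it belongs to `W^{1,q}(A)` whatever the relation between `q` and
      -- `p`.
      have h0 : w =ᵐ[volume.restrict A] 0 := by
        filter_upwards [ae_restrict_mem hA.isOpen.measurableSet] with x hx using h3 x hx
      refine ⟨h1.mono (IsInclusion.isOpen_outer hΩ) hΩf outer_subset le_rfl,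
        .of_hasWeakGrad hA.isOpen (h1.hasWeakGrad.mono hAΩ)
          ((memLp_congr_ae h0).2 MemLp.zero) ((memLp_congr_ae (g := 0) ?_).2 MemLp.zero)⟩
      exact weakGrad_ae_eq_zero_of_eq_zero hA.isOpen hAΩ h1 h3
    | _ => trivial

/-- Replacing a boundary datum by one of its extensions. -/
theorem isAdmissible_congr (hΩ : IsOpen Ω) (hp : 1 < p) (hk : IsPhase k A σ)
    (hw : IsAdmissible p k Ω A f w) (a : ℝ) :
    IsAdmissible p k Ω A (a • f) u ↔ IsAdmissible p k Ω A (a • w) u := by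
  rw [isAdmissible_iff] at hw
  rw [isAdmissible_iff, isAdmissible_iff]
  have hU : IsOpen (potentialDomain k Ω A) := isOpen_potentialDomain hΩ
  have hm : 1 ≤ min p (innerExponent p k) := (lt_min hp (one_lt_innerExponent hp hk)).le
  refine and_congr_right fun _ => and_congr_left fun _ => ⟨fun h => ?_, fun h => ?_⟩
  · have := h.add hm hU (hw.2.1.const_smul hU (-a))
    convert this using 1
    ext1 x
    simp only [Pi.sub_apply, Pi.add_apply, Pi.smul_apply, smul_eq_mul]
    ring
  · have := h.add hm hU (hw.2.1.const_smul hU a)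
    convert this using 1
    ext1 x
    simp only [Pi.sub_apply, Pi.add_apply, Pi.smul_apply, smul_eq_mul]
    ring

/-- The average Dirichlet-to-Neumann form of a datum is the energy of its potential. -/
theorem avgDtN_eq_energy [Nontrivial (Rn n)] (hΩ : IsLipschitzDomain Ω) (hA : IsInclusion Ω A)
    (hp : 1 < p) (hσ : IsConductivity p k Ω A σ) (hf : MemW Ω p f) :
    AvgDtNWellDefined p k Ω A σ f f ∧ 0 ≤ avgDtN p k Ω A σ f f ∧
      ∃ u, IsPotential p k Ω A σ f u ∧
        dirichletEnergy k Ω A σ u = ENNReal.ofReal (avgDtN p k Ω A σ f f) := by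
  have hΩo := hΩ.isOpen
  obtain ⟨w, hw⟩ := exists_isTestExtension hΩo hΩ.isBounded hA hp hσ.phase hf
  have hF := isFrame hΩ hA hp hσ
  have hwr := hw.memModular hΩo hA hp hσ.phase
  have hwc := isAdmissible_iff.1 hw.1
  have hcomp : ∀ {a : ℝ} {v}, IsAdmissible p k Ω A (a • f) v ↔
      IsCompetitor Ω (potentialDomain k Ω A) (zeroDomain A k) (min p (innerExponent p k))
        (a • w) v := fun {a v} => (isAdmissible_congr hΩo hp hσ.phase hw.1 a).trans isAdmissible_iff
  obtain ⟨L, u, hu, hL, hL0, hLE, hval⟩ :=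
    hF.exists_minimizers (IsConductivity.isMaterial hΩo hA hp hσ) hwc.1 hwc.2.2 hwr
  simp only [← dirichletEnergy_eq_energy hA hσ, ← hcomp] at hu hLE hval
  have htest : ∀ {w'}, IsTestExtension p k Ω A f w' →
      IsCompetitor Ω (potentialDomain k Ω A) (zeroDomain A k) (min p (innerExponent p k)) w w' :=
    fun {w'} h => by
      have := hcomp (a := 1) (v := w')
      rw [one_smul, one_smul] at this
      exact this.1 h.1
  -- `L a` is the only admissible value, so the choice operator in `dtn` can return nothing else.
  have hiff : ∀ a ℓ, IsDtNValue p k Ω A σ (a • f) f ℓ ↔ ℓ = L a := by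
    refine fun a ℓ => ⟨?_, ?_⟩
    · rintro ⟨v, hv, h⟩
      rw [← (h w hw).2]
      exact (hval a v hv.1 hv.2 w (htest hw) hwr).2
    · rintro rfl
      exact ⟨u a, hu a, fun w' hw' =>
        hval a (u a) (hu a).1 (hu a).2 w' (htest hw') (hw'.memModular hΩo hA hp hσ.phase)⟩
  have hdtn : ∀ a, dtn p k Ω A σ (a • f) f = L a := fun a =>
    (hiff a _).1 (Classical.epsilon_spec ⟨L a, (hiff a _).2 rfl⟩)
  have havg : avgDtN p k Ω A σ f f = ∫ a in (0 : ℝ)..1, L a := by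
    simp only [avgDtN, hdtn]
  refine ⟨⟨fun a _ => ⟨L a, (hiff a _).2 rfl, fun ℓ h => (hiff a ℓ).1 h⟩, by simpa only [hdtn]⟩,
    by rwa [havg], u 1, ?_, by rw [havg, hLE]⟩
  have := hu 1
  rwa [one_smul] at this

end DtN

/-! ### Comparison of energies -/

section Comparison

variable {n : ℕ} {Ω A₁ A₂ : Set (Rn n)} {p : ℝ} {k₁ k₂ : Phase} {σ₁ σ₂ : Rn n → ℝ → ℝ≥0∞}
  {f u : Rn n → ℝ}

theorem energyDensity_mono {x : Rn n} (h : ∀ E : ℝ, 0 < E → σ₁ x E ≤ σ₂ x E) (E : ℝ) :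
    energyDensity σ₁ x E ≤ energyDensity σ₂ x E :=
  setLIntegral_mono' measurableSet_Ioc fun ξ hξ => by
    gcongr
    exact h ξ hξ.1

/-- An open null set is empty, so an almost-everywhere incompatibility of the two materials becomes
an inclusion of sets. -/
theorem subset_closure_of_ae_notMem_outer (hΩ : IsOpen Ω) (hA : IsInclusion Ω A₁)
    (h : ∀ᵐ x ∂(volume.restrict Ω), x ∈ A₁ → x ∉ outer Ω A₂) : A₁ ⊆ closure A₂ := by
  have hAΩ : A₁ ⊆ Ω := subset_closure.trans hA.closure_subset
  have h0 : A₁ ∩ outer Ω A₂ = ∅ := by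
    refine ((hA.isOpen.inter (IsInclusion.isOpen_outer hΩ)).measure_eq_zero_iff
      (volume : Measure (Rn n))).1 ?_
    rw [ae_restrict_iff' hΩ.measurableSet, ae_iff] at h
    refine measure_mono_null (fun x hx => ?_) h
    simp only [mem_ofPred_eq, Classical.not_imp, not_not]
    exact ⟨hAΩ hx.1, hx.1, hx.2⟩
  intro x hx
  by_contra h'
  exact h0.subset ⟨hx, hAΩ hx, h'⟩

theorem HasGrowthOn.pos_and_ne_top {S : Set (Rn n)} (h : HasGrowthOn p S σ₁) :
    ∀ᵐ x ∂(volume.restrict S), 0 < σ₁ x 1 ∧ σ₁ x 1 ≠ ⊤ := by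
  obtain ⟨a, b, E₀, ha, hab, hE₀, h⟩ := h
  filter_upwards [h] with x hx
  obtain ⟨h1, h2⟩ := hx 1 one_pos
  refine ⟨lt_of_lt_of_le (ENNReal.ofReal_pos.2 (by positivity)) h1, ne_top_of_le_ne_top ?_ h2⟩
  split_ifs <;> exact ENNReal.ofReal_ne_top

/-- The potential `u` need not lie in the Sobolev space attached to `σ₁`. Its finite `σ₁`-energy
puts the gradient in `L^{min p q₁}`, and a competitor is rebuilt as `f + v`, where `v` has zero
boundary values and gradient `∇u - ∇f`. -/
theorem exists_isAdmissible_growth [Nontrivial (Rn n)] {q₁ q₂ : ℝ} (hΩ : IsLipschitzDomain Ω)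
    (hA₁ : IsInclusion Ω A₁) (hp : 1 < p) (hσ₁ : IsConductivity p (.growth q₁) Ω A₁ σ₁)
    (hσ₂ : IsConductivity p (.growth q₂) Ω A₂ σ₂)
    (hle : ∀ᵐ x ∂(volume.restrict Ω), ∀ E : ℝ, 0 < E → σ₁ x E ≤ σ₂ x E) (hf : MemW Ω p f)
    (hu : IsAdmissible p (.growth q₂) Ω A₂ f u)
    (hE : dirichletEnergy (.growth q₂) Ω A₂ σ₂ u < ⊤) :
    ∃ v, IsAdmissible p (.growth q₁) Ω A₁ f v ∧
      dirichletEnergy (.growth q₁) Ω A₁ σ₁ v ≤ dirichletEnergy (.growth q₂) Ω A₂ σ₂ u := by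
  have hΩf : volume Ω ≠ ⊤ := hΩ.isBounded.measure_lt_top.ne
  have hm₁ : 1 ≤ min p q₁ := (lt_min hp hσ₁.phase.1).le
  have hm₂ : 1 ≤ min p q₂ := (lt_min hp hσ₂.phase.1).le
  have hEle : dirichletEnergy (.growth q₁) Ω A₁ σ₁ u ≤ dirichletEnergy (.growth q₂) Ω A₂ σ₂ u := by
    refine lintegral_mono_ae ?_
    filter_upwards [hle] with x hx using energyDensity_mono hx _
  have hF := isFrame hΩ hA₁ hp hσ₁
  have : IsFiniteMeasure ((volume : Measure (Rn n)).restrict Ω) := hF.isFiniteMeasure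
  obtain ⟨b, hb⟩ := hF.exponent_bounds
  have hgu : MemLp (weakGrad Ω u) (ENNReal.ofReal (min p q₁)) (volume.restrict Ω) := by
    have h1 := hEle.trans_lt hE
    rw [dirichletEnergy_eq_energy hA₁ hσ₁] at h1
    have h2 : IsMaterial (volume.restrict Ω) _ _ _ :=
      IsConductivity.isMaterial hΩ.isOpen hA₁ hp hσ₁
    exact (h2.memModular_of_energy_lt_top hu.1.2.2.1 h1).memLp hF.one_le fun x => (hb x).1
  have hfm : MemW Ω (min p q₁) f := hf.mono hΩ.isOpen hΩf subset_rfl (min_le_left _ _)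
  have hd := (hu.1.hasWeakGrad.sub hf.hasWeakGrad).weakGrad_ae_eq hΩ.isOpen
  -- The difference has zero boundary values in the sense of exponent `min p q₂`; since it also lies
  -- in `L^{min p q₁}`, the exponent can be changed. The Lipschitz boundary of `Ω` is needed for
  -- this.
  have hlim : IsGradLimit Ω Ω (min p q₁) (weakGrad Ω u - weakGrad Ω f) :=
    ((IsGradLimit.of_vanishesOnBoundary hu.2).congr_ae hd).of_memLp hm₂ hm₁ hΩ (hgu.sub hfm.2.2)
  obtain ⟨v, hv, hvg⟩ : ∃ v, VanishesOnBoundary Ω Ω (min p q₁) v ∧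
      HasWeakGrad Ω v (weakGrad Ω u - weakGrad Ω f) := hF.exists_primitive _ hlim
  have hfv := (hf.hasWeakGrad.add hvg).weakGrad_ae_eq hΩ.isOpen
  refine ⟨f + v, ⟨hfm.add hΩ.isOpen hv.1, by rwa [add_sub_cancel_left]⟩,
    le_trans (le_of_eq ?_) hEle⟩
  refine lintegral_congr_ae ?_
  filter_upwards [hfv] with x hx
  simp only [potentialGrad, potentialDomain, hx, Pi.add_apply, Pi.sub_apply, add_sub_cancel]

/-- On `A₂` one has `σ₁ ≤ σ₂ = 0`, whereas `σ₁ > 0` outside `closure A₁`. So `A₂ ⊆ closure A₁`, and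
restricting `u` shrinks both the domain of integration and the density. -/
theorem isAdmissible_insulator (hΩ : IsOpen Ω) (hb : Bornology.IsBounded Ω)
    (hA₂ : IsInclusion Ω A₂) (hσ₁ : IsConductivity p .insulator Ω A₁ σ₁)
    (hσ₂ : IsConductivity p .insulator Ω A₂ σ₂)
    (hle : ∀ᵐ x ∂(volume.restrict Ω), ∀ E : ℝ, 0 < E → σ₁ x E ≤ σ₂ x E)
    (hu : IsAdmissible p .insulator Ω A₂ f u) :
    IsAdmissible p .insulator Ω A₁ f u ∧
      dirichletEnergy .insulator Ω A₁ σ₁ u ≤ dirichletEnergy .insulator Ω A₂ σ₂ u := by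
  have hO₁ : IsOpen (outer Ω A₁) := IsInclusion.isOpen_outer hΩ
  have hsub : A₂ ⊆ closure A₁ := by
    refine subset_closure_of_ae_notMem_outer hΩ hA₂ ?_
    have h1 := ae_restrict_of_ae (s := Ω)
      ((ae_restrict_iff' hO₁.measurableSet).1 hσ₁.growth.pos_and_ne_top)
    have h2 := ae_restrict_of_ae (s := Ω)
      ((ae_restrict_iff' hA₂.isOpen.measurableSet).1 hσ₂.phase)
    filter_upwards [hle, h1, h2] with x h3 h4 h5 hx hx'
    have := h3 1 one_pos
    rw [h5 hx 1 one_pos] at this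
    exact absurd (h4 hx').1 (not_lt.2 this)
  have hB : outer Ω A₁ ⊆ outer Ω A₂ :=
    sdiff_subset_sdiff_right (closure_minimal hsub isClosed_closure)
  have hf₂ : volume (outer Ω A₂) ≠ ⊤ := (hb.subset outer_subset).measure_lt_top.ne
  refine ⟨⟨hu.1.mono hO₁ hf₂ hB le_rfl, hu.2.mono_set hO₁ hB hf₂⟩, ?_⟩
  have hae := (hu.1.hasWeakGrad.mono hB).weakGrad_ae_eq hO₁
  calc dirichletEnergy .insulator Ω A₁ σ₁ u
      ≤ ∫⁻ x in outer Ω A₁, energyDensity σ₂ x ‖weakGrad (outer Ω A₂) u x‖ := by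
        refine lintegral_mono_ae ?_
        filter_upwards [hae, ae_restrict_of_ae_restrict_of_subset outer_subset hle] with x hx hx'
        simp only [potentialGrad, potentialDomain, hx]
        exact energyDensity_mono hx' _
    _ ≤ dirichletEnergy .insulator Ω A₂ σ₂ u := lintegral_mono_set hB

/-- On `A₁` one has `σ₂ ≥ σ₁ = ∞`, whereas `σ₂` is finite outside `closure A₂`. So `A₁ ⊆ closure
A₂`; as `∂A₂` is null, the gradient of `u` vanishes a.e. on `A₁`, and it carries no energy where
only `σ₁` is being integrated. -/
theorem isAdmissible_conductor (hΩ : IsOpen Ω)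
    (hA₁ : IsInclusion Ω A₁) (hA₂ : IsInclusion Ω A₂)
    (hσ₁ : IsConductivity p .conductor Ω A₁ σ₁) (hσ₂ : IsConductivity p .conductor Ω A₂ σ₂)
    (hle : ∀ᵐ x ∂(volume.restrict Ω), ∀ E : ℝ, 0 < E → σ₁ x E ≤ σ₂ x E)
    (hu : IsAdmissible p .conductor Ω A₂ f u) :
    IsAdmissible p .conductor Ω A₁ f u ∧
      dirichletEnergy .conductor Ω A₁ σ₁ u ≤ dirichletEnergy .conductor Ω A₂ σ₂ u := by
  have hO₂ : IsOpen (outer Ω A₂) := IsInclusion.isOpen_outer hΩ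
  have hsub : A₁ ⊆ closure A₂ := by
    refine subset_closure_of_ae_notMem_outer hΩ hA₁ ?_
    have h1 := ae_restrict_of_ae (s := Ω)
      ((ae_restrict_iff' hO₂.measurableSet).1 hσ₂.growth.pos_and_ne_top)
    have h2 := ae_restrict_of_ae (s := Ω)
      ((ae_restrict_iff' hA₁.isOpen.measurableSet).1 hσ₁.phase)
    filter_upwards [hle, h1, h2] with x h3 h4 h5 hx hx'
    have := h3 1 one_pos
    rw [h5 hx 1 one_pos] at this
    exact (h4 hx').2 (top_le_iff.1 this)
  have hz : ∀ᵐ x ∂(volume.restrict Ω), x ∈ outer Ω A₂ ∨ weakGrad Ω u x = 0 := by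
    have h1 := ae_restrict_of_ae (s := Ω)
      ((ae_restrict_iff' hA₂.isOpen.measurableSet).1 hu.2.2)
    filter_upwards [ae_mem_outer_or_mem hΩ hA₂, h1] with x hx hx'
    exact hx.imp_right hx'
  refine ⟨⟨hu.1, hu.2.1, ?_⟩, ?_⟩
  · filter_upwards [ae_restrict_of_ae_restrict_of_subset
      (subset_closure.trans hA₁.closure_subset) hz, ae_restrict_mem hA₁.isOpen.measurableSet]
      with x hx hx'
    exact hx.resolve_left fun h => h.2 (hsub hx')
  · calc dirichletEnergy .conductor Ω A₁ σ₁ u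
        ≤ ∫⁻ x in outer Ω A₁,
            (outer Ω A₂).indicator (fun x => energyDensity σ₂ x ‖weakGrad Ω u x‖) x := by
          refine lintegral_mono_ae ?_
          filter_upwards [ae_restrict_of_ae_restrict_of_subset outer_subset hz,
            ae_restrict_of_ae_restrict_of_subset outer_subset hle] with x hx hx'
          rcases hx with hx | hx
          · rw [indicator_of_mem hx]
            exact energyDensity_mono hx' _
          · simp [potentialGrad, potentialDomain, hx, energyDensity]
      _ = ∫⁻ x in outer Ω A₂ ∩ outer Ω A₁, energyDensity σ₂ x ‖weakGrad Ω u x‖ := by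
          rw [lintegral_indicator hO₂.measurableSet, Measure.restrict_restrict hO₂.measurableSet]
      _ ≤ dirichletEnergy .conductor Ω A₂ σ₂ u := lintegral_mono_set inter_subset_left

end Comparison

/-! ### Monotonicity of the average Dirichlet-to-Neumann form -/

theorem theorem5p3 {n : ℕ} (hn : 2 ≤ n) (Ω A₁ A₂ : Set (Rn n))
    (hΩ : IsLipschitzDomain Ω) (hA₁ : IsInclusion Ω A₁) (hA₂ : IsInclusion Ω A₂)
    (p : ℝ) (hp : 1 < p) (k₁ k₂ : Phase) (σ₁ σ₂ : Rn n → ℝ → ℝ≥0∞)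
    (hσ₁ : IsConductivity p k₁ Ω A₁ σ₁) (hσ₂ : IsConductivity p k₂ Ω A₂ σ₂)
    (hcase : (k₁ = Phase.empty ∧ k₂ = Phase.empty) ∨
      (∃ q₁ q₂ : ℝ, k₁ = Phase.growth q₁ ∧ k₂ = Phase.growth q₂) ∨
      (k₁ = Phase.insulator ∧ k₂ = Phase.insulator) ∨
      (k₁ = Phase.conductor ∧ k₂ = Phase.conductor))
    (hle : ∀ᵐ x ∂(volume.restrict Ω), ∀ E : ℝ, 0 < E → σ₁ x E ≤ σ₂ x E)
    (f : Rn n → ℝ) (hf : MemXDiamond Ω p f) :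
    AvgDtNWellDefined p k₁ Ω A₁ σ₁ f f ∧ AvgDtNWellDefined p k₂ Ω A₂ σ₂ f f ∧
      avgDtN p k₁ Ω A₁ σ₁ f f ≤ avgDtN p k₂ Ω A₂ σ₂ f f := by
  have : Nonempty (Fin n) := ⟨⟨0, by omega⟩⟩
  have : Nontrivial (Rn n) := inferInstance
  obtain ⟨hwd₁, h0₁, u₁, hu₁, hE₁⟩ := avgDtN_eq_energy hΩ hA₁ hp hσ₁ hf.1
  obtain ⟨hwd₂, h0₂, u₂, hu₂, hE₂⟩ := avgDtN_eq_energy hΩ hA₂ hp hσ₂ hf.1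
  refine ⟨hwd₁, hwd₂, ?_⟩
  -- Each kind of inclusion turns the potential of `σ₂` into a competitor for `σ₁` without raising
  -- the energy.
  have hcomp : ∃ v, IsAdmissible p k₁ Ω A₁ f v ∧
      dirichletEnergy k₁ Ω A₁ σ₁ v ≤ dirichletEnergy k₂ Ω A₂ σ₂ u₂ := by
    rcases hcase with ⟨rfl, rfl⟩ | ⟨q₁, q₂, rfl, rfl⟩ | ⟨rfl, rfl⟩ | ⟨rfl, rfl⟩
    · refine ⟨u₂, hu₂.1, lintegral_mono_ae ?_⟩
      filter_upwards [hle] with x hx using energyDensity_mono hx _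
    · exact exists_isAdmissible_growth hΩ hA₁ hp hσ₁ hσ₂ hle hf.1 hu₂.1
        (hE₂ ▸ ENNReal.ofReal_lt_top)
    · exact ⟨u₂, isAdmissible_insulator hΩ.isOpen hΩ.isBounded hA₂ hσ₁ hσ₂ hle hu₂.1⟩
    · exact ⟨u₂, isAdmissible_conductor hΩ.isOpen hA₁ hA₂ hσ₁ hσ₂ hle hu₂.1⟩
  obtain ⟨v, hv, hvE⟩ := hcomp
  -- Both average forms are minimal energies, and the potential of `σ₁` does at least as well as the
  -- competitor `v`.
  rw [← ENNReal.ofReal_le_ofReal_iff h0₂, ← hE₁, ← hE₂]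
  exact (hu₁.2 v hv).trans hvE
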